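/- Let $n\ge 2$ and $C\neq 0$, put $\varepsilon=C/|C|$, $R=1/\sqrt{|C|}$, and let $\langle x,y\rangle=\varepsilon x_1y_1+x_2y_2+\dots+x_{n+1}y_{n+1}$ on $\mathbb{R}^{n+1}$. Let $\mathbb{M}^n(C)=\{p:\langle p,p\rangle=1/C\}$ be the sphere if $C>0$, and its sheet $p_1>0$ (hyperbolic space) if $C<0$. Let $f=\cos,\ g=\sin$ if $C>0$ and $f=\cosh,\ g=\sinh$ if $C<0$, so that $\exp_p(zv)=f(z/R)\,p+R\,g(z/R)\,v$ for a unit vector $v\in T_p\mathbb{M}^n(C)$. The totally umbilical hypersurfaces of $\mathbb{M}^n(C)$ are its nonempty intersections $Q^{n-1}$ with affine hyperplanes $\{p:\langle w,p\rangle=c\}$ that are nowhere tangent to $\mathbb{M}^n(C)$. Let $M$ be a connected (immersed) smooth hypersurface of $\mathbb{M}^n(C)$. Suppose that $M$ is concircular with axis $V$: $V$ is a smooth vector field on $\mathbb{M}^n(C)$, not identically zero, with $\overline\nabla V=\mu I$ for a smooth function $\mu$, where $\overline\nabla$ is the Levi-Civita connection of $\mathbb{M}^n(C)$, and $\langle N,V\rangle$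 is constant along $M$ for (locally chosen) smooth unit normal fields $N$ of $M$. Suppose that $M$ is nontrivial: it is not contained in a totally umbilical hypersurface of $\mathbb{M}^n(C)$. Then every point $q$ of $M$ has an open neighbourhood $U$ in $M$, on which the immersion is injective, with the following property. There are a totally umbilical hypersurface $Q^{n-1}$, an embedded hypersurface $P^{n-2}$ of $Q^{n-1}$, a smooth unit normal field $\eta_1$ of $P^{n-2}$ in $Q^{n-1}$, a smooth unit normal field $\eta_2$, along $P^{n-2}$, of $Q^{n-1}$ in $\mathbb{M}^n(C)$, a constant $a\in\mathbb{R}$ and an interval $I_0$ that is a neighbourhood of $0$ such that, with $W_a=\cos(a)\,\eta_1+\sin(a)\,\eta_2$ and $$\Psi_a(p,z)=\exp_p(zW_a(p))=f\Big(\frac zR\Big)p+R\,g\Big(\frac zR\Big)W_a(p),$$ the image of $U$ in $\mathbb{M}^n(C)$ is $\Psi_a(P^{n-2}\times I_0)$. If moreover $V$ is not normal to $M$ at $q$, these can be chosen so that $q\in P^{n-2}$ and $\Psi_a$ is a parametrization of $U$: there is a smooth bijection $u\mapsto(\pi(u),\zeta(u))$ of $U$ onto $P^{n-2}\times I_0$,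 taking $q$ to $(q,0)$, such that the image of each $u\in U$ in $\mathbb{M}^n(C)$ is $\Psi_a(\pi(u),\zeta(u))$. The points of $M$ at which $V$ is not normal to $M$ form a dense subset of $M$. -/

import Mathlib

open scoped Manifold ContDiff Topology

noncomputable section

namespace SpaceForm

/-- The vector space underlying the pseudo-Euclidean space that contains the `n`-dimensional
space form. -/
abbrev Ambient (n : ℕ) : Type := EuclideanSpace ℝ (Fin (n + 1))

/-- The sign `ε` of the curvature `C ≠ 0`. -/
def eps (C : ℝ) : ℝ := if C < 0 then -1 else 1

/-- The flat metric `ε dx₁² + dx₂² + ⋯ + dxₙ₊₁²`. -/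
def ip {n : ℕ} (C : ℝ) (x y : Ambient n) : ℝ :=
  eps C * x 0 * y 0 + ∑ i : Fin n, x i.succ * y i.succ

/-- The space form of constant curvature `C ≠ 0`: the sphere `⟨p, p⟩ = 1 / C` for `C > 0`, and
hyperbolic space, that is, the sheet `p₁ > 0` of the hyperboloid `⟨p, p⟩ = 1 / C`, for `C < 0`. -/
def spaceForm (n : ℕ) (C : ℝ) : Set (Ambient n) :=
  {p | ip C p p = 1 / C ∧ (C < 0 → 0 < p 0)}

/-- The orthogonal projection of the ambient space onto the tangent space
`{v | ⟨v, p⟩ = 0}` of the space form at its point `p`. -/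
def tanProj {n : ℕ} (C : ℝ) (p v : Ambient n) : Ambient n := v - (C * ip C v p) • p

/-- The Levi-Civita connection of the space form: the tangential part at `p` of the ambient
derivative of `V` in the tangent direction `X`. -/
def covDeriv {n : ℕ} (C : ℝ) (V : Ambient n → Ambient n) (p X : Ambient n) : Ambient n :=
  tanProj C p (fderiv ℝ V p X)

/-- `V` restricts to a concircular vector field of the space form: it is smooth and tangent, and
`∇ V = μ I` for a smooth function `μ`.  As the space form is a closed submanifold, each smooth
vector field or function on it is the restriction of a smooth map of the ambient space; only the
values on the space form matter below. -/
structure IsConcircularField {n : ℕ} (C : ℝ) (V : Ambient n → Ambient n) : Prop where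
  smooth : ContDiff ℝ ∞ V
  tangent : ∀ p ∈ spaceForm n C, ip C (V p) p = 0
  concircular : ∃ μ : Ambient n → ℝ, ContDiff ℝ ∞ μ ∧
    ∀ p ∈ spaceForm n C, ∀ X : Ambient n, ip C X p = 0 → covDeriv C V p X = μ p • X

section Immersed

variable {k : ℕ} {M : Type*} [TopologicalSpace M]
  [ChartedSpace (EuclideanSpace ℝ (Fin (k + 1))) M]

/-- `x` immerses the `(k + 1)`-dimensional manifold `M` as a hypersurface of the
`(k + 2)`-dimensional space form. -/
structure IsHypersurface (C : ℝ) (x : M → Ambient (k + 2)) : Prop where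
  smooth : ContMDiff (𝓡 (k + 1)) 𝓘(ℝ, Ambient (k + 2)) ∞ x
  immersion : ∀ q : M,
    Function.Injective (mfderiv (𝓡 (k + 1)) 𝓘(ℝ, Ambient (k + 2)) x q)
  mem : ∀ q : M, x q ∈ spaceForm (k + 2) C

/-- The ambient vector `v` is orthogonal to the tangent space of the hypersurface at `q`. -/
def IsNormalAt (C : ℝ) (x : M → Ambient (k + 2)) (q : M) (v : Ambient (k + 2)) : Prop :=
  ∀ X : TangentSpace (𝓡 (k + 1)) q,
    ip C v (mfderiv (𝓡 (k + 1)) 𝓘(ℝ, Ambient (k + 2)) x q X : Ambient (k + 2)) = 0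

/-- `v` is a unit normal vector, in the space form, of the hypersurface at `q`. -/
def IsUnitNormalAt (C : ℝ) (x : M → Ambient (k + 2)) (q : M) (v : Ambient (k + 2)) : Prop :=
  ip C v (x q) = 0 ∧ IsNormalAt C x q v ∧ ip C v v = 1

/-- The hypersurface is concircular with axis `V`: the vector field `V` is concircular and not
identically zero, and `⟨N, V⟩` is a constant `l`, for smooth local unit normal fields `N`
(the sign of `N` is chosen locally, so that `M` need not be orientable). -/
def IsConcircularHypersurface (C : ℝ) (x : M → Ambient (k + 2))
    (V : Ambient (k + 2) → Ambient (k + 2)) : Prop :=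
  IsConcircularField C V ∧ (∃ p ∈ spaceForm (k + 2) C, V p ≠ 0) ∧
    ∃ l : ℝ, ∀ q : M, ∃ (U : Set M) (N : M → Ambient (k + 2)), IsOpen U ∧ q ∈ U ∧
      ContMDiffOn (𝓡 (k + 1)) 𝓘(ℝ, Ambient (k + 2)) ∞ N U ∧
      ∀ u ∈ U, IsUnitNormalAt C x u (N u) ∧ ip C (N u) (V (x u)) = l

end Immersed

/-- The intersection of the space form with the affine hyperplane `⟨w, p⟩ = c`. -/
def hyperplaneSection {n : ℕ} (C : ℝ) (w : Ambient n) (c : ℝ) : Set (Ambient n) :=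
  {p | p ∈ spaceForm n C ∧ ip C w p = c}

/-- The hyperplane `⟨w, p⟩ = c` is nowhere tangent to the space form, so that the section (if not
empty) is a hypersurface of the space form.  These sections are the totally umbilical
hypersurfaces of the space form. -/
def IsUmbilicalSection {n : ℕ} (C : ℝ) (w : Ambient n) (c : ℝ) : Prop :=
  ∀ p ∈ hyperplaneSection C w c, tanProj C p w ≠ 0

/-- The hypersurface is trivial: it is contained, as an open piece, in a totally umbilical
hypersurface `Q` of the space form. -/
def IsTrivial {n : ℕ} {M : Type*} (C : ℝ) (x : M → Ambient n) : Prop :=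
  ∃ (w : Ambient n) (c : ℝ), IsUmbilicalSection C w c ∧ Set.range x ⊆ hyperplaneSection C w c

/-- The tangent space at `p` of the section of the space form by a hyperplane orthogonal
to `w`. -/
def sectionTangent {n : ℕ} (C : ℝ) (w p : Ambient n) : Set (Ambient n) :=
  {v | ip C v p = 0 ∧ ip C v w = 0}

/-- `S` is a smooth embedded `d`-dimensional submanifold: near each of its points it is the image
of an injective immersion of an open subset of `ℝᵈ`, with continuous inverse. -/
def IsEmbeddedSubmanifold {n : ℕ} (d : ℕ) (S : Set (Ambient n)) : Prop :=
  ∀ p ∈ S, ∃ (O : Set (Ambient n)) (D : Set (EuclideanSpace ℝ (Fin d)))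
    (y : EuclideanSpace ℝ (Fin d) → Ambient n) (g : Ambient n → EuclideanSpace ℝ (Fin d)),
    IsOpen O ∧ p ∈ O ∧ IsOpen D ∧ ContDiffOn ℝ ∞ y D ∧
    (∀ u ∈ D, Function.Injective (fderiv ℝ y u)) ∧ y '' D = S ∩ O ∧
    ContinuousOn g (S ∩ O) ∧ ∀ u ∈ D, g (y u) = u

/-- `v` is tangent to the submanifold `S` at `p`: it is the velocity of a curve in `S`. -/
def IsTangentTo {n : ℕ} (S : Set (Ambient n)) (p v : Ambient n) : Prop :=
  ∃ γ : ℝ → Ambient n, γ 0 = p ∧ HasDerivAt γ v 0 ∧ ∀ᶠ t in 𝓝 (0 : ℝ), γ t ∈ S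

/-- `P` is a hypersurface of the section `Q` of the `(k + 2)`-dimensional space form by the
hyperplane `⟨w, p⟩ = c`; along `P`, `η₁` is a smooth unit normal field of `P` in `Q`, and `η₂` is a
smooth unit normal field of `Q` in the space form. -/
structure IsFramedHypersurface {k : ℕ} (C : ℝ) (w : Ambient (k + 2)) (c : ℝ)
    (P : Set (Ambient (k + 2))) (η₁ η₂ : Ambient (k + 2) → Ambient (k + 2)) : Prop where
  subset : P ⊆ hyperplaneSection C w c
  submanifold : IsEmbeddedSubmanifold k P
  smooth₁ : ContDiffOn ℝ ∞ η₁ P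
  smooth₂ : ContDiffOn ℝ ∞ η₂ P
  tangent₁ : ∀ p ∈ P, η₁ p ∈ sectionTangent C w p
  normal₁ : ∀ p ∈ P, ∀ v, IsTangentTo P p v → ip C (η₁ p) v = 0
  unit₁ : ∀ p ∈ P, ip C (η₁ p) (η₁ p) = 1
  tangent₂ : ∀ p ∈ P, ip C (η₂ p) p = 0
  normal₂ : ∀ p ∈ P, ∀ v ∈ sectionTangent C w p, ip C (η₂ p) v = 0
  unit₂ : ∀ p ∈ P, ip C (η₂ p) (η₂ p) = 1

/-- The radius `R > 0`, for which `C = ε / R²`. -/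
def radius (C : ℝ) : ℝ := 1 / Real.sqrt |C|

/-- `f = cos` for `C > 0`, and `f = cosh` for `C < 0`. -/
def fC (C t : ℝ) : ℝ := if C < 0 then Real.cosh t else Real.cos t

/-- `g = sin` for `C > 0`, and `g = sinh` for `C < 0`. -/
def gC (C t : ℝ) : ℝ := if C < 0 then Real.sinh t else Real.sin t

/-- `exp_p (z v)`, for a unit tangent vector `v` of the space form at `p`: the point at time `z` of
the unit speed geodesic with initial velocity `v`. -/
def geodesic {n : ℕ} (C : ℝ) (p v : Ambient n) (z : ℝ) : Ambient n :=
  fC C (z / radius C) • p + (radius C * gC C (z / radius C)) • v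

/-- `W_a = cos(a) η₁ + sin(a) η₂`. -/
def fieldW {n : ℕ} (η₁ η₂ : Ambient n → Ambient n) (a : ℝ) (p : Ambient n) : Ambient n :=
  Real.cos a • η₁ p + Real.sin a • η₂ p

/-- `Ψ_a(p, z) = exp_p (z W_a(p))`. -/
def ruledMap {n : ℕ} (C : ℝ) (η₁ η₂ : Ambient n → Ambient n) (a : ℝ)
    (s : Ambient n × ℝ) : Ambient n :=
  geodesic C s.1 (fieldW η₁ η₂ a s.1) s.2

end SpaceForm

end

/-! Write `h = ⟨w, ·⟩` for the height. A concircular field on a space form is the tangential part `w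
- C h p` of a constant ambient vector `w` (`IsConcircularField.exists_axis`), so the hypothesis says
that `⟨N, w⟩` is a constant `l`. The part of `w` tangent to the hypersurface is then `E = w - C h p
- l N` (`axisTangent`). It is the gradient of `h` along the hypersurface, and `⟨E, E⟩ = ⟨w, w⟩ - l²
- C h²` depends on `h` alone.

Differentiating `⟨N, w⟩ = l` shows that `E` is orthogonal to the image of the shape operator; as
that operator is symmetric, it kills `E` (`Patch.fderiv_normal_eq_zero`). So the integral curves of
`E`, the leaves, are geodesics of the space form along which `N` is constant, and the height on them
is an explicit function `leafHeight`. `TubularPatch.exists_ball` proves this by a Gronwall estimate: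
the explicit geodesic with frozen normal solves the right equation, hence cannot leave the
hypersurface.

A level set of `h` on which `E ≠ 0` is a hypersurface `P` of a hyperplane section `Q`. Along it `E`
and `N` span the same plane as the two normals `η₁`, `η₂`, with constant coefficients, so `E / |E|`
is `W_a` for a constant `a` (`TubularPatch.exists_framed_level`). Flowing along the leaves from `P`
gives the parametrization near points with `E ≠ 0`, which are those where `V` is not normal.

Where `E = 0` the leaves end at an extremal height. There `P` is taken at a slightly different
height and the leaves are followed up to the end; points with `E = 0` are reached as limits
(`TubularPatch.exists_ruled_of_neg`). This needs density of the set `E ≠ 0`: the interior of `E = 0`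
is also closed, so by connectedness it is empty or everything, and in the second case `h` is
constant and the hypersurface is trivial (`dense_not_isNormalAt`). -/

noncomputable section

namespace SpaceForm

/-! ### The ambient bilinear form and its positivity on tangent spaces -/

section Form

variable {n : ℕ} {C : ℝ}

/-- The flat metric as a continuous bilinear form. -/
def ipL (n : ℕ) (C : ℝ) : Ambient n →L[ℝ] Ambient n →L[ℝ] ℝ :=
  eps C • (EuclideanSpace.proj 0 : Ambient n →L[ℝ] ℝ).smulRight
      (EuclideanSpace.proj 0 : Ambient n →L[ℝ] ℝ) +
    ∑ i : Fin n, (EuclideanSpace.proj i.succ : Ambient n →L[ℝ] ℝ).smulRight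
      (EuclideanSpace.proj i.succ : Ambient n →L[ℝ] ℝ)

theorem ip_eq_ipL (x y : Ambient n) : ip C x y = ipL n C x y := by
  simp [ip, ipL, mul_assoc]

theorem ip_comm (x y : Ambient n) : ip C x y = ip C y x := by
  simp only [ip]
  exact congrArg₂ _ (by ring) (Finset.sum_congr rfl fun i _ => mul_comm _ _)

theorem ip_add_left (x y z : Ambient n) : ip C (x + y) z = ip C x z + ip C y z := by
  simp [ip_eq_ipL]

theorem ip_add_right (x y z : Ambient n) : ip C x (y + z) = ip C x y + ip C x z := by
  simp [ip_eq_ipL]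

theorem ip_sub_left (x y z : Ambient n) : ip C (x - y) z = ip C x z - ip C y z := by
  simp [ip_eq_ipL]

theorem ip_sub_right (x y z : Ambient n) : ip C x (y - z) = ip C x y - ip C x z := by
  simp [ip_eq_ipL]

theorem ip_smul_left (a : ℝ) (x y : Ambient n) : ip C (a • x) y = a * ip C x y := by
  simp [ip_eq_ipL]

theorem ip_smul_right (a : ℝ) (x y : Ambient n) : ip C x (a • y) = a * ip C x y := by
  simp [ip_eq_ipL]

theorem ip_neg_left (x y : Ambient n) : ip C (-x) y = - ip C x y := by
  simp [ip_eq_ipL]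

theorem ip_neg_right (x y : Ambient n) : ip C x (-y) = - ip C x y := by
  simp [ip_eq_ipL]

@[simp] theorem ip_zero_left (x : Ambient n) : ip C 0 x = 0 := by simp [ip_eq_ipL]

@[simp] theorem ip_zero_right (x : Ambient n) : ip C x 0 = 0 := by simp [ip_eq_ipL]

section Calculus

variable {E : Type*} [NormedAddCommGroup E] [NormedSpace ℝ E] {f g : E → Ambient n}

theorem _root_.ContDiffAt.ip {m : ℕ∞ω} {a : E} (hf : ContDiffAt ℝ m f a) (hg : ContDiffAt ℝ m g a) :
    ContDiffAt ℝ m (fun u => ip C (f u) (g u)) a := by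
  simp only [ip_eq_ipL]
  exact (ContDiffAt.continuousLinearMap_comp (ipL n C) hf).clm_apply hg

theorem _root_.ContDiffOn.ip {m : ℕ∞ω} {s : Set E} (hf : ContDiffOn ℝ m f s)
    (hg : ContDiffOn ℝ m g s) : ContDiffOn ℝ m (fun u => ip C (f u) (g u)) s := by
  simp only [ip_eq_ipL]
  exact (ContDiffOn.continuousLinearMap_comp (ipL n C) hf).clm_apply hg

theorem _root_.HasFDerivAt.ip {a : E} {f' g' : E →L[ℝ] Ambient n} (hf : HasFDerivAt f f' a)
    (hg : HasFDerivAt g g' a) :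
    HasFDerivAt (fun u => ip C (f u) (g u))
      ((ipL n C (f a)).comp g' + ((ipL n C).flip (g a)).comp f') a := by
  simp only [ip_eq_ipL]
  have := ((ipL n C).hasFDerivAt.comp a hf).clm_apply hg
  refine this.congr_fderiv ?_
  ext v
  simp

theorem fderiv_ip {a : E} (hf : DifferentiableAt ℝ f a)
    (hg : DifferentiableAt ℝ g a) (v : E) :
    fderiv ℝ (fun u => ip C (f u) (g u)) a v
      = ip C (f a) (fderiv ℝ g a v) + ip C (fderiv ℝ f a v) (g a) := by
  rw [(hf.hasFDerivAt.ip hg.hasFDerivAt).fderiv]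
  simp [ip_eq_ipL]

theorem _root_.HasDerivAt.ip {f g : ℝ → Ambient n} {a : ℝ} {f' g' : Ambient n} (hf : HasDerivAt f f' a)
    (hg : HasDerivAt g g' a) :
    HasDerivAt (fun u => ip C (f u) (g u)) (ip C (f a) g' + ip C f' (g a)) a := by
  have := (hf.hasFDerivAt.ip (C := C) hg.hasFDerivAt).hasDerivAt
  simpa [ip_eq_ipL] using this

theorem _root_.ContinuousOn.ip {X : Type*} [TopologicalSpace X] {f g : X → Ambient n} {s : Set X}
    (hf : ContinuousOn f s) (hg : ContinuousOn g s) :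
    ContinuousOn (fun u => ip C (f u) (g u)) s := by
  simp only [ip_eq_ipL]
  exact ((ipL n C).continuous.comp_continuousOn hf).clm_apply hg

end Calculus

theorem ip_self_of_mem {p : Ambient n} (hp : p ∈ spaceForm n C) : ip C p p = 1 / C := hp.1

/-- Quantitative positivity of the metric on tangent spaces. It is needed in this form because the
estimates below use the Euclidean norm, while unit vectors of hyperbolic space are Euclidean-bounded
only over bounded sets of base points. -/
theorem norm_sq_le_of_tangent (hC : C ≠ 0) {p v : Ambient n} (hp : p ∈ spaceForm n C)
    (hv : ip C v p = 0) : ‖v‖ ^ 2 ≤ (1 + 2 * |C| * ‖p‖ ^ 2) * ip C v v := by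
  have hnv : ‖v‖ ^ 2 = v 0 ^ 2 + ∑ i : Fin n, v i.succ ^ 2 := by
    rw [EuclideanSpace.real_norm_sq_eq, Fin.sum_univ_succ]
  have hnp : ‖p‖ ^ 2 = p 0 ^ 2 + ∑ i : Fin n, p i.succ ^ 2 := by
    rw [EuclideanSpace.real_norm_sq_eq, Fin.sum_univ_succ]
  have hS : 0 ≤ ∑ i : Fin n, v i.succ ^ 2 := Finset.sum_nonneg fun i _ => sq_nonneg _
  have hP : 0 ≤ ∑ i : Fin n, p i.succ ^ 2 := Finset.sum_nonneg fun i _ => sq_nonneg _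
  have hCS := Finset.sum_mul_sq_le_sq_mul_sq Finset.univ (fun i : Fin n => v i.succ)
    (fun i => p i.succ)
  have hvv : ip C v v = eps C * v 0 ^ 2 + ∑ i : Fin n, v i.succ ^ 2 := by
    simp only [ip, sq, mul_assoc]
  have hpp : eps C * p 0 ^ 2 + ∑ i : Fin n, p i.succ ^ 2 = 1 / C := by
    rw [← ip_self_of_mem hp]; simp only [ip, sq, mul_assoc]
  have hvp : eps C * v 0 * p 0 + ∑ i : Fin n, v i.succ * p i.succ = 0 := hv
  rw [hvv, hnv, hnp]
  generalize (∑ i : Fin n, v i.succ ^ 2) = S at *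
  generalize (∑ i : Fin n, p i.succ ^ 2) = P at *
  generalize (∑ i : Fin n, v i.succ * p i.succ) = T at *
  rcases lt_or_gt_of_ne hC with h | h
  · have he : eps C = -1 := by simp [eps, h]
    have hp0 := hp.2 h
    rw [he] at hvp hpp ⊢
    have hT : T = v 0 * p 0 := by linarith
    have hP' : P = p 0 ^ 2 + 1 / C := by linarith
    rw [abs_of_neg h]
    have h1 : 0 < -(1 / C) := by
      have := one_div_neg.mpr h
      linarith
    -- Cauchy–Schwarz for the spatial parts of `v` and `p`, after eliminating `T` by tangency and
    -- `P` by the equation of the hyperboloid.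
    have h2 : S * (-(1 / C)) ≤ p 0 ^ 2 * (S - v 0 ^ 2) := by
      rw [hT, hP'] at hCS; nlinarith
    have h3 : 0 ≤ S - v 0 ^ 2 := by
      have : 0 ≤ p 0 ^ 2 * (S - v 0 ^ 2) := le_trans (mul_nonneg hS h1.le) h2
      exact nonneg_of_mul_nonneg_right this (by positivity)
    have h4 : S ≤ -C * (p 0 ^ 2 * (S - v 0 ^ 2)) := by
      have := mul_le_mul_of_nonneg_left h2 (by linarith : 0 ≤ -C)
      have h5 : -C * (S * (-(1 / C))) = S := by field_simp
      linarith
    have h6 : 0 ≤ -C * P * (S - v 0 ^ 2) := by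
      have : 0 ≤ -C := by linarith
      positivity
    nlinarith
  · have he : eps C = 1 := by simp [eps, not_lt.mpr h.le]
    rw [he]
    have : 0 ≤ 2 * |C| * (p 0 ^ 2 + P) * (v 0 ^ 2 + S) := by positivity
    nlinarith

theorem ip_self_nonneg_of_tangent (hC : C ≠ 0) {p v : Ambient n} (hp : p ∈ spaceForm n C)
    (hv : ip C v p = 0) : 0 ≤ ip C v v := by
  have := norm_sq_le_of_tangent hC hp hv
  have h1 : 0 ≤ (1 + 2 * |C| * ‖p‖ ^ 2) * ip C v v := le_trans (by positivity) this
  exact nonneg_of_mul_nonneg_right h1 (by positivity)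

theorem eq_zero_of_tangent (hC : C ≠ 0) {p v : Ambient n} (hp : p ∈ spaceForm n C)
    (hv : ip C v p = 0) (h : ip C v v = 0) : v = 0 := by
  have := norm_sq_le_of_tangent hC hp hv
  rw [h, mul_zero] at this
  have h2 : ‖v‖ ^ 2 = 0 := le_antisymm this (by positivity)
  simpa using h2

end Form

/-! ### Generalized sine and cosine of curvature `C` -/

section Trig

variable {C : ℝ}

/-- `z ↦ f (z / R)`. -/
def cs (C z : ℝ) : ℝ := fC C (z / radius C)

/-- `z ↦ R g (z / R)`. -/
def sn (C z : ℝ) : ℝ := radius C * gC C (z / radius C)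

theorem radius_pos (hC : C ≠ 0) : 0 < radius C := by
  have : 0 < |C| := abs_pos.mpr hC
  unfold radius; positivity

theorem abs_mul_radius_sq (hC : C ≠ 0) : |C| * radius C ^ 2 = 1 := by
  have : 0 < |C| := abs_pos.mpr hC
  rw [radius, div_pow, Real.sq_sqrt this.le]
  field_simp

@[simp] theorem cs_zero : cs C 0 = 1 := by simp [cs, fC]

@[simp] theorem sn_zero : sn C 0 = 0 := by simp [sn, gC]

theorem cs_neg (z : ℝ) : cs C (-z) = cs C z := by
  simp only [cs, fC, neg_div, Real.cosh_neg, Real.cos_neg]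

theorem sn_neg (z : ℝ) : sn C (-z) = - sn C z := by
  simp only [sn, gC, neg_div, Real.sinh_neg, Real.sin_neg]
  split_ifs <;> ring

theorem hasDerivAt_sn (hC : C ≠ 0) (z : ℝ) : HasDerivAt (sn C) (cs C z) z := by
  have hR := (radius_pos hC).ne'
  have h0 : HasDerivAt (fun z : ℝ => z / radius C) (1 / radius C) z :=
    (hasDerivAt_id z).div_const _
  by_cases h : C < 0
  · have e1 : sn C = fun z => radius C * Real.sinh (z / radius C) := by funext; simp [sn, gC, h]
    have e2 : cs C = fun z => Real.cosh (z / radius C) := by funext; simp [cs, fC, h]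
    rw [e1, e2]
    exact (h0.sinh.const_mul (radius C)).congr_deriv (by field_simp)
  · have e1 : sn C = fun z => radius C * Real.sin (z / radius C) := by funext; simp [sn, gC, h]
    have e2 : cs C = fun z => Real.cos (z / radius C) := by funext; simp [cs, fC, h]
    rw [e1, e2]
    exact (h0.sin.const_mul (radius C)).congr_deriv (by field_simp)

theorem hasDerivAt_cs (hC : C ≠ 0) (z : ℝ) : HasDerivAt (cs C) (-C * sn C z) z := by
  have hR := (radius_pos hC).ne'
  have hR2 := abs_mul_radius_sq hC
  have h0 : HasDerivAt (fun z : ℝ => z / radius C) (1 / radius C) z :=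
    (hasDerivAt_id z).div_const _
  by_cases h : C < 0
  · have e1 : sn C = fun z => radius C * Real.sinh (z / radius C) := by funext; simp [sn, gC, h]
    have e2 : cs C = fun z => Real.cosh (z / radius C) := by funext; simp [cs, fC, h]
    rw [abs_of_neg h] at hR2
    rw [e1, e2]
    refine h0.cosh.congr_deriv ?_
    field_simp
    linear_combination -Real.sinh (z / radius C) * hR2
  · have e1 : sn C = fun z => radius C * Real.sin (z / radius C) := by funext; simp [sn, gC, h]
    have e2 : cs C = fun z => Real.cos (z / radius C) := by funext; simp [cs, fC, h]
    rw [abs_of_nonneg (not_lt.mp h)] at hR2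
    rw [e1, e2]
    refine h0.cos.congr_deriv ?_
    field_simp
    linear_combination Real.sin (z / radius C) * hR2

theorem cs_add (hC : C ≠ 0) (a b : ℝ) : cs C (a + b) = cs C a * cs C b - C * (sn C a * sn C b) := by
  have hR2 := abs_mul_radius_sq hC
  by_cases h : C < 0
  · rw [abs_of_neg h] at hR2
    simp only [sn, gC, cs, fC, h, if_true, add_div, Real.cosh_add]
    linear_combination -Real.sinh (a / radius C) * Real.sinh (b / radius C) * hR2
  · rw [abs_of_nonneg (not_lt.mp h)] at hR2
    simp only [sn, gC, cs, fC, h, if_false, add_div, Real.cos_add]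
    linear_combination Real.sin (a / radius C) * Real.sin (b / radius C) * hR2

theorem sn_add (a b : ℝ) : sn C (a + b) = sn C a * cs C b + cs C a * sn C b := by
  by_cases h : C < 0
  · simp only [sn, gC, cs, fC, h, if_true, add_div, Real.sinh_add]
    ring
  · simp only [sn, gC, cs, fC, h, if_false, add_div, Real.sin_add]
    ring

theorem cs_sq_add (hC : C ≠ 0) (z : ℝ) : cs C z ^ 2 + C * sn C z ^ 2 = 1 := by
  have h := cs_add hC z (-z)
  rw [add_neg_cancel, cs_zero, cs_neg, sn_neg] at h
  linear_combination -h

theorem contDiff_cs {m : ℕ∞ω} : ContDiff ℝ m (cs C) := by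
  unfold cs fC
  split_ifs
  · exact Real.contDiff_cosh.comp (contDiff_id.div_const _)
  · exact Real.contDiff_cos.comp (contDiff_id.div_const _)

theorem contDiff_sn {m : ℕ∞ω} : ContDiff ℝ m (sn C) := by
  unfold sn gC
  split_ifs
  · exact contDiff_const.mul (Real.contDiff_sinh.comp (contDiff_id.div_const _))
  · exact contDiff_const.mul (Real.contDiff_sin.comp (contDiff_id.div_const _))

end Trig

/-! ### Geodesics of the space form -/

section Geodesic

variable {n : ℕ} {C : ℝ}

theorem geodesic_eq (p v : Ambient n) (z : ℝ) : geodesic C p v z = cs C z • p + sn C z • v := rfl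

/-- The velocity at time `z` of the geodesic `geodesic C p v`. -/
def velocity (C : ℝ) (p v : Ambient n) (z : ℝ) : Ambient n := (-C * sn C z) • p + cs C z • v

@[simp] theorem geodesic_zero (p v : Ambient n) : geodesic C p v 0 = p := by simp [geodesic_eq]

@[simp] theorem velocity_zero (p v : Ambient n) : velocity C p v 0 = v := by simp [velocity]

theorem hasDerivAt_geodesic (hC : C ≠ 0) (p v : Ambient n) (z : ℝ) :
    HasDerivAt (geodesic C p v) (velocity C p v z) z :=
  ((hasDerivAt_cs hC z).smul_const p).add ((hasDerivAt_sn hC z).smul_const v)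

theorem geodesic_geodesic (hC : C ≠ 0) (p v : Ambient n) (a b : ℝ) :
    geodesic C (geodesic C p v a) (velocity C p v a) b = geodesic C p v (a + b) := by
  simp only [geodesic_eq, velocity, cs_add hC, sn_add]
  module

/-- The time `t` is uniform in the unit direction. This matters near zeros of `E`, where the
direction `E / |E|` has no limit to rely on. -/
theorem exists_dist_geodesic_lt (hC : C ≠ 0) (r : ℝ) {δ : ℝ} (hδ : 0 < δ) :
    ∃ t > 0, ∀ p ∈ spaceForm n C, ‖p‖ ≤ r → ∀ v, ip C v p = 0 → ip C v v = 1 →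
      ∀ z, |z| < t → dist (geodesic C p v z) p < δ := by
  set B := √(1 + 2 * |C| * r ^ 2)
  have hcont : Continuous fun z => |cs C z - 1| * |r| + |sn C z| * B :=
    ((((contDiff_cs (m := 0)).continuous.sub continuous_const).abs).mul continuous_const).add
      ((contDiff_sn (m := 0)).continuous.abs.mul continuous_const)
  have h0 : ∀ᶠ z in 𝓝 (0 : ℝ), |cs C z - 1| * |r| + |sn C z| * B < δ :=
    hcont.continuousAt.eventually_lt continuousAt_const (by simpa using hδ)
  obtain ⟨t, ht, h⟩ := Metric.eventually_nhds_iff.mp h0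
  refine ⟨t, ht, fun p hp hpr v hv h1 z hz => ?_⟩
  refine lt_of_le_of_lt ?_ (h (by simpa using hz))
  have hvB : ‖v‖ ≤ B := by
    refine Real.le_sqrt_of_sq_le ?_
    have := norm_sq_le_of_tangent hC hp hv
    rw [h1, mul_one] at this
    refine this.trans ?_
    have := norm_nonneg p
    gcongr
  have : geodesic C p v z - p = (cs C z - 1) • p + sn C z • v := by
    rw [geodesic_eq]; module
  rw [dist_eq_norm, this]
  refine (norm_add_le _ _).trans ?_
  rw [norm_smul, norm_smul, Real.norm_eq_abs, Real.norm_eq_abs]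
  gcongr
  exact hpr.trans (le_abs_self r)

end Geodesic

/-! ### A Gronwall lemma and a smooth inverse function theorem -/

section Analysis

/-- Gronwall's inequality with zero initial value, for both signs of `b`; rescaling time to `[0, 1]`
treats them together. -/
theorem eq_zero_of_norm_deriv_le {W : Type*} [NormedAddCommGroup W] [NormedSpace ℝ W]
    {f f' : ℝ → W} {K b : ℝ} (hf : ∀ t ∈ Set.uIcc 0 b, HasDerivAt f (f' t) t) (h0 : f 0 = 0)
    (hK : ∀ t ∈ Set.uIcc 0 b, ‖f' t‖ ≤ K * ‖f t‖) : f b = 0 := by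
  have hmem : ∀ s ∈ Set.Icc (0 : ℝ) 1, s * b ∈ Set.uIcc 0 b := by
    intro s hs
    rcases le_total 0 b with h | h
    · rw [Set.uIcc_of_le h]
      exact ⟨mul_nonneg hs.1 h, by nlinarith [hs.2]⟩
    · rw [Set.uIcc_of_ge h]
      exact ⟨by nlinarith [hs.2], mul_nonpos_of_nonneg_of_nonpos hs.1 h⟩
  have hder : ∀ s ∈ Set.Icc (0 : ℝ) 1, HasDerivAt (fun s => f (s * b)) (b • f' (s * b)) s := by
    intro s hs
    have h1 : HasDerivAt (fun s : ℝ => s * b) b s := by simpa using (hasDerivAt_id s).mul_const b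
    exact (hf _ (hmem s hs)).scomp s h1
  have := eq_zero_of_abs_deriv_le_mul_abs_self_of_eq_zero_right (f := fun s => f (s * b))
    (f' := fun s => b • f' (s * b)) (K := |b| * K) (a := 0) (b := 1)
    (fun s hs => (hder s hs).continuousAt.continuousWithinAt)
    (fun s hs => (hder s (Set.Ico_subset_Icc_self hs)).hasDerivWithinAt) (by simpa using h0)
    (fun s hs => by
      rw [norm_smul, Real.norm_eq_abs, mul_assoc]
      exact mul_le_mul_of_nonneg_left (hK _ (hmem s (Set.Ico_subset_Icc_self hs))) (abs_nonneg b))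
    1 (by simp)
  simpa using this

/-- Shrinking the source to the open set where the derivative is invertible makes the local inverse
smooth on its whole target, and not just at one point. -/
theorem exists_openPartialHomeomorph {E G : Type*} [NormedAddCommGroup E] [NormedSpace ℝ E]
    [CompleteSpace E] [NormedAddCommGroup G] [NormedSpace ℝ G] [CompleteSpace G] {f : E → G}
    {s : Set E} (hs : IsOpen s) (hf : ContDiffOn ℝ ∞ f s) {a : E} (ha : a ∈ s) {f' : E ≃L[ℝ] G}
    (hf' : HasFDerivAt f (f' : E →L[ℝ] G) a) :
    ∃ e : OpenPartialHomeomorph E G, a ∈ e.source ∧ e.source ⊆ s ∧ (e : E → G) = f ∧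
      ContDiffOn ℝ ∞ e.symm e.target := by
  have hfa : ContDiffAt ℝ ∞ f a := hf.contDiffAt (hs.mem_nhds ha)
  let e₀ := hfa.toOpenPartialHomeomorph f hf' (by simp)
  have hcont : ContinuousOn (fderiv ℝ f) s := hf.continuousOn_fderiv_of_isOpen hs (by simp)
  have ht : IsOpen (s ∩ fderiv ℝ f ⁻¹' Set.range ((↑) : (E ≃L[ℝ] G) → E →L[ℝ] G)) :=
    hcont.isOpen_inter_preimage hs ContinuousLinearEquiv.isOpen
  refine ⟨e₀.restrOpen _ ht, ⟨hfa.mem_toOpenPartialHomeomorph_source hf' (by simp), ha, f',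
    hf'.fderiv.symm⟩, fun x hx => hx.2.1, rfl, ?_⟩
  intro y hy
  have hy' := (e₀.restrOpen _ ht).map_target hy
  obtain ⟨g', hg'⟩ := hy'.2.2
  refine (OpenPartialHomeomorph.contDiffAt_symm _ (f₀' := g') hy ?_ ?_).contDiffWithinAt
  · rw [hg']
    exact ((hf.contDiffAt (hs.mem_nhds hy'.2.1)).differentiableAt (by simp)).hasFDerivAt
  · exact hf.contDiffAt (hs.mem_nhds hy'.2.1)

end Analysis

/-! ### Concircular fields come from constant vectors -/

section Concircular

variable {n : ℕ} {C : ℝ}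

/-- The open cone over the space form. -/
def cone (n : ℕ) (C : ℝ) : Set (Ambient n) := {y | 0 < C * ip C y y ∧ (C < 0 → 0 < y 0)}

/-- The central projection of the cone onto the space form. -/
def coneProj (C : ℝ) (y : Ambient n) : Ambient n := (√(C * ip C y y))⁻¹ • y

theorem contDiffOn_coneProj : ContDiffOn ℝ ∞ (coneProj C) (cone n C) := by
  refine ContDiffOn.smul (ContDiffOn.inv (ContDiffOn.sqrt ?_ fun y hy => hy.1.ne')
    fun y hy => (Real.sqrt_pos.mpr hy.1).ne') contDiffOn_id
  exact contDiffOn_const.mul (contDiffOn_id.ip contDiffOn_id)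

theorem continuous_ip_self : Continuous fun y : Ambient n => ip C y y :=
  continuousOn_univ.mp (continuousOn_id.ip continuousOn_id)

theorem isOpen_cone : IsOpen (cone n C) := by
  have h1 : IsOpen {y : Ambient n | 0 < C * ip C y y} :=
    isOpen_lt continuous_const (continuous_const.mul continuous_ip_self)
  by_cases h : C < 0
  · have h2 : IsOpen {y : Ambient n | 0 < y 0} :=
      isOpen_lt continuous_const (EuclideanSpace.proj (𝕜 := ℝ) (0 : Fin (n + 1))).continuous
    convert h1.inter h2 using 1
    ext y; simp [cone, h]
  · convert h1 using 1
    ext y; simp [cone, h]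

theorem coneProj_mem (hC : C ≠ 0) {y : Ambient n} (hy : y ∈ cone n C) :
    coneProj C y ∈ spaceForm n C := by
  have hs : 0 < √(C * ip C y y) := Real.sqrt_pos.mpr hy.1
  refine ⟨?_, fun h => ?_⟩
  · simp only [coneProj, ip_smul_left, ip_smul_right]
    have h2 := Real.sq_sqrt hy.1.le
    rw [eq_div_iff hC]
    field_simp
    linear_combination -h2
  · have := hy.2 h
    simp only [coneProj, PiLp.smul_apply, smul_eq_mul]
    positivity

theorem mem_cone (hC : C ≠ 0) {p : Ambient n} (hp : p ∈ spaceForm n C) : p ∈ cone n C := by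
  refine ⟨?_, hp.2⟩
  rw [ip_self_of_mem hp]
  field_simp
  exact one_pos

theorem coneProj_of_mem (hC : C ≠ 0) {p : Ambient n} (hp : p ∈ spaceForm n C) :
    coneProj C p = p := by
  rw [coneProj, ip_self_of_mem hp, mul_one_div_cancel hC]
  simp

/-- For `C < 0` the cone is star-shaped about the first basis vector; for `C > 0` it is a punctured
vector space of dimension at least two. -/
theorem isPreconnected_cone (hC : C ≠ 0) (hn : 1 ≤ n) : IsPreconnected (cone n C) := by
  rcases lt_or_gt_of_ne hC with h | h
  · have he : eps C = -1 := by simp [eps, h]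
    have key : ∀ y : Ambient n, y ∈ cone n C ↔ ∑ i : Fin n, y i.succ ^ 2 < y 0 ^ 2 ∧ 0 < y 0 := by
      intro y
      have h0 : ip C y y = - y 0 ^ 2 + ∑ i : Fin n, y i.succ ^ 2 := by
        simp only [ip, he, sq]; ring_nf
      simp only [cone, Set.mem_ofPred_eq, h, forall_true_left, h0]
      refine and_congr_left fun _ => ⟨fun h1 => ?_, fun h1 => ?_⟩
      · by_contra! h2
        nlinarith
      · nlinarith
    have hstar : StarConvex ℝ (EuclideanSpace.single 0 1 : Ambient n) (cone n C) := by
      intro y hy a b ha hb hab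
      rw [key] at hy ⊢
      have h1 : (a • (EuclideanSpace.single 0 1 : Ambient n) + b • y) 0 = a + b * y 0 := by simp
      have h2 : ∀ i : Fin n, (a • (EuclideanSpace.single 0 1 : Ambient n) + b • y) i.succ
          = b * y i.succ := by intro i; simp
      simp only [h1, h2, mul_pow, ← Finset.mul_sum]
      have hy0 := hy.2
      rcases hb.eq_or_lt with rfl | hb
      · have : a = 1 := by linarith
        simp [this]
      · refine ⟨?_, by positivity⟩
        have := mul_lt_mul_of_pos_left hy.1 (pow_pos hb 2)
        have h3 : 0 ≤ a * (b * y 0) := by positivity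
        nlinarith
    have hne : (EuclideanSpace.single 0 1 : Ambient n) ∈ cone n C := by
      rw [key]; simp
    exact (hstar.isPathConnected hne).isConnected.isPreconnected
  · have he : eps C = 1 := by simp [eps, not_lt.mpr h.le]
    have : cone n C = {0}ᶜ := by
      ext y
      have h0 : ip C y y = ‖y‖ ^ 2 := by
        rw [EuclideanSpace.real_norm_sq_eq, Fin.sum_univ_succ]
        simp only [ip, he, sq]; ring_nf
      simp [cone, not_lt.mpr h.le, h0, h, sq_pos_iff]
    rw [this]
    refine (isConnected_compl_singleton_of_one_lt_rank ?_ _).isPreconnected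
    rw [← Module.finrank_eq_rank, finrank_euclideanSpace_fin]
    exact_mod_cast Nat.lt_succ_of_le hn

/-- Two linear equations in at least three unknowns. This is where the proof of `exists_axis` uses
that the space form has dimension at least two. -/
theorem exists_tangent_orthogonal {m : ℕ} (p Y : Ambient (m + 2)) :
    ∃ X : Ambient (m + 2), X ≠ 0 ∧ ip C X p = 0 ∧ ip C X Y = 0 := by
  let L : Ambient (m + 2) →ₗ[ℝ] ℝ × ℝ :=
    ((ipL (m + 2) C p : Ambient (m + 2) →L[ℝ] ℝ) : Ambient (m + 2) →ₗ[ℝ] ℝ).prod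
      ((ipL (m + 2) C Y : Ambient (m + 2) →L[ℝ] ℝ) : Ambient (m + 2) →ₗ[ℝ] ℝ)
  have hL : LinearMap.ker L ≠ ⊥ := by
    apply LinearMap.ker_ne_bot_of_finrank_lt
    simp
  obtain ⟨X, hX, hX0⟩ := (Submodule.ne_bot_iff _).mp hL
  have : (ipL (m + 2) C p X, ipL (m + 2) C Y X) = (0, 0) := hX
  rw [Prod.mk.injEq] at this
  refine ⟨X, hX0, ?_, ?_⟩
  · rw [ip_comm, ip_eq_ipL]; exact this.1
  · rw [ip_comm, ip_eq_ipL]; exact this.2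

theorem fderiv_coneProj_tangent (hC : C ≠ 0) {y : Ambient n} (hy : y ∈ cone n C) (X : Ambient n) :
    ip C (fderiv ℝ (coneProj C) y X) (coneProj C y) = 0 := by
  have hd : DifferentiableAt ℝ (coneProj (n := n) C) y :=
    (contDiffOn_coneProj.contDiffAt (isOpen_cone.mem_nhds hy)).differentiableAt (by simp)
  have h1 : (fun u : Ambient n => ip C (coneProj C u) (coneProj C u)) =ᶠ[𝓝 y] fun _ => 1 / C :=
    Filter.eventuallyEq_of_mem (isOpen_cone.mem_nhds hy)
      fun u hu => ip_self_of_mem (coneProj_mem hC hu)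
  have h2 := fderiv_ip (C := C) hd hd X
  rw [h1.fderiv_eq, ip_comm (coneProj C y)] at h2
  simp only [fderiv_fun_const, Pi.zero_apply, zero_apply] at h2
  linarith

/-- If `DW` takes the form `α ⊗ y`, differentiating once more gives `D²W (X, Z) = α(Z) X` modulo
`y`. Symmetry of `D²W` forces `α(Z) X = α(X) Z` for tangent vectors, and choosing `X` orthogonal to
`Z` gives `α(Z) = 0`. -/
theorem fderiv_eq_zero_of_radial {m : ℕ} (hC : C ≠ 0) {W : Ambient (m + 2) → Ambient (m + 2)}
    (hW : ContDiffOn ℝ ∞ W (cone (m + 2) C))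
    (hrad : ∀ y ∈ cone (m + 2) C, ∀ X, ∃ a : ℝ, fderiv ℝ W y X = a • y)
    {p Y : Ambient (m + 2)} (hp : p ∈ spaceForm (m + 2) C) (hY : ip C Y p = 0) :
    fderiv ℝ W p Y = 0 := by
  have hpc := mem_cone hC hp
  have hWp : ContDiffAt ℝ ∞ W p := hW.contDiffAt (isOpen_cone.mem_nhds hpc)
  have hD : HasFDerivAt (fderiv ℝ W) (fderiv ℝ (fderiv ℝ W) p) p :=
    ((hWp.fderiv_right (m := 1) (by norm_cast)).differentiableAt (by simp)).hasFDerivAt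
  have hsymm := second_derivative_symmetric_of_eventually (f := W) (f' := fderiv ℝ W)
    (Filter.eventually_of_mem (isOpen_cone.mem_nhds hpc) fun y hy =>
      ((hW.contDiffAt (isOpen_cone.mem_nhds hy)).differentiableAt (by simp)).hasFDerivAt) hD
  -- Radiality is used as the identity `⟨DW Z, a⟩ ⟨y, p⟩ = ⟨DW Z, p⟩ ⟨y, a⟩` in `y`, which is
  -- differentiated at `p` in the direction `X`; this avoids any smoothness of the radial
  -- coefficient.
  have key : ∀ X Z a : Ambient (m + 2), ip C X p = 0 → ip C p a = 0 →
      ip C (fderiv ℝ (fderiv ℝ W) p X Z) a * (1 / C) = ip C (fderiv ℝ W p Z) p * ip C X a := by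
    intro X Z a hX ha
    have hDZ : HasFDerivAt (fun y => fderiv ℝ W y Z) ((fderiv ℝ (fderiv ℝ W) p).flip Z) p := by
      refine (hD.clm_apply (hasFDerivAt_const Z p)).congr_fderiv ?_
      ext v; simp
    have e1 := (hDZ.ip (C := C) (hasFDerivAt_const a p)).mul
      ((hasFDerivAt_id p).ip (C := C) (hasFDerivAt_const p p))
    have e2 := (hDZ.ip (C := C) (hasFDerivAt_const p p)).mul
      ((hasFDerivAt_id p).ip (C := C) (hasFDerivAt_const a p))
    have h12 : (fun y => ip C (fderiv ℝ W y Z) a * ip C (id y) p) =ᶠ[𝓝 p]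
        fun y => ip C (fderiv ℝ W y Z) p * ip C (id y) a := by
      refine Filter.eventuallyEq_of_mem (isOpen_cone.mem_nhds hpc) fun y hy => ?_
      obtain ⟨b, hb⟩ := hrad y hy Z
      simp only [hb, ip_smul_left, id]
      ring
    have := congrArg (fun T => T X) ((e1.congr_of_eventuallyEq h12.symm).unique e2)
    simp [← ip_eq_ipL, hX, ha, ip_self_of_mem hp] at this
    rw [one_div]
    linarith
  obtain ⟨X, hX0, hXp, hXY⟩ := exists_tangent_orthogonal (C := C) p Y
  have h1 := key X Y X hXp (by rw [ip_comm, hXp])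
  have h2 := key Y X X hY (by rw [ip_comm, hXp])
  rw [hsymm X Y, h2, ip_comm Y X, hXY, mul_zero] at h1
  have hXX : ip C X X ≠ 0 := fun h => hX0 (eq_zero_of_tangent hC hp hXp h)
  have h3 : ip C (fderiv ℝ W p Y) p = 0 := by
    rcases mul_eq_zero.mp h1.symm with h | h
    · exact h
    · exact absurd h hXX
  obtain ⟨b, hb⟩ := hrad p hpc Y
  rw [hb, ip_smul_left, ip_self_of_mem hp] at h3
  rw [hb, (mul_eq_zero.mp h3).resolve_right (one_div_ne_zero hC), zero_smul]

/-- Concircular vector fields of the space form are the tangential parts of constant vectors. -/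
theorem IsConcircularField.exists_axis {m : ℕ} (hC : C ≠ 0)
    {V : Ambient (m + 2) → Ambient (m + 2)} (hV : IsConcircularField C V) :
    ∃ w : Ambient (m + 2), ∀ p ∈ spaceForm (m + 2) C, V p = tanProj C p w := by
  obtain ⟨μ, hμ, hμV⟩ := hV.concircular
  -- For `V = w - C ⟨w, p⟩ p` one has `μ = -C ⟨w, p⟩`, so `V - μ p` is the candidate for the
  -- constant `w`. Composing with `coneProj` turns its constancy on the space form into a vanishing
  -- derivative on an open set.
  set W₀ : Ambient (m + 2) → Ambient (m + 2) := fun y => V y - μ y • y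
  have hW₀ : ContDiff ℝ ∞ W₀ := hV.smooth.sub (hμ.smul contDiff_id)
  set W := W₀ ∘ coneProj C
  have hr : ∀ y ∈ cone (m + 2) C, DifferentiableAt ℝ (coneProj C) y := fun y hy =>
    (contDiffOn_coneProj.contDiffAt (isOpen_cone.mem_nhds hy)).differentiableAt (by simp)
  have hW : ContDiffOn ℝ ∞ W (cone (m + 2) C) := hW₀.comp_contDiffOn contDiffOn_coneProj
  have hrad : ∀ y ∈ cone (m + 2) C, ∀ X, ∃ a : ℝ, fderiv ℝ W y X = a • y := by
    intro y hy X
    set X' := fderiv ℝ (coneProj C) y X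
    have hX' : ip C X' (coneProj C y) = 0 := fderiv_coneProj_tangent hC hy X
    have h1 : fderiv ℝ W y X = fderiv ℝ W₀ (coneProj C y) X' := by
      rw [fderiv_comp y (hW₀.contDiffAt.differentiableAt (by simp)) (hr y hy)]
      rfl
    have h2 : fderiv ℝ W₀ (coneProj C y) X' = fderiv ℝ V (coneProj C y) X' -
        (μ (coneProj C y) • X' + fderiv ℝ μ (coneProj C y) X' • coneProj C y) := by
      have hv := (hV.smooth.contDiffAt (x := coneProj C y)).differentiableAt (by simp)
      have hm := (hμ.contDiffAt (x := coneProj C y)).differentiableAt (by simp)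
      rw [show fderiv ℝ W₀ (coneProj C y) = _ from
        (hv.hasFDerivAt.sub (hm.hasFDerivAt.smul (hasFDerivAt_id _))).fderiv]
      simp
    have h3 := hμV _ (coneProj_mem hC hy) X' hX'
    rw [covDeriv, tanProj, sub_eq_iff_eq_add] at h3
    refine ⟨(C * ip C (fderiv ℝ V (coneProj C y) X') (coneProj C y) -
      fderiv ℝ μ (coneProj C y) X') * (√(C * ip C y y))⁻¹, ?_⟩
    rw [h1, h2, mul_smul]
    nth_rw 1 [h3]
    change _ = _ • coneProj C y
    module
  have hzero : ∀ y ∈ cone (m + 2) C, fderiv ℝ W y = 0 := by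
    intro y hy
    have h1 : W =ᶠ[𝓝 y] W ∘ coneProj C :=
      Filter.eventuallyEq_of_mem (isOpen_cone.mem_nhds hy) fun u hu => by
        simp only [W, Function.comp, coneProj_of_mem hC (coneProj_mem hC hu)]
    have hp := coneProj_mem hC hy
    ext1 X
    rw [h1.fderiv_eq, fderiv_comp y
      ((hW.contDiffAt (isOpen_cone.mem_nhds (mem_cone hC hp))).differentiableAt (by simp))
      (hr y hy)]
    exact fderiv_eq_zero_of_radial hC hW hrad hp (fderiv_coneProj_tangent hC hy X)
  have hconst : ∀ p ∈ spaceForm (m + 2) C, ∀ q ∈ spaceForm (m + 2) C, W p = W q :=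
    fun p hp q hq => isOpen_cone.is_const_of_fderiv_eq_zero
      (isPreconnected_cone hC (by omega)) (hW.differentiableOn (by simp)) hzero
      (mem_cone hC hp) (mem_cone hC hq)
  rcases (spaceForm (m + 2) C).eq_empty_or_nonempty with h | ⟨p₀, hp₀⟩
  · exact ⟨0, by simp [h]⟩
  refine ⟨W p₀, fun p hp => ?_⟩
  rw [hconst p₀ hp₀ p hp]
  have : W p = V p - μ p • p := by simp only [W, Function.comp, coneProj_of_mem hC hp, W₀]
  rw [this, tanProj, ip_sub_left, ip_smul_left, hV.tangent p hp, ip_self_of_mem hp]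
  have : C * (0 - μ p * (1 / C)) = - μ p := by field_simp; ring
  rw [this]
  module

end Concircular

/-! ### Local theory of the hypersurface: the axis direction and the shape operator -/

/-- A parametrized hypersurface `X` of the space form over an open set `D` of parameters, with a
smooth unit normal field `N` for which `⟨N, w⟩` is the constant `l`. -/
structure Patch {k : ℕ} (C : ℝ) (w : Ambient (k + 2)) (l : ℝ)
    (D : Set (EuclideanSpace ℝ (Fin (k + 1))))
    (X N : EuclideanSpace ℝ (Fin (k + 1)) → Ambient (k + 2)) : Prop where
  isOpen : IsOpen D
  smooth : ContDiffOn ℝ ∞ X D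
  smooth_normal : ContDiffOn ℝ ∞ N D
  immersion : ∀ u ∈ D, Function.Injective (fderiv ℝ X u)
  mem : ∀ u ∈ D, X u ∈ spaceForm (k + 2) C
  normal_position : ∀ u ∈ D, ip C (N u) (X u) = 0
  normal : ∀ u ∈ D, ∀ v, ip C (N u) (fderiv ℝ X u v) = 0
  unit : ∀ u ∈ D, ip C (N u) (N u) = 1
  axis : ∀ u ∈ D, ip C (N u) w = l

/-- The component of `w` tangent to the hypersurface, at a point `p` with unit normal `ν`. -/
def axisTangent {n : ℕ} (C : ℝ) (w : Ambient n) (l : ℝ) (p ν : Ambient n) : Ambient n :=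
  w - (C * ip C w p) • p - l • ν

namespace Patch

variable {k : ℕ} {C : ℝ} {w : Ambient (k + 2)} {l : ℝ}
  {D : Set (EuclideanSpace ℝ (Fin (k + 1)))}
  {X N : EuclideanSpace ℝ (Fin (k + 1)) → Ambient (k + 2)} {u : EuclideanSpace ℝ (Fin (k + 1))}

theorem mono (P : Patch C w l D X N) {D' : Set (EuclideanSpace ℝ (Fin (k + 1)))}
    (hD' : IsOpen D') (h : D' ⊆ D) : Patch C w l D' X N where
  isOpen := hD'
  smooth := P.smooth.mono h
  smooth_normal := P.smooth_normal.mono h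
  immersion u hu := P.immersion u (h hu)
  mem u hu := P.mem u (h hu)
  normal_position u hu := P.normal_position u (h hu)
  normal u hu := P.normal u (h hu)
  unit u hu := P.unit u (h hu)
  axis u hu := P.axis u (h hu)

theorem neg (P : Patch C w l D X N) : Patch C (-w) (-l) D X N :=
  { P with axis := fun u hu => by rw [ip_neg_right, P.axis u hu] }

theorem contDiffAt (P : Patch C w l D X N) (hu : u ∈ D) : ContDiffAt ℝ ∞ X u :=
  P.smooth.contDiffAt (P.isOpen.mem_nhds hu)

theorem contDiffAt_normal (P : Patch C w l D X N) (hu : u ∈ D) : ContDiffAt ℝ ∞ N u :=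
  P.smooth_normal.contDiffAt (P.isOpen.mem_nhds hu)

theorem differentiableAt (P : Patch C w l D X N) (hu : u ∈ D) : DifferentiableAt ℝ X u :=
  (P.contDiffAt hu).differentiableAt (by simp)

theorem differentiableAt_normal (P : Patch C w l D X N) (hu : u ∈ D) : DifferentiableAt ℝ N u :=
  (P.contDiffAt_normal hu).differentiableAt (by simp)

theorem ip_fderiv_of_const {f g : EuclideanSpace ℝ (Fin (k + 1)) → Ambient (k + 2)} {c : ℝ}
    (hD : IsOpen D) (hu : u ∈ D) (hf : DifferentiableAt ℝ f u) (hg : DifferentiableAt ℝ g u)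
    (h : ∀ u ∈ D, ip C (f u) (g u) = c) (v : EuclideanSpace ℝ (Fin (k + 1))) :
    ip C (f u) (fderiv ℝ g u v) + ip C (fderiv ℝ f u v) (g u) = 0 := by
  have h1 : (fun u => ip C (f u) (g u)) =ᶠ[𝓝 u] fun _ => c :=
    Filter.eventuallyEq_of_mem (hD.mem_nhds hu) h
  rw [← fderiv_ip hf hg, h1.fderiv_eq]
  simp

theorem ip_fderiv_position (P : Patch C w l D X N) (hu : u ∈ D)
    (v : EuclideanSpace ℝ (Fin (k + 1))) : ip C (fderiv ℝ X u v) (X u) = 0 := by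
  have := ip_fderiv_of_const (C := C) P.isOpen hu (P.differentiableAt hu) (P.differentiableAt hu)
    (fun u hu => ip_self_of_mem (P.mem u hu)) v
  rw [ip_comm (X u)] at this
  linarith

/-- The derivative at `(u, 0, 0)` of `(u, s, t) ↦ X u + s N u + t X u`. -/
def frameMap (X N : EuclideanSpace ℝ (Fin (k + 1)) → Ambient (k + 2))
    (u : EuclideanSpace ℝ (Fin (k + 1))) :
    EuclideanSpace ℝ (Fin (k + 1)) × ℝ × ℝ →L[ℝ] Ambient (k + 2) :=
  (fderiv ℝ X u).coprod (((ContinuousLinearMap.id ℝ ℝ).smulRight (N u)).coprod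
    ((ContinuousLinearMap.id ℝ ℝ).smulRight (X u)))

theorem frameMap_apply (v : EuclideanSpace ℝ (Fin (k + 1))) (s t : ℝ) :
    frameMap X N u (v, s, t) = fderiv ℝ X u v + (s • N u + t • X u) := by
  simp [frameMap]

theorem frameMap_injective (hC : C ≠ 0) (P : Patch C w l D X N) (hu : u ∈ D) :
    Function.Injective (frameMap X N u) := by
  refine (injective_iff_map_eq_zero _).mpr ?_
  rintro ⟨v, s, t⟩ h
  rw [frameMap_apply] at h
  have h1 := congrArg (fun y => ip C (N u) y) h
  have h2 := congrArg (fun y => ip C y (X u)) h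
  simp only [ip_add_right, ip_add_left, ip_smul_left, ip_smul_right, P.normal u hu,
    P.normal_position u hu, P.unit u hu, P.ip_fderiv_position hu, ip_self_of_mem (P.mem u hu),
    ip_zero_left, ip_zero_right] at h1 h2
  have hs : s = 0 := by linarith
  have ht : t = 0 := by
    rcases mul_eq_zero.mp (show t * (1 / C) = 0 by linarith) with h | h
    · exact h
    · exact absurd h (one_div_ne_zero hC)
  subst hs ht
  have hv : fderiv ℝ X u v = fderiv ℝ X u 0 := by simpa using h
  simp [P.immersion u hu hv]

/-- `frameMap` as a linear equivalence. -/
def frameEquiv (hC : C ≠ 0) (P : Patch C w l D X N) (hu : u ∈ D) :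
    (EuclideanSpace ℝ (Fin (k + 1)) × ℝ × ℝ) ≃L[ℝ] Ambient (k + 2) :=
  (LinearEquiv.ofInjectiveOfFinrankEq
    ((frameMap X N u : _ →L[ℝ] Ambient (k + 2)) : _ →ₗ[ℝ] Ambient (k + 2))
    (P.frameMap_injective hC hu) (by simp)).toContinuousLinearEquiv

theorem frameEquiv_coe (hC : C ≠ 0) (P : Patch C w l D X N) (hu : u ∈ D) :
    ((P.frameEquiv hC hu : _ ≃L[ℝ] Ambient (k + 2)) : _ →L[ℝ] Ambient (k + 2))
      = frameMap X N u := by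
  rfl

/-- By dimension, tangent vectors, normal and position together span the ambient space; pairing with
`N` and `X` then isolates the tangent part. -/
theorem exists_fderiv_eq (hC : C ≠ 0) (P : Patch C w l D X N) (hu : u ∈ D) {v : Ambient (k + 2)}
    (h1 : ip C v (X u) = 0) (h2 : ip C v (N u) = 0) : ∃ τ, fderiv ℝ X u τ = v := by
  obtain ⟨⟨τ, s, t⟩, hv⟩ := (P.frameEquiv hC hu).surjective v
  have hv' : fderiv ℝ X u τ + (s • N u + t • X u) = v := by
    rw [← hv, ← frameMap_apply, ← P.frameEquiv_coe hC hu]; rfl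
  rw [ip_comm] at h2
  rw [← hv'] at h1 h2
  have h3 := P.normal u hu τ
  have h4 := P.normal_position u hu
  simp only [ip_add_left, ip_smul_left, ip_add_right, ip_smul_right, P.ip_fderiv_position hu,
    h3, h4, P.unit u hu, ip_self_of_mem (P.mem u hu)] at h1 h2
  have hs : s = 0 := by linarith
  have ht : t = 0 := by
    rcases mul_eq_zero.mp (show t * (1 / C) = 0 by linarith) with h | h
    · exact h
    · exact absurd h (one_div_ne_zero hC)
  exact ⟨τ, by rw [← hv', hs, ht]; simp⟩

theorem ip_axisTangent_position (hC : C ≠ 0) (P : Patch C w l D X N) (hu : u ∈ D) :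
    ip C (axisTangent C w l (X u) (N u)) (X u) = 0 := by
  simp only [axisTangent, ip_sub_left, ip_smul_left, P.normal_position u hu,
    ip_self_of_mem (P.mem u hu)]
  field_simp
  ring

theorem ip_axisTangent_normal (P : Patch C w l D X N) (hu : u ∈ D) :
    ip C (axisTangent C w l (X u) (N u)) (N u) = 0 := by
  rw [ip_comm]
  simp only [axisTangent, ip_sub_right, ip_smul_right, P.unit u hu, P.axis u hu,
    P.normal_position u hu]
  ring

/-- With `ip_axisTangent_self` this says that `⟨w, E⟩ = ⟨E, E⟩` is a function of the height only.
All later comparisons of `|E|` with `leafSlope` rest on it. -/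
theorem ip_axis_axisTangent (P : Patch C w l D X N) (hu : u ∈ D) :
    ip C w (axisTangent C w l (X u) (N u)) = ip C w w - l ^ 2 - C * ip C w (X u) ^ 2 := by
  simp only [axisTangent, ip_sub_right, ip_smul_right, ip_comm _ (N u), P.axis u hu]
  ring

theorem ip_axisTangent_self (hC : C ≠ 0) (P : Patch C w l D X N) (hu : u ∈ D) :
    ip C (axisTangent C w l (X u) (N u)) (axisTangent C w l (X u) (N u))
      = ip C w w - l ^ 2 - C * ip C w (X u) ^ 2 := by
  nth_rw 1 [axisTangent]
  rw [ip_sub_left, ip_sub_left, ip_smul_left, ip_smul_left, ip_comm (X u), ip_comm (N u),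
    P.ip_axisTangent_position hC hu, P.ip_axisTangent_normal hu, P.ip_axis_axisTangent hu]
  ring

theorem ip_axis_fderiv (P : Patch C w l D X N) (hu : u ∈ D)
    (v : EuclideanSpace ℝ (Fin (k + 1))) :
    ip C (axisTangent C w l (X u) (N u)) (fderiv ℝ X u v) = ip C w (fderiv ℝ X u v) := by
  simp only [axisTangent, ip_sub_left, ip_smul_left, P.normal u hu, ip_comm (X u),
    P.ip_fderiv_position hu]
  ring

/-- `E` represents `⟨w, ·⟩` on tangent vectors and is itself tangent, so it can be paired with
itself. -/
theorem axisTangent_eq_zero_iff (hC : C ≠ 0) (P : Patch C w l D X N) (hu : u ∈ D) :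
    axisTangent C w l (X u) (N u) = 0 ↔ ∀ v, ip C w (fderiv ℝ X u v) = 0 := by
  refine ⟨fun h v => by rw [← P.ip_axis_fderiv hu, h, ip_zero_left], fun h => ?_⟩
  obtain ⟨τ, hτ⟩ := P.exists_fderiv_eq hC hu (P.ip_axisTangent_position hC hu)
    (P.ip_axisTangent_normal hu)
  refine eq_zero_of_tangent hC (P.mem u hu) (P.ip_axisTangent_position hC hu) ?_
  nth_rw 2 [← hτ]
  rw [P.ip_axis_fderiv hu, h]

/-- Symmetry of the shape operator: differentiating `⟨N, dX b⟩ = 0` reduces it to the symmetry of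
`D²X`. -/
theorem ip_fderiv_normal_symm (P : Patch C w l D X N) (hu : u ∈ D)
    (v v' : EuclideanSpace ℝ (Fin (k + 1))) :
    ip C (fderiv ℝ N u v) (fderiv ℝ X u v') = ip C (fderiv ℝ N u v') (fderiv ℝ X u v) := by
  have hd : HasFDerivAt (fderiv ℝ X) (fderiv ℝ (fderiv ℝ X) u) u :=
    (((P.contDiffAt hu).fderiv_right (m := 1) (by norm_cast)).differentiableAt
      (by simp)).hasFDerivAt
  have hsymm := second_derivative_symmetric_of_eventually (f := X) (f' := fderiv ℝ X)
    (Filter.eventually_of_mem (P.isOpen.mem_nhds hu) fun y hy =>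
      (P.differentiableAt hy).hasFDerivAt) hd
  have key : ∀ a b : EuclideanSpace ℝ (Fin (k + 1)),
      ip C (fderiv ℝ N u a) (fderiv ℝ X u b) = - ip C (N u) (fderiv ℝ (fderiv ℝ X) u a b) := by
    intro a b
    have hdb : HasFDerivAt (fun y => fderiv ℝ X y b) ((fderiv ℝ (fderiv ℝ X) u).flip b) u := by
      refine (hd.clm_apply (hasFDerivAt_const b u)).congr_fderiv ?_
      ext v; simp
    have := ip_fderiv_of_const (C := C) P.isOpen hu (P.differentiableAt_normal hu)
      hdb.differentiableAt (fun u hu => P.normal u hu b) a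
    rw [hdb.fderiv] at this
    simp only [ContinuousLinearMap.flip_apply] at this
    linarith
  rw [key, key, hsymm]

/-- The direction tangent to the axis lies in the kernel of the shape operator. -/
theorem fderiv_normal_eq_zero (hC : C ≠ 0) (P : Patch C w l D X N) (hu : u ∈ D)
    {τ : EuclideanSpace ℝ (Fin (k + 1))} (hτ : fderiv ℝ X u τ = axisTangent C w l (X u) (N u)) :
    fderiv ℝ N u τ = 0 := by
  have hN := P.differentiableAt_normal hu
  have h1 : ∀ v, ip C (fderiv ℝ N u v) (N u) = 0 := by
    intro v
    have := ip_fderiv_of_const (C := C) P.isOpen hu hN hN P.unit v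
    rw [ip_comm (N u)] at this
    linarith
  have h2 : ∀ v, ip C (fderiv ℝ N u v) (X u) = 0 := by
    intro v
    have := ip_fderiv_of_const (C := C) P.isOpen hu hN (P.differentiableAt hu) P.normal_position v
    rw [P.normal u hu] at this
    linarith
  have h3 : ∀ v, ip C (fderiv ℝ N u v) w = 0 := by
    intro v
    have := ip_fderiv_of_const (C := C) P.isOpen hu hN (differentiableAt_const w) P.axis v
    simp at this
    exact this
  -- `dN τ` is itself tangent, say `dX σ`. By symmetry `⟨dN τ, dN τ⟩ = ⟨dN σ, E⟩`, and `dN σ` is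
  -- orthogonal to `w`, `X` and `N`, of which `E` is a combination.
  obtain ⟨σ, hσ⟩ := P.exists_fderiv_eq hC hu (h2 τ) (h1 τ)
  refine eq_zero_of_tangent hC (P.mem u hu) (h2 τ) ?_
  nth_rw 2 [← hσ]
  rw [P.ip_fderiv_normal_symm hu, hτ, axisTangent, ip_sub_right, ip_sub_right, ip_smul_right,
    ip_smul_right, h1, h2, h3]
  ring

end Patch

/-! ### Smooth retractions onto the hypersurface -/

/-- A patch with a smooth retraction `r` of an open set `O` of the ambient space. -/
structure TubularPatch {k : ℕ} (C : ℝ) (w : Ambient (k + 2)) (l : ℝ)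
    (D : Set (EuclideanSpace ℝ (Fin (k + 1))))
    (X N : EuclideanSpace ℝ (Fin (k + 1)) → Ambient (k + 2)) (O : Set (Ambient (k + 2)))
    (r : Ambient (k + 2) → EuclideanSpace ℝ (Fin (k + 1))) : Prop
    extends Patch C w l D X N where
  isOpen_tube : IsOpen O
  smooth_retraction : ContDiffOn ℝ ∞ r O
  mapsTo_retraction : Set.MapsTo r O D
  mem_tube : ∀ u ∈ D, X u ∈ O
  retraction : ∀ u ∈ D, r (X u) = u

section

variable {k : ℕ} {C : ℝ} {w : Ambient (k + 2)} {l : ℝ}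
  {D : Set (EuclideanSpace ℝ (Fin (k + 1)))}
  {X N : EuclideanSpace ℝ (Fin (k + 1)) → Ambient (k + 2)} {u : EuclideanSpace ℝ (Fin (k + 1))}
  {O : Set (Ambient (k + 2))} {r : Ambient (k + 2) → EuclideanSpace ℝ (Fin (k + 1))}

/-- The inverse function theorem for `(u, s, t) ↦ X u + s N u + t X u`, whose derivative at `(u, 0,
0)` is `frameMap`; the retraction is the first coordinate of the local inverse. -/
theorem Patch.exists_tubularPatch (hC : C ≠ 0) (P : Patch C w l D X N) (hu : u ∈ D) :
    ∃ D' ⊆ D, u ∈ D' ∧ ∃ O r, TubularPatch C w l D' X N O r := by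
  set Φ : EuclideanSpace ℝ (Fin (k + 1)) × ℝ × ℝ → Ambient (k + 2) :=
    fun z => X z.1 + (z.2.1 • N z.1 + z.2.2 • X z.1)
  have hs : IsOpen (Prod.fst ⁻¹' D : Set (EuclideanSpace ℝ (Fin (k + 1)) × ℝ × ℝ)) :=
    P.isOpen.preimage continuous_fst
  have hX1 : ContDiffOn ℝ ∞ (fun z : EuclideanSpace ℝ (Fin (k + 1)) × ℝ × ℝ => X z.1)
      (Prod.fst ⁻¹' D) := P.smooth.comp contDiff_fst.contDiffOn fun z hz => hz
  have hN1 : ContDiffOn ℝ ∞ (fun z : EuclideanSpace ℝ (Fin (k + 1)) × ℝ × ℝ => N z.1)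
      (Prod.fst ⁻¹' D) := P.smooth_normal.comp contDiff_fst.contDiffOn fun z hz => hz
  have hΦ : ContDiffOn ℝ ∞ Φ (Prod.fst ⁻¹' D) :=
    hX1.add (((contDiff_fst.comp contDiff_snd).contDiffOn.smul hN1).add
      ((contDiff_snd.comp contDiff_snd).contDiffOn.smul hX1))
  have hΦ' : HasFDerivAt Φ ((P.frameEquiv hC hu : _ ≃L[ℝ] Ambient (k + 2)) : _ →L[ℝ] Ambient (k + 2))
      (u, 0, 0) := by
    rw [P.frameEquiv_coe]
    have d0 : HasFDerivAt (fun z : EuclideanSpace ℝ (Fin (k + 1)) × ℝ × ℝ => z.1)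
        (ContinuousLinearMap.fst ℝ _ _) (u, 0, 0) := hasFDerivAt_fst
    have d1 : HasFDerivAt (fun z : EuclideanSpace ℝ (Fin (k + 1)) × ℝ × ℝ => z.2.1)
        ((ContinuousLinearMap.fst ℝ _ _).comp (ContinuousLinearMap.snd ℝ _ _)) (u, 0, 0) :=
      hasFDerivAt_fst.comp _ hasFDerivAt_snd
    have d2 : HasFDerivAt (fun z : EuclideanSpace ℝ (Fin (k + 1)) × ℝ × ℝ => z.2.2)
        ((ContinuousLinearMap.snd ℝ _ _).comp (ContinuousLinearMap.snd ℝ _ _)) (u, 0, 0) :=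
      hasFDerivAt_snd.comp _ hasFDerivAt_snd
    have dX := (P.differentiableAt hu).hasFDerivAt.comp (u, (0 : ℝ), (0 : ℝ)) d0
    have dN := (P.differentiableAt_normal hu).hasFDerivAt.comp (u, (0 : ℝ), (0 : ℝ)) d0
    refine (dX.add ((d1.smul dN).add (d2.smul dX))).congr_fderiv ?_
    refine ContinuousLinearMap.ext fun z => ?_
    obtain ⟨v, s, t⟩ := z
    rw [frameMap_apply]
    simp
  obtain ⟨e, he, hes, hef, hesymm⟩ := exists_openPartialHomeomorph hs hΦ (a := (u, 0, 0)) hu hΦ'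
  have hΦ0 : ∀ u, Φ (u, 0, 0) = X u := fun u => by simp [Φ]
  set D' : Set (EuclideanSpace ℝ (Fin (k + 1))) := (fun u => (u, (0 : ℝ), (0 : ℝ))) ⁻¹' e.source
  have hD' : D' ⊆ D := fun v hv => hes hv
  have hD'o : IsOpen D' := e.open_source.preimage (by fun_prop)
  have hr : ContDiffOn ℝ ∞ (fun y => (e.symm y).1) e.target := contDiff_fst.comp_contDiffOn hesymm
  have hret : ∀ v ∈ D', (e.symm (X v)).1 = v := fun v hv => by
    have := e.left_inv hv
    rw [hef, hΦ0] at this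
    rw [this]
  refine ⟨D', hD', he, e.target ∩ (fun y => (e.symm y).1) ⁻¹' D', fun y => (e.symm y).1,
    { P.mono hD'o hD' with
      isOpen_tube := hr.continuousOn.isOpen_inter_preimage e.open_target hD'o
      smooth_retraction := hr.mono Set.inter_subset_left
      mapsTo_retraction := fun y hy => hy.2
      mem_tube := fun v hv => ⟨?_, ?_⟩
      retraction := hret }⟩
  · have := e.map_source hv
    rwa [hef, hΦ0] at this
  · simpa only [Set.mem_preimage, hret v hv] using hv

theorem TubularPatch.injOn (P : TubularPatch C w l D X N O r) : Set.InjOn X D :=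
  fun u hu v hv h => by rw [← P.retraction u hu, h, P.retraction v hv]

theorem TubularPatch.fderiv_retraction (P : TubularPatch C w l D X N O r) (hu : u ∈ D)
    (v : EuclideanSpace ℝ (Fin (k + 1))) : fderiv ℝ r (X u) (fderiv ℝ X u v) = v := by
  have hr : DifferentiableAt ℝ r (X u) := (P.smooth_retraction.contDiffAt
    (P.isOpen_tube.mem_nhds (P.mem_tube u hu))).differentiableAt (by simp)
  have h1 : r ∘ X =ᶠ[𝓝 u] id := Filter.eventuallyEq_of_mem (P.isOpen.mem_nhds hu)
    fun v hv => P.retraction v hv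
  have h2 := h1.fderiv_eq (𝕜 := ℝ)
  rw [fderiv_comp u hr (P.differentiableAt hu), fderiv_id] at h2
  exact congrArg (fun T : EuclideanSpace ℝ (Fin (k + 1)) →L[ℝ] EuclideanSpace ℝ (Fin (k + 1)) => T v) h2

end

/-! ### Height along the leaves -/

/-- The height `⟨w, ·⟩` along an integral curve of the tangential part of the axis. -/
def leafHeight (C c ρ z : ℝ) : ℝ := c * cs C z + ρ * sn C z

/-- The derivative of `leafHeight`. -/
def leafSlope (C c ρ z : ℝ) : ℝ := ρ * cs C z - C * c * sn C z

section

variable {C c ρ : ℝ}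

@[simp] theorem leafHeight_zero : leafHeight C c ρ 0 = c := by simp [leafHeight]

@[simp] theorem leafSlope_zero : leafSlope C c ρ 0 = ρ := by simp [leafSlope]

theorem leafHeight_add (hC : C ≠ 0) (s z : ℝ) : leafHeight C c ρ (s + z) =
    leafHeight C (leafHeight C c ρ s) (leafSlope C c ρ s) z := by
  simp only [leafHeight, leafSlope, cs_add hC, sn_add]
  ring

theorem leafSlope_add (hC : C ≠ 0) (s z : ℝ) : leafSlope C c ρ (s + z) =
    leafSlope C (leafHeight C c ρ s) (leafSlope C c ρ s) z := by
  simp only [leafHeight, leafSlope, cs_add hC, sn_add]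
  ring

/-- A conservation law. When `ρ² + C c² = ⟨w, w⟩ - l²`, the right side is `⟨E, E⟩` at the same
height, so the slope is `|E|` up to sign. -/
theorem leafSlope_sq (hC : C ≠ 0) (z : ℝ) :
    leafSlope C c ρ z ^ 2 = ρ ^ 2 + C * c ^ 2 - C * leafHeight C c ρ z ^ 2 := by
  simp only [leafHeight, leafSlope]
  linear_combination (ρ ^ 2 + C * c ^ 2) * cs_sq_add hC z

theorem hasDerivAt_leafHeight (hC : C ≠ 0) (z : ℝ) :
    HasDerivAt (leafHeight C c ρ) (leafSlope C c ρ z) z := by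
  refine (((hasDerivAt_cs hC z).const_mul c).add
    ((hasDerivAt_sn hC z).const_mul ρ)).congr_deriv ?_
  simp only [leafSlope]
  ring

theorem contDiff_leafHeight {m : ℕ∞ω} : ContDiff ℝ m (leafHeight C c ρ) :=
  (contDiff_const.mul contDiff_cs).add (contDiff_const.mul contDiff_sn)

theorem contDiff_leafSlope {m : ℕ∞ω} : ContDiff ℝ m (leafSlope C c ρ) :=
  (contDiff_const.mul contDiff_cs).sub (contDiff_const.mul contDiff_sn)

end

/-! ### Geodesics in the axis direction stay in the hypersurface -/

namespace TubularPatch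

variable {k : ℕ} {C : ℝ} {w : Ambient (k + 2)} {l : ℝ}
  {D : Set (EuclideanSpace ℝ (Fin (k + 1)))}
  {X N : EuclideanSpace ℝ (Fin (k + 1)) → Ambient (k + 2)} {u : EuclideanSpace ℝ (Fin (k + 1))}
  {O : Set (Ambient (k + 2))} {r : Ambient (k + 2) → EuclideanSpace ℝ (Fin (k + 1))}

theorem contDiffOn_comp (P : TubularPatch C w l D X N O r) :
    ContDiffOn ℝ ∞ (fun y => X (r y)) O :=
  P.smooth.comp P.smooth_retraction P.mapsTo_retraction

theorem contDiffOn_normal_comp (P : TubularPatch C w l D X N O r) :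
    ContDiffOn ℝ ∞ (fun y => N (r y)) O :=
  P.smooth_normal.comp P.smooth_retraction P.mapsTo_retraction

theorem contDiffOn_axisTangent_comp (P : TubularPatch C w l D X N O r) :
    ContDiffOn ℝ ∞ (fun y => axisTangent C w l (X (r y)) (N (r y))) O :=
  (contDiffOn_const.sub ((contDiffOn_const.mul (contDiffOn_const.ip P.contDiffOn_comp)).smul
    P.contDiffOn_comp)).sub (P.contDiffOn_normal_comp.const_smul l)

/-- Near a point of the hypersurface, both the hypersurface and its unit normal are invariant along
the axis direction: the deviations obey a linear differential inequality. -/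
theorem exists_bound (hC : C ≠ 0) (P : TubularPatch C w l D X N O r) (hu : u ∈ D) :
    ∃ δ > 0, Metric.ball (X u) δ ⊆ O ∧ ∃ L : ℝ, ∀ y ∈ Metric.ball (X u) δ, ∀ ν : Ambient (k + 2),
      ‖(axisTangent C w l y ν, (0 : Ambient (k + 2))) -
        fderiv ℝ (fun y => (X (r y), N (r y))) y (axisTangent C w l y ν)‖
        ≤ L * ‖(y, ν) - (X (r y), N (r y))‖ := by
  set T : Ambient (k + 2) → Ambient (k + 2) × Ambient (k + 2) := fun y => (X (r y), N (r y))
  set A : Ambient (k + 2) → Ambient (k + 2) := fun y => axisTangent C w l (X (r y)) (N (r y))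
  have hO : O ∈ 𝓝 (X u) := P.isOpen_tube.mem_nhds (P.mem_tube u hu)
  have hT : ContDiffOn ℝ ∞ T O := P.contDiffOn_comp.prodMk P.contDiffOn_normal_comp
  have hTd : ContDiffAt ℝ 1 (fderiv ℝ T) (X u) :=
    (hT.contDiffAt hO).fderiv_right (m := 1) (by norm_cast)
  have hA : ContDiffAt ℝ 1 A (X u) := (P.contDiffOn_axisTangent_comp.contDiffAt hO).of_le (by norm_cast)
  -- `G` vanishes on the hypersurface: there `r` is a retraction, `A` is tangent, and `N` has zero
  -- derivative along `A`. Since `G` is Lipschitz near `X u`, it is bounded by the distance from `y`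
  -- to its retract `X (r y)`.
  set G : Ambient (k + 2) → Ambient (k + 2) × Ambient (k + 2) := fun y => fderiv ℝ T y (A y) - (A y, 0)
  have hG : ContDiffAt ℝ 1 G (X u) := (hTd.clm_apply hA).sub (hA.prodMk contDiffAt_const)
  set Q : Ambient (k + 2) → Ambient (k + 2) := fun y => (C * ip C w y) • y
  have hQ : ContDiffAt ℝ 1 Q (X u) :=
    (contDiffAt_const.mul (contDiffAt_const.ip contDiffAt_id)).smul contDiffAt_id
  obtain ⟨K₁, t₁, ht₁, hK₁⟩ := hG.exists_lipschitzOnWith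
  obtain ⟨K₂, t₂, ht₂, hK₂⟩ := hQ.exists_lipschitzOnWith
  set K₃ := ‖fderiv ℝ T (X u)‖ + 1
  have ht₃ : {y | ‖fderiv ℝ T y‖ < K₃} ∈ 𝓝 (X u) :=
    hTd.continuousAt.norm.eventually_lt continuousAt_const (by simp [K₃])
  have ht : O ∩ t₁ ∩ t₂ ∈ 𝓝 (X u) := Filter.inter_mem (Filter.inter_mem hO ht₁) ht₂
  have hξ : (fun y => X (r y)) ⁻¹' (O ∩ t₁ ∩ t₂) ∈ 𝓝 (X u) := by
    refine (P.contDiffOn_comp.continuousOn.continuousAt hO).preimage_mem_nhds ?_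
    rwa [P.retraction u hu]
  obtain ⟨δ, hδ, hball⟩ := Metric.mem_nhds_iff.mp
    (Filter.inter_mem (Filter.inter_mem ht hξ) ht₃)
  refine ⟨δ, hδ, fun y hy => (hball hy).1.1.1.1, K₁ + (1 + K₃) * (K₂ + |l|), fun y hy ν => ?_⟩
  obtain ⟨⟨⟨⟨hyO, hy1⟩, hy2⟩, ⟨⟨hzO, hz1⟩, hz2⟩⟩, hy3⟩ := hball hy
  set z := X (r y)
  have hyD := P.mapsTo_retraction hyO
  have hrz : r z = r y := P.retraction _ hyD
  have hGz : G z = 0 := by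
    have hAz : A z = axisTangent C w l (X (r y)) (N (r y)) := by simp only [A, hrz]
    obtain ⟨τ, hτ⟩ := P.exists_fderiv_eq hC hyD (P.ip_axisTangent_position hC hyD)
      (P.ip_axisTangent_normal hyD)
    have hrd : DifferentiableAt ℝ r z :=
      (P.smooth_retraction.contDiffAt (P.isOpen_tube.mem_nhds hzO)).differentiableAt (by simp)
    have hz' : ∀ (f : EuclideanSpace ℝ (Fin (k + 1)) → Ambient (k + 2)), DifferentiableAt ℝ f (r y) →
        HasFDerivAt (fun y => f (r y)) ((fderiv ℝ f (r y)).comp (fderiv ℝ r z)) z := by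
      intro f hf
      rw [← hrz] at hf
      have := hf.hasFDerivAt.comp z hrd.hasFDerivAt
      rwa [hrz] at this
    have hTz := (hz' X (P.differentiableAt hyD)).prodMk (hz' N (P.differentiableAt_normal hyD))
    have h0 : fderiv ℝ r z (fderiv ℝ X (r y) τ) = τ := P.fderiv_retraction hyD τ
    simp only [G]
    rw [show fderiv ℝ T z = _ from hTz.fderiv, hAz, ← hτ]
    simp only [ContinuousLinearMap.prod_apply, ContinuousLinearMap.comp_apply, h0,
      P.fderiv_normal_eq_zero hC hyD hτ, sub_self]
  set d := ‖(y, ν) - T y‖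
  have hd1 : ‖y - z‖ ≤ d := norm_fst_le ((y, ν) - T y)
  have hd2 : ‖ν - N (r y)‖ ≤ d := norm_snd_le ((y, ν) - T y)
  have hGy : ‖G y‖ ≤ K₁ * d := by
    have := hK₁.norm_sub_le hy1 hz1
    rw [hGz, sub_zero] at this
    exact this.trans (mul_le_mul_of_nonneg_left hd1 K₁.2)
  -- The rest of the error comes from evaluating `axisTangent` at `(y, ν)` instead of at the
  -- retracted pair `T y`.
  set ε := axisTangent C w l y ν - A y
  have hε : ‖ε‖ ≤ (K₂ + |l|) * d := by
    have h1 : ε = -(Q y - Q z) - l • (ν - N (r y)) := by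
      simp only [ε, A, Q, axisTangent, z]; module
    rw [h1, add_mul]
    refine (norm_sub_le _ _).trans (add_le_add ?_ ?_)
    · rw [norm_neg]
      exact (hK₂.norm_sub_le hy2 hz2).trans (mul_le_mul_of_nonneg_left hd1 K₂.2)
    · rw [norm_smul, Real.norm_eq_abs]
      exact mul_le_mul_of_nonneg_left hd2 (abs_nonneg l)
  have hsplit : (axisTangent C w l y ν, (0 : Ambient (k + 2))) -
      fderiv ℝ T y (axisTangent C w l y ν) = -G y + ((ε, 0) - fderiv ℝ T y ε) := by
    have h1 : axisTangent C w l y ν = A y + ε := by simp [ε]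
    have h2 : (A y + ε, (0 : Ambient (k + 2))) = (A y, 0) + (ε, 0) := by simp
    rw [h1, map_add, h2]
    simp only [G]
    abel
  rw [hsplit]
  have h3 : ‖fderiv ℝ T y ε‖ ≤ K₃ * ‖ε‖ :=
    ((fderiv ℝ T y).le_opNorm ε).trans (mul_le_mul_of_nonneg_right (le_of_lt hy3) (norm_nonneg _))
  have h4 : ‖((ε, 0) : Ambient (k + 2) × Ambient (k + 2))‖ = ‖ε‖ := by simp [Prod.norm_def]
  have h5 : 0 ≤ K₃ := by positivity
  calc ‖-G y + ((ε, 0) - fderiv ℝ T y ε)‖ ≤ ‖G y‖ + (‖ε‖ + K₃ * ‖ε‖) := by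
        refine (norm_add_le _ _).trans ?_
        rw [norm_neg]
        gcongr
        refine (norm_sub_le _ _).trans ?_
        rw [h4]
        gcongr
    _ = ‖G y‖ + (1 + K₃) * ‖ε‖ := by ring
    _ ≤ K₁ * d + (1 + K₃) * ((K₂ + |l|) * d) := by gcongr
    _ = _ := by ring

/-- Through a point of the hypersurface, the geodesic of the space form in the direction of the
tangential part of the axis stays in the hypersurface, and the unit normal is constant on it. -/
theorem exists_ball (hC : C ≠ 0) (P : TubularPatch C w l D X N O r) {u₀} (hu₀ : u₀ ∈ D) :
    ∃ δ > 0, Metric.ball (X u₀) δ ⊆ O ∧ ∀ u ∈ D, ∀ (e : Ambient (k + 2)) (c ρ s t : ℝ),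
      ip C w (X u) = leafHeight C c ρ s →
      axisTangent C w l (X u) (N u) = leafSlope C c ρ s • e → ip C e e = 1 →
      (∀ z ∈ Set.uIcc s t, z ≠ t → 0 < leafSlope C c ρ z) →
      (∀ z ∈ Set.uIcc s t, geodesic C (X u) e (z - s) ∈ Metric.ball (X u₀) δ) →
      ∃ u' ∈ D, X u' = geodesic C (X u) e (t - s) ∧ N u' = N u ∧
        ip C w (X u') = leafHeight C c ρ t ∧
        axisTangent C w l (X u') (N u') = leafSlope C c ρ t • velocity C (X u) e (t - s) := by
  obtain ⟨δ, hδ, hO, L, hL⟩ := P.exists_bound hC hu₀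
  refine ⟨δ, hδ, hO, fun u hu e c ρ s t hh hE he hpos hball => ?_⟩
  rcases eq_or_ne s t with rfl | hst
  · exact ⟨u, hu, by simp, rfl, hh, by simpa using hE⟩
  have hs0 : 0 < leafSlope C c ρ s := hpos s Set.left_mem_uIcc hst
  have hwe : ip C w e = leafSlope C c ρ s := by
    have h1 := P.ip_axis_axisTangent hu
    rw [← P.ip_axisTangent_self hC hu, hE, ip_smul_left, ip_smul_right, ip_smul_right, he] at h1
    have := mul_left_cancel₀ hs0.ne' h1
    linarith
  have hheight : ∀ z, ip C w (geodesic C (X u) e z) = leafHeight C c ρ (s + z) := by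
    intro z
    rw [geodesic_eq, ip_add_right, ip_smul_right, ip_smul_right, hh, hwe, leafHeight_add hC]
    generalize leafHeight C c ρ s = h
    generalize leafSlope C c ρ s = σ
    simp only [leafHeight]
    ring
  -- With the normal frozen at `N u`, the geodesic already solves the equation of the leaves, up to
  -- the speed `leafSlope`: `w` is a combination of `e`, `X u` and `N u`, so this is a computation
  -- in that basis.
  have hfield : ∀ z, axisTangent C w l (geodesic C (X u) e z) (N u) =
      leafSlope C c ρ (s + z) • velocity C (X u) e z := by
    intro z
    have hw : w = leafSlope C c ρ s • e + (C * leafHeight C c ρ s) • X u + l • N u := by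
      rw [← hE, axisTangent, hh]; module
    rw [axisTangent, hheight]
    nth_rw 1 [hw]
    rw [leafSlope_add hC, leafHeight_add hC]
    generalize leafSlope C c ρ s = σ
    generalize leafHeight C c ρ s = h
    simp only [geodesic_eq, velocity, leafHeight, leafSlope]
    have := cs_sq_add hC z
    have e1 : σ • e = (σ * (cs C z ^ 2 + C * sn C z ^ 2)) • e := by rw [this, mul_one]
    have e2 : (C * h) • X u = (C * h * (cs C z ^ 2 + C * sn C z ^ 2)) • X u := by rw [this, mul_one]
    rw [e1, e2]
    module
  set T : Ambient (k + 2) → Ambient (k + 2) × Ambient (k + 2) := fun y => (X (r y), N (r y))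
  have hT : ContDiffOn ℝ ∞ T O := P.contDiffOn_comp.prodMk P.contDiffOn_normal_comp
  -- The deviation of (point, frozen normal) from its retraction to the hypersurface.
  -- `exists_bound`, divided by the speed, is the differential inequality for it.
  set f : ℝ → Ambient (k + 2) × Ambient (k + 2) :=
    fun z => (geodesic C (X u) e z, N u) - T (geodesic C (X u) e z)
  have hfd : ∀ z, geodesic C (X u) e z ∈ Metric.ball (X u₀) δ →
      HasDerivAt f ((velocity C (X u) e z, 0) -
        fderiv ℝ T (geodesic C (X u) e z) (velocity C (X u) e z)) z := by
    intro z hz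
    have hg := hasDerivAt_geodesic hC (X u) e z
    have hTz : DifferentiableAt ℝ T (geodesic C (X u) e z) :=
      (hT.contDiffAt (P.isOpen_tube.mem_nhds (hO hz))).differentiableAt (by simp)
    exact (hg.prodMk (hasDerivAt_const z (N u))).sub (hTz.hasFDerivAt.comp_hasDerivAt z hg)
  have hmem : ∀ z ∈ Set.uIcc 0 (t - s), s + z ∈ Set.uIcc s t := by
    intro z hz
    rcases le_total s t with h | h
    · rw [Set.uIcc_of_le (by linarith)] at hz
      rw [Set.uIcc_of_le h]
      exact ⟨by linarith [hz.1], by linarith [hz.2]⟩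
    · rw [Set.uIcc_of_ge (by linarith)] at hz
      rw [Set.uIcc_of_ge h]
      exact ⟨by linarith [hz.1], by linarith [hz.2]⟩
  have hball' : ∀ z ∈ Set.uIcc 0 (t - s), geodesic C (X u) e z ∈ Metric.ball (X u₀) δ := by
    intro z hz
    have := hball _ (hmem z hz)
    rwa [add_sub_cancel_left] at this
  -- The slope may vanish at the endpoint `t`, as it does where `E = 0`. So Gronwall is applied on
  -- shorter intervals, on which the slope has a positive minimum `m`; the endpoint follows by
  -- continuity.
  have hstrict : ∀ b ∈ Set.uIcc 0 (t - s), b ≠ t - s → f b = 0 := by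
    intro b hb hbt
    have hsub : Set.uIcc 0 b ⊆ Set.uIcc 0 (t - s) := Set.uIcc_subset_uIcc_left hb
    have hpos' : ∀ z ∈ Set.uIcc 0 b, 0 < leafSlope C c ρ (s + z) := by
      intro z hz
      refine hpos _ (hmem z (hsub hz)) fun h => ?_
      have hz' : z = t - s := by linarith
      subst hz'
      rcases le_total 0 (t - s) with h0 | h0
      · rw [Set.uIcc_of_le h0] at hb
        rw [Set.mem_uIcc] at hz
        rcases hz with hz | hz
        · exact hbt (le_antisymm hb.2 hz.2)
        · exact hbt (by linarith [hb.1, hz.1, hz.2, hb.2])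
      · rw [Set.uIcc_of_ge h0] at hb
        rw [Set.mem_uIcc] at hz
        rcases hz with hz | hz
        · exact hbt (by linarith [hb.1, hz.1, hz.2, hb.2])
        · exact hbt (le_antisymm hz.1 hb.1)
    have hcont : ContinuousOn (fun z => leafSlope C c ρ (s + z)) (Set.uIcc 0 b) :=
      ((contDiff_leafSlope (m := 0)).continuous.comp (continuous_const.add continuous_id)).continuousOn
    obtain ⟨z₀, hz₀, hmin⟩ := isCompact_uIcc.exists_isMinOn (Set.nonempty_uIcc) hcont
    set m := leafSlope C c ρ (s + z₀)
    have hm : 0 < m := hpos' z₀ hz₀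
    refine eq_zero_of_norm_deriv_le (K := |L| / m) (fun z hz => hfd z (hball' z (hsub hz))) ?_ ?_
    · simp [f, T, P.retraction u hu]
    · intro z hz
      have h1 := hL _ (hball' z (hsub hz)) (N u)
      rw [hfield] at h1
      set v := velocity C (X u) e z
      have h2 : ((leafSlope C c ρ (s + z) • v, 0) : Ambient (k + 2) × Ambient (k + 2)) -
          fderiv ℝ T (geodesic C (X u) e z) (leafSlope C c ρ (s + z) • v) =
          leafSlope C c ρ (s + z) • ((v, 0) - fderiv ℝ T (geodesic C (X u) e z) v) := by
        have h4 : ((leafSlope C c ρ (s + z) • v, 0) : Ambient (k + 2) × Ambient (k + 2)) =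
            leafSlope C c ρ (s + z) • (v, 0) := by simp
        rw [map_smul, smul_sub, h4]
      have h3 : m ≤ leafSlope C c ρ (s + z) := hmin hz
      change ‖_ - fderiv ℝ T (geodesic C (X u) e z) _‖ ≤ _ at h1
      rw [h2, norm_smul, Real.norm_eq_abs, abs_of_pos (hpos' z hz)] at h1
      rw [div_mul_eq_mul_div, le_div_iff₀ hm, mul_comm]
      refine (mul_le_mul_of_nonneg_right h3 (norm_nonneg _)).trans (h1.trans ?_)
      exact mul_le_mul_of_nonneg_right (le_abs_self L) (norm_nonneg _)
  have hf : f (t - s) = 0 := by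
    have hts : t - s ≠ 0 := sub_ne_zero.mpr hst.symm
    have hmem1 : ∀ a ∈ Set.Ioo (0 : ℝ) 1, a * (t - s) ∈ Set.uIcc 0 (t - s) := by
      intro a ha
      rcases le_total 0 (t - s) with h | h
      · rw [Set.uIcc_of_le h]
        exact ⟨mul_nonneg ha.1.le h, by nlinarith [ha.2]⟩
      · rw [Set.uIcc_of_ge h]
        exact ⟨by nlinarith [ha.2], mul_nonpos_of_nonneg_of_nonpos ha.1.le h⟩
    have hc : ContinuousAt (fun a : ℝ => f (a * (t - s))) 1 := by
      refine ContinuousAt.comp (g := f) (f := fun a : ℝ => a * (t - s)) ?_ (by fun_prop)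
      rw [one_mul]
      exact (hfd _ (hball' _ Set.right_mem_uIcc)).continuousAt
    have h1 : Filter.Tendsto (fun a : ℝ => f (a * (t - s))) (𝓝[<] 1) (𝓝 (f (1 * (t - s)))) :=
      hc.tendsto.mono_left nhdsWithin_le_nhds
    have h2 : (fun a : ℝ => f (a * (t - s))) =ᶠ[𝓝[<] 1] fun _ => 0 := by
      filter_upwards [Ioo_mem_nhdsLT (show (0 : ℝ) < 1 by norm_num)] with a ha
      refine hstrict _ (hmem1 a ha) fun h => ?_
      have := mul_right_cancel₀ hts (h.trans (one_mul _).symm)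
      exact absurd this ha.2.ne
    rw [one_mul] at h1
    exact tendsto_nhds_unique h1 (tendsto_const_nhds.congr' h2.symm)
  have hyO := hO (hball' _ Set.right_mem_uIcc)
  have hf1 : geodesic C (X u) e (t - s) = X (r (geodesic C (X u) e (t - s))) :=
    sub_eq_zero.mp (congrArg Prod.fst hf)
  have hf2 : N u = N (r (geodesic C (X u) e (t - s))) := sub_eq_zero.mp (congrArg Prod.snd hf)
  have hst' : s + (t - s) = t := by ring
  refine ⟨r (geodesic C (X u) e (t - s)), P.mapsTo_retraction hyO, hf1.symm, hf2.symm, ?_, ?_⟩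
  · rw [← hf1, hheight, hst']
  · rw [← hf1, ← hf2, hfield, hst']

end TubularPatch

/-! ### Zeros of the axis direction -/

section

variable {k : ℕ} {C : ℝ} {w : Ambient (k + 2)} {l : ℝ}
  {D : Set (EuclideanSpace ℝ (Fin (k + 1)))}
  {X N : EuclideanSpace ℝ (Fin (k + 1)) → Ambient (k + 2)} {u : EuclideanSpace ℝ (Fin (k + 1))}
  {O : Set (Ambient (k + 2))} {r : Ambient (k + 2) → EuclideanSpace ℝ (Fin (k + 1))}

theorem abs_ip_le {n : ℕ} (x y : Ambient n) : |ip C x y| ≤ ‖ipL n C‖ * ‖x‖ * ‖y‖ := by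
  rw [ip_eq_ipL, ← Real.norm_eq_abs]
  exact (ipL n C).le_opNorm₂ x y

theorem Patch.contDiffOn_axisTangent (P : Patch C w l D X N) :
    ContDiffOn ℝ ∞ (fun u => axisTangent C w l (X u) (N u)) D :=
  (contDiffOn_const.sub ((contDiffOn_const.mul (contDiffOn_const.ip P.smooth)).smul
    P.smooth)).sub (P.smooth_normal.const_smul l)

theorem Patch.contDiffOn_height (P : Patch C w l D X N) :
    ContDiffOn ℝ ∞ (fun u => ip C w (X u)) D :=
  contDiffOn_const.ip P.smooth

theorem Patch.fderiv_height (P : Patch C w l D X N) (hu : u ∈ D)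
    (v : EuclideanSpace ℝ (Fin (k + 1))) :
    fderiv ℝ (fun u => ip C w (X u)) u v = ip C (axisTangent C w l (X u) (N u)) (fderiv ℝ X u v) := by
  rw [P.ip_axis_fderiv hu, fderiv_ip (differentiableAt_const w) (P.differentiableAt hu)]
  simp

/-- Here `⟨w, w⟩ = l²`, so `|E|² = -C h²` and `|dh| ≤ const · |h|` near `u`. Gronwall along segments
issuing from `u` gives `h = 0`, hence `E = 0`. -/
theorem Patch.eventually_axisTangent_eq_zero_of_height (hC : C ≠ 0) (P : Patch C w l D X N)
    (hu : u ∈ D) (h0 : axisTangent C w l (X u) (N u) = 0) (hh : ip C w (X u) = 0) :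
    ∀ᶠ v in 𝓝 u, axisTangent C w l (X v) (N v) = 0 := by
  have hK : ip C w w - l ^ 2 = 0 := by
    have := P.ip_axisTangent_self hC hu
    rw [h0, hh, ip_zero_left] at this
    linarith
  have hDu := P.isOpen.mem_nhds hu
  set F : EuclideanSpace ℝ (Fin (k + 1)) → ℝ :=
    fun v => ‖ipL (k + 2) C‖ * (√((1 + 2 * |C| * ‖X v‖ ^ 2) * |C|)) * ‖fderiv ℝ X v‖
  have hF : ContinuousAt F u := by
    have h1 : ContinuousAt X u := (P.contDiffAt hu).continuousAt
    have h2 : ContinuousAt (fderiv ℝ X) u :=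
      ((P.contDiffAt hu).fderiv_right (m := 0) (by norm_cast)).continuousAt
    fun_prop
  have hFb : ∀ᶠ v in 𝓝 u, F v < F u + 1 := hF.eventually_lt continuousAt_const (by simp)
  obtain ⟨ε, hε, hball⟩ := Metric.eventually_nhds_iff_ball.mp
    ((Filter.eventually_mem_set.mpr hDu).and hFb)
  refine Metric.eventually_nhds_iff_ball.mpr ⟨ε, hε, fun v hv => ?_⟩
  have hvD := (hball v hv).1
  have hzero : ip C w (X v) = 0 := by
    have hseg : ∀ t ∈ Set.uIcc (0 : ℝ) 1, u + t • (v - u) ∈ Metric.ball u ε := by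
      intro t ht
      rw [Set.uIcc_of_le zero_le_one] at ht
      exact (convex_ball u ε).add_smul_sub_mem (Metric.mem_ball_self hε) hv ht
    have := eq_zero_of_norm_deriv_le (f := fun t => ip C w (X (u + t • (v - u))))
      (f' := fun t => fderiv ℝ (fun u => ip C w (X u)) (u + t • (v - u)) (v - u))
      (K := (F u + 1) * ‖v - u‖) (b := 1) ?_ (by simpa using hh) ?_
    · simpa using this
    · intro t ht
      have hd : DifferentiableAt ℝ (fun u => ip C w (X u)) (u + t • (v - u)) :=
        (P.contDiffOn_height.contDiffAt
          (P.isOpen.mem_nhds (hball _ (hseg t ht)).1)).differentiableAt (by simp)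
      have hl : HasDerivAt (fun t : ℝ => u + t • (v - u)) (v - u) t := by
        simpa using ((hasDerivAt_id t).smul_const (v - u)).const_add u
      exact hd.hasFDerivAt.comp_hasDerivAt t hl
    · intro t ht
      obtain ⟨hyD, hyF⟩ := hball _ (hseg t ht)
      set y := u + t • (v - u)
      rw [P.fderiv_height hyD, Real.norm_eq_abs, Real.norm_eq_abs]
      have h1 : ‖axisTangent C w l (X y) (N y)‖ ≤
          √((1 + 2 * |C| * ‖X y‖ ^ 2) * |C|) * |ip C w (X y)| := by
        have h2 := norm_sq_le_of_tangent hC (P.mem y hyD) (P.ip_axisTangent_position hC hyD)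
        rw [P.ip_axisTangent_self hC hyD, hK] at h2
        rw [← Real.sqrt_sq_eq_abs (ip C w (X y)), ← Real.sqrt_mul (by positivity)]
        refine Real.le_sqrt_of_sq_le (h2.trans ?_)
        have h3 : 0 - C * ip C w (X y) ^ 2 ≤ |C| * ip C w (X y) ^ 2 := by
          nlinarith [mul_le_mul_of_nonneg_right (neg_le_abs C) (sq_nonneg (ip C w (X y)))]
        exact (mul_le_mul_of_nonneg_left h3 (by positivity)).trans_eq (by ring)
      calc |ip C (axisTangent C w l (X y) (N y)) (fderiv ℝ X y (v - u))|
          ≤ ‖ipL (k + 2) C‖ * ‖axisTangent C w l (X y) (N y)‖ * ‖fderiv ℝ X y (v - u)‖ :=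
            abs_ip_le _ _
        _ ≤ ‖ipL (k + 2) C‖ * (√((1 + 2 * |C| * ‖X y‖ ^ 2) * |C|) * |ip C w (X y)|) *
            (‖fderiv ℝ X y‖ * ‖v - u‖) := by
            gcongr
            exact (fderiv ℝ X y).le_opNorm _
        _ = F y * (‖v - u‖ * |ip C w (X y)|) := by ring
        _ ≤ (F u + 1) * (‖v - u‖ * |ip C w (X y)|) := by gcongr
        _ = _ := by ring
  refine eq_zero_of_tangent hC (P.mem v hvD) (P.ip_axisTangent_position hC hvD) ?_
  rw [P.ip_axisTangent_self hC hvD, hK, hzero]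
  ring

/-- The derivative of `E` in its own direction satisfies `⟨dE, E⟩ = -C h |E|²`. If `dE` vanishes at
`u`, it is too small nearby to allow this with `C h` bounded away from zero, unless `E = 0`. -/
theorem TubularPatch.eventually_axisTangent_eq_zero (hC : C ≠ 0)
    (P : TubularPatch C w l D X N O r) (hu : u ∈ D) (hh : ip C w (X u) ≠ 0)
    (hd : fderiv ℝ (fun u => axisTangent C w l (X u) (N u)) u = 0) :
    ∀ᶠ v in 𝓝 u, axisTangent C w l (X v) (N v) = 0 := by
  set E : EuclideanSpace ℝ (Fin (k + 1)) → Ambient (k + 2) :=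
    fun u => axisTangent C w l (X u) (N u)
  have hDu := P.isOpen.mem_nhds hu
  set F : EuclideanSpace ℝ (Fin (k + 1)) → ℝ := fun v => ‖ipL (k + 2) C‖ *
    (‖fderiv ℝ E v‖ * ‖fderiv ℝ r (X v)‖) * (1 + 2 * |C| * ‖X v‖ ^ 2)
  have hX : ContinuousAt X u := (P.contDiffAt hu).continuousAt
  have hF : ContinuousAt F u := by
    have h2 : ContinuousAt (fderiv ℝ E) u :=
      ((P.contDiffOn_axisTangent.contDiffAt hDu).fderiv_right (m := 0) (by norm_cast)).continuousAt
    have h3 : ContinuousAt (fderiv ℝ r) (X u) :=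
      ((P.smooth_retraction.contDiffAt
        (P.isOpen_tube.mem_nhds (P.mem_tube u hu))).fderiv_right (m := 0)
          (by norm_cast)).continuousAt
    have h4 : ContinuousAt (fun v => fderiv ℝ r (X v)) u :=
      ContinuousAt.comp (f := X) (g := fderiv ℝ r) h3 hX
    fun_prop
  have hh' : ContinuousAt (fun v => |C * ip C w (X v)|) u :=
    ((P.contDiffOn_height.continuousOn.continuousAt hDu).const_mul C).abs
  have hlt : F u < |C * ip C w (X u)| := by
    have : F u = 0 := by simp only [F, hd]; simp
    rw [this]
    exact abs_pos.mpr (mul_ne_zero hC hh)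
  filter_upwards [hF.eventually_lt hh' hlt, hDu] with v hv hvD
  by_contra hE
  have hpos : 0 < ip C (E v) (E v) := lt_of_le_of_ne
    (ip_self_nonneg_of_tangent hC (P.mem v hvD) (P.ip_axisTangent_position hC hvD))
    fun h => hE (eq_zero_of_tangent hC (P.mem v hvD) (P.ip_axisTangent_position hC hvD) h.symm)
  obtain ⟨τ, hτ⟩ := P.exists_fderiv_eq hC hvD (P.ip_axisTangent_position hC hvD)
    (P.ip_axisTangent_normal hvD)
  -- The derivative of the retraction inverts `dX`, and so gives a bound on `τ` that is uniform near
  -- `u`.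
  have hτn : ‖τ‖ ≤ ‖fderiv ℝ r (X v)‖ * ‖E v‖ := by
    rw [← P.fderiv_retraction hvD τ, hτ]
    exact (fderiv ℝ r (X v)).le_opNorm _
  have hXv := (P.differentiableAt hvD).hasFDerivAt
  have hEv : HasFDerivAt E _ v := ((hasFDerivAt_const w v).sub
    ((((hasFDerivAt_const w v).ip (C := C) hXv).const_mul C).smul hXv)).sub
      ((P.differentiableAt_normal hvD).hasFDerivAt.const_smul l)
  have hkey : ip C (fderiv ℝ E v τ) (E v) = -(C * ip C w (X v)) * ip C (E v) (E v) := by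
    rw [hEv.fderiv]
    simp only [zero_apply, sub_apply, add_apply, smul_apply, ContinuousLinearMap.smulRight_apply,
      hτ, P.fderiv_normal_eq_zero hC hvD hτ, ip_sub_left, ip_add_left, ip_smul_left, smul_zero,
      ip_zero_left, ip_comm (X v), P.ip_axisTangent_position hC hvD, E]
    ring
  have hle : |C * ip C w (X v)| * ip C (E v) (E v) ≤ F v * ip C (E v) (E v) := by
    calc |C * ip C w (X v)| * ip C (E v) (E v) = |ip C (fderiv ℝ E v τ) (E v)| := by
          rw [hkey, abs_mul _ (ip C (E v) (E v)), abs_neg, abs_of_pos hpos]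
      _ ≤ ‖ipL (k + 2) C‖ * ‖fderiv ℝ E v τ‖ * ‖E v‖ := abs_ip_le _ _
      _ ≤ ‖ipL (k + 2) C‖ * (‖fderiv ℝ E v‖ * (‖fderiv ℝ r (X v)‖ * ‖E v‖)) * ‖E v‖ := by
          gcongr
          refine ((fderiv ℝ E v).le_opNorm _).trans ?_
          gcongr
      _ = ‖ipL (k + 2) C‖ * (‖fderiv ℝ E v‖ * ‖fderiv ℝ r (X v)‖) * ‖E v‖ ^ 2 := by ring
      _ ≤ ‖ipL (k + 2) C‖ * (‖fderiv ℝ E v‖ * ‖fderiv ℝ r (X v)‖) *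
          ((1 + 2 * |C| * ‖X v‖ ^ 2) * ip C (E v) (E v)) := by
          gcongr
          exact norm_sq_le_of_tangent hC (P.mem v hvD) (P.ip_axisTangent_position hC hvD)
      _ = _ := by simp only [F]; ring
  exact absurd (le_of_mul_le_mul_right hle hpos) (not_le.mpr hv)

/-- The interior of the set of points where the axis is normal is closed. -/
theorem Patch.eventually_axisTangent_eq_zero (hC : C ≠ 0) (P : Patch C w l D X N) (hu : u ∈ D)
    (h : u ∈ closure {v | ∀ᶠ v' in 𝓝 v, axisTangent C w l (X v') (N v') = 0}) :
    ∀ᶠ v in 𝓝 u, axisTangent C w l (X v) (N v) = 0 := by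
  obtain ⟨D', hD', huD', O, r, P'⟩ := P.exists_tubularPatch hC hu
  set E : EuclideanSpace ℝ (Fin (k + 1)) → Ambient (k + 2) :=
    fun u => axisTangent C w l (X u) (N u)
  have hDu := P.isOpen.mem_nhds hu
  have hE : ContinuousAt E u := P.contDiffOn_axisTangent.continuousOn.continuousAt hDu
  have hE' : ContinuousAt (fderiv ℝ E) u :=
    ((P.contDiffOn_axisTangent.contDiffAt hDu).fderiv_right (m := 0) (by norm_cast)).continuousAt
  have hfreq := mem_closure_iff_frequently.mp h
  -- `E` and `dE` vanish on the open zero set, hence by continuity also on its closure.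
  have h0 : E u = 0 := by
    by_contra hne
    obtain ⟨v, hv, hv'⟩ := (hfreq.and_eventually (hE.eventually_ne hne)).exists
    exact hv' hv.self_of_nhds
  have h1 : fderiv ℝ E u = 0 := by
    by_contra hne
    obtain ⟨v, hv, hv'⟩ := (hfreq.and_eventually (hE'.eventually_ne hne)).exists
    refine hv' ?_
    have : E =ᶠ[𝓝 v] fun _ => 0 := hv
    rw [this.fderiv_eq]
    simp
  by_cases hh : ip C w (X u) = 0
  · exact P.eventually_axisTangent_eq_zero_of_height hC hu h0 hh
  · exact P'.eventually_axisTangent_eq_zero hC huD' hh h1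

end

/-! ### Level sets of the height as framed hypersurfaces of umbilical sections -/

section

variable {k : ℕ} {C : ℝ} {w : Ambient (k + 2)} {l : ℝ}
  {D : Set (EuclideanSpace ℝ (Fin (k + 1)))}
  {X N : EuclideanSpace ℝ (Fin (k + 1)) → Ambient (k + 2)} {u : EuclideanSpace ℝ (Fin (k + 1))}
  {O : Set (Ambient (k + 2))} {r : Ambient (k + 2) → EuclideanSpace ℝ (Fin (k + 1))}

/-- A regular point of a function has coordinates one of which is the function, the others being
linear. -/
theorem exists_chart_of_regular {h : EuclideanSpace ℝ (Fin (k + 1)) → ℝ}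
    {U : Set (EuclideanSpace ℝ (Fin (k + 1)))} (hU : IsOpen U) (hh : ContDiffOn ℝ ∞ h U)
    (hu : u ∈ U) (hd : fderiv ℝ h u ≠ 0) :
    ∃ (e : OpenPartialHomeomorph (EuclideanSpace ℝ (Fin (k + 1))) (EuclideanSpace ℝ (Fin k) × ℝ))
      (A : EuclideanSpace ℝ (Fin (k + 1)) →L[ℝ] EuclideanSpace ℝ (Fin k)),
      u ∈ e.source ∧ e.source ⊆ U ∧ (∀ v, e v = (A v, h v)) ∧ ContDiffOn ℝ ∞ e.symm e.target := by
  set dh : EuclideanSpace ℝ (Fin (k + 1)) →ₗ[ℝ] ℝ := (fderiv ℝ h u).toLinearMap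
  have hdh : dh ≠ 0 := fun h0 => hd (by ext1 v; exact congrArg (fun T => T v) h0)
  have hker : Module.finrank ℝ (LinearMap.ker dh) = k := by
    have h1 := LinearMap.finrank_range_add_finrank_ker dh
    rw [LinearMap.range_eq_top.mpr (LinearMap.surjective hdh)] at h1
    simp at h1
    omega
  obtain ⟨g, hg⟩ := (LinearMap.ker dh).subtype.exists_leftInverse_of_injective
    (LinearMap.ker_eq_bot.mpr Subtype.val_injective)
  let φ : LinearMap.ker dh ≃ₗ[ℝ] EuclideanSpace ℝ (Fin k) :=
    LinearEquiv.ofFinrankEq _ _ (by rw [hker]; simp)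
  let A : EuclideanSpace ℝ (Fin (k + 1)) →L[ℝ] EuclideanSpace ℝ (Fin k) :=
    LinearMap.toContinuousLinearMap (φ.toLinearMap.comp g)
  have hinj : Function.Injective (A.toLinearMap.prod dh) := by
    refine (injective_iff_map_eq_zero _).mpr fun v hv => ?_
    have hv' : (A v, dh v) = (0, 0) := hv
    rw [Prod.mk.injEq] at hv'
    have h1 : g v = ⟨v, hv'.2⟩ := congrArg (fun T => T ⟨v, hv'.2⟩) hg
    have h2 : φ (g v) = 0 := hv'.1
    rw [h1, LinearEquiv.map_eq_zero_iff] at h2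
    exact congrArg Subtype.val h2
  let Φ : EuclideanSpace ℝ (Fin (k + 1)) ≃L[ℝ] EuclideanSpace ℝ (Fin k) × ℝ :=
    (LinearEquiv.ofInjectiveOfFinrankEq _ hinj (by simp)).toContinuousLinearEquiv
  have hf : HasFDerivAt (fun v => (A v, h v)) (Φ : EuclideanSpace ℝ (Fin (k + 1)) →L[ℝ] _) u := by
    have := (A.hasFDerivAt (x := u)).prodMk
      ((hh.contDiffAt (hU.mem_nhds hu)).differentiableAt (by simp)).hasFDerivAt
    exact this
  obtain ⟨e, he, hes, hef, hsymm⟩ :=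
    exists_openPartialHomeomorph hU (A.contDiff.contDiffOn.prodMk hh) hu hf
  exact ⟨e, A, he, hes, fun v => by rw [hef], hsymm⟩

/-- In coordinates that include the height, the level set is a slice. The retraction provides the
continuous inverse, and differentiating the left inverse `A ∘ r` yields the immersion property. -/
theorem TubularPatch.isEmbeddedSubmanifold_level (P : TubularPatch C w l D X N O r)
    {U : Set (EuclideanSpace ℝ (Fin (k + 1)))} (hU : IsOpen U) (hUD : U ⊆ D) {c : ℝ}
    (hreg : ∀ u ∈ U, ip C w (X u) = c → fderiv ℝ (fun u => ip C w (X u)) u ≠ 0) :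
    IsEmbeddedSubmanifold k (X '' {u | u ∈ U ∧ ip C w (X u) = c}) := by
  rintro _ ⟨u, ⟨hu, huc⟩, rfl⟩
  obtain ⟨e, A, heu, heU, hef, hsymm⟩ := exists_chart_of_regular (k := k) hU
    (P.contDiffOn_height.mono hUD) hu (hreg u hu huc)
  set j : EuclideanSpace ℝ (Fin k) → EuclideanSpace ℝ (Fin k) × ℝ := fun b => (b, c)
  have hj : ContDiff ℝ ∞ j := contDiff_id.prodMk contDiff_const
  have hDo : IsOpen (j ⁻¹' e.target) := e.open_target.preimage hj.continuous
  have hsrc : ∀ b ∈ j ⁻¹' e.target, e.symm (j b) ∈ e.source := fun b hb => e.map_target hb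
  have hval : ∀ b ∈ j ⁻¹' e.target, A (e.symm (j b)) = b ∧ ip C w (X (e.symm (j b))) = c := by
    intro b hb
    have := e.right_inv hb
    rw [hef] at this
    exact Prod.mk.inj this
  have hy : ContDiffOn ℝ ∞ (fun b => X (e.symm (j b))) (j ⁻¹' e.target) :=
    P.smooth.comp (hsymm.comp hj.contDiffOn fun b hb => hb) fun b hb => hUD (heU (hsrc b hb))
  have hret : ∀ b ∈ j ⁻¹' e.target, A (r (X (e.symm (j b)))) = b := fun b hb => by
    rw [P.retraction _ (hUD (heU (hsrc b hb))), (hval b hb).1]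
  refine ⟨O ∩ r ⁻¹' e.source, j ⁻¹' e.target, fun b => X (e.symm (j b)), fun y => A (r y),
    P.smooth_retraction.continuousOn.isOpen_inter_preimage P.isOpen_tube e.open_source,
    ⟨P.mem_tube u (hUD hu), ?_⟩, hDo, hy, fun b hb => ?_, ?_, ?_, hret⟩
  · rwa [Set.mem_preimage, P.retraction u (hUD hu)]
  · have hO : X (e.symm (j b)) ∈ O := P.mem_tube _ (hUD (heU (hsrc b hb)))
    have hg : DifferentiableAt ℝ (fun y => A (r y)) (X (e.symm (j b))) :=
      A.differentiableAt.comp _ ((P.smooth_retraction.contDiffAt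
        (P.isOpen_tube.mem_nhds hO)).differentiableAt (by simp))
    have hyb : DifferentiableAt ℝ (fun b => X (e.symm (j b))) b :=
      (hy.contDiffAt (hDo.mem_nhds hb)).differentiableAt (by simp)
    have h1 : (fun y => A (r y)) ∘ (fun b => X (e.symm (j b))) =ᶠ[𝓝 b] id :=
      Filter.eventuallyEq_of_mem (hDo.mem_nhds hb) hret
    have h2 := h1.fderiv_eq (𝕜 := ℝ)
    rw [fderiv_comp b hg hyb, fderiv_id] at h2
    refine Function.LeftInverse.injective (g := fderiv ℝ (fun y => A (r y)) (X (e.symm (j b)))) ?_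
    intro v
    exact congrArg (fun T : EuclideanSpace ℝ (Fin k) →L[ℝ] EuclideanSpace ℝ (Fin k) => T v) h2
  · ext y
    constructor
    · rintro ⟨b, hb, rfl⟩
      have hD := hUD (heU (hsrc b hb))
      refine ⟨⟨_, ⟨heU (hsrc b hb), (hval b hb).2⟩, rfl⟩, P.mem_tube _ hD, ?_⟩
      rw [Set.mem_preimage, P.retraction _ hD]
      exact hsrc b hb
    · rintro ⟨⟨v, ⟨hv, hvc⟩, rfl⟩, -, hvs⟩
      rw [Set.mem_preimage, P.retraction v (hUD hv)] at hvs
      have hev : e v = j (A v) := by rw [hef, hvc]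
      refine ⟨A v, ?_, ?_⟩
      · rw [Set.mem_preimage, ← hev]
        exact e.map_source hvs
      · change X (e.symm (j (A v))) = X v
        rw [← hev, e.left_inv hvs]
  · refine A.continuous.comp_continuousOn (P.smooth_retraction.continuousOn.mono ?_)
    exact fun y hy => hy.2.1

/-- A curve `γ` in the level set satisfies `γ = X ∘ r ∘ γ`, so its velocity lies in the image of
`dX`; constancy of the height along `γ` gives the second equation. -/
theorem TubularPatch.ip_of_isTangentTo (P : TubularPatch C w l D X N O r)
    {U : Set (EuclideanSpace ℝ (Fin (k + 1)))} (hUD : U ⊆ D) {c : ℝ} (hu : u ∈ D)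
    {v : Ambient (k + 2)}
    (hv : IsTangentTo (X '' {u | u ∈ U ∧ ip C w (X u) = c}) (X u) v) :
    ip C (N u) v = 0 ∧ ip C (axisTangent C w l (X u) (N u)) v = 0 := by
  obtain ⟨γ, hγ0, hγ, hγm⟩ := hv
  have hr : DifferentiableAt ℝ r (γ 0) := by
    rw [hγ0]
    exact (P.smooth_retraction.contDiffAt
      (P.isOpen_tube.mem_nhds (P.mem_tube u hu))).differentiableAt (by simp)
  have hX : DifferentiableAt ℝ X (r (γ 0)) := by
    rw [hγ0, P.retraction u hu]; exact P.differentiableAt hu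
  have h1 : HasDerivAt (fun t => X (r (γ t))) (fderiv ℝ X (r (γ 0)) (fderiv ℝ r (γ 0) v)) 0 :=
    hX.hasFDerivAt.comp_hasDerivAt 0 (hr.hasFDerivAt.comp_hasDerivAt 0 hγ)
  have h2 : (fun t => X (r (γ t))) =ᶠ[𝓝 0] γ := by
    filter_upwards [hγm] with t ht
    obtain ⟨u', hu', hut⟩ := ht
    rw [← hut, P.retraction u' (hUD hu'.1)]
  have h3 := (h1.congr_of_eventuallyEq h2.symm).unique hγ
  rw [hγ0, P.retraction u hu] at h3
  have h4 : HasDerivAt (fun t => ip C w (γ t)) (ip C w v) 0 := by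
    simpa using (hasDerivAt_const (0 : ℝ) w).ip (C := C) hγ
  have h5 : (fun t => ip C w (γ t)) =ᶠ[𝓝 0] fun _ => c := by
    filter_upwards [hγm] with t ht
    obtain ⟨u', hu', hut⟩ := ht
    rw [← hut, hu'.2]
  have h6 := (h4.congr_of_eventuallyEq h5.symm).unique (hasDerivAt_const (0 : ℝ) c)
  constructor
  · rw [← h3, P.normal u hu]
  · rw [← h3, P.ip_axis_fderiv hu, h3, h6]

/-- The quantity in `h` is the square of the tangential part of `w` at any point of height `c`. -/
theorem isUmbilicalSection_of_pos {n : ℕ} {w : Ambient n} {c : ℝ} (h : 0 < ip C w w - C * c ^ 2)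
    (hC : C ≠ 0) : IsUmbilicalSection C w c := by
  intro p hp h0
  have h1 : ip C (tanProj C p w) (tanProj C p w) = ip C w w - C * c ^ 2 := by
    simp only [tanProj, ip_sub_left, ip_sub_right, ip_smul_left, ip_smul_right,
      ip_self_of_mem hp.1, ip_comm p w, hp.2]
    field_simp
    ring
  rw [h0, ip_zero_left] at h1
  linarith

/-- A level set of the height is a hypersurface of a totally umbilical hypersurface, and the axis
direction makes a constant angle with the normal fields of both. -/
theorem TubularPatch.exists_framed_level (hC : C ≠ 0) (P : TubularPatch C w l D X N O r)
    {U : Set (EuclideanSpace ℝ (Fin (k + 1)))} (hU : IsOpen U) (hUD : U ⊆ D) {c ρ : ℝ}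
    (hρ : 0 < ρ) (hρ2 : ρ ^ 2 + C * c ^ 2 = ip C w w - l ^ 2) :
    IsUmbilicalSection C w c ∧ ∃ (η₁ η₂ : Ambient (k + 2) → Ambient (k + 2)) (a : ℝ),
      IsFramedHypersurface C w c (X '' {u | u ∈ U ∧ ip C w (X u) = c}) η₁ η₂ ∧
      ∀ u ∈ U, ip C w (X u) = c →
        fieldW η₁ η₂ a (X u) = ρ⁻¹ • axisTangent C w l (X u) (N u) := by
  refine ⟨isUmbilicalSection_of_pos (by nlinarith [sq_nonneg l, pow_pos hρ 2]) hC, ?_⟩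
  -- On the level set `|E| = ρ` and `w - C c p = E + l N`, a normal of the section of length `m`. In
  -- the plane of `E` and `N` the unit vector orthogonal to it is `(l E - ρ² N) / (ρ m)`. Solving
  -- for `E / ρ` gives the coefficients `l / m` and `ρ / m`, constant on the level set.
  set m := √(ρ ^ 2 + l ^ 2)
  have hm2 : m ^ 2 = ρ ^ 2 + l ^ 2 := Real.sq_sqrt (by positivity)
  have hm : 0 < m := Real.sqrt_pos.mpr (by positivity)
  set E : Ambient (k + 2) → Ambient (k + 2) := fun y => axisTangent C w l (X (r y)) (N (r y))
  set η₁ : Ambient (k + 2) → Ambient (k + 2) :=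
    fun y => (ρ * m)⁻¹ • (l • E y - ρ ^ 2 • N (r y))
  set η₂ : Ambient (k + 2) → Ambient (k + 2) := fun y => m⁻¹ • (w - (C * c) • y)
  obtain ⟨a, ha1, ha2⟩ : ∃ a, Real.cos a = l / m ∧ Real.sin a = ρ / m := by
    set ζ : ℂ := ⟨l / m, ρ / m⟩
    have hζ : ‖ζ‖ = 1 := by
      rw [Complex.norm_def, Complex.normSq_mk, Real.sqrt_eq_one]
      field_simp
      linarith
    have hζ0 : ζ ≠ 0 := by
      intro h
      rw [h, norm_zero] at hζ
      exact zero_ne_one hζ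
    refine ⟨ζ.arg, ?_, ?_⟩
    · rw [Complex.cos_arg hζ0, hζ, div_one]
    · rw [Complex.sin_arg, hζ, div_one]
  have hEE : ∀ u ∈ D, ip C w (X u) = c →
      ip C (axisTangent C w l (X u) (N u)) (axisTangent C w l (X u) (N u)) = ρ ^ 2 := by
    intro u hu huc
    rw [P.ip_axisTangent_self hC hu, huc]
    linarith
  have hE₁ : ∀ u ∈ D, η₁ (X u) =
      (ρ * m)⁻¹ • (l • axisTangent C w l (X u) (N u) - ρ ^ 2 • N u) := by
    intro u hu
    simp only [η₁, E, P.retraction u hu]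
  have hE₂ : ∀ u, ip C w (X u) = c →
      η₂ (X u) = m⁻¹ • (axisTangent C w l (X u) (N u) + l • N u) := by
    intro u huc
    simp only [η₂, axisTangent, huc]
    module
  refine ⟨η₁, η₂, a, ?_, ?_⟩
  · refine
      { subset := ?_
        submanifold := P.isEmbeddedSubmanifold_level hU hUD fun u hu huc h0 => ?_
        smooth₁ := ?_
        smooth₂ := ?_
        tangent₁ := ?_
        normal₁ := ?_
        unit₁ := ?_
        tangent₂ := ?_
        normal₂ := ?_
        unit₂ := ?_ }
    · rintro _ ⟨u, ⟨hu, huc⟩, rfl⟩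
      exact ⟨P.mem u (hUD hu), huc⟩
    · obtain ⟨τ, hτ⟩ := P.exists_fderiv_eq hC (hUD hu) (P.ip_axisTangent_position hC (hUD hu))
        (P.ip_axisTangent_normal (hUD hu))
      have h1 := P.fderiv_height (hUD hu) τ
      rw [h0, hτ, hEE u (hUD hu) huc, zero_apply] at h1
      exact (pow_pos hρ 2).ne h1
    · refine ContDiffOn.const_smul _ ((P.contDiffOn_axisTangent_comp.const_smul l).sub
        (P.contDiffOn_normal_comp.const_smul (ρ ^ 2))) |>.mono ?_
      rintro _ ⟨u, ⟨hu, -⟩, rfl⟩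
      exact P.mem_tube u (hUD hu)
    · exact ((contDiff_const.sub (contDiff_id.const_smul (C * c))).const_smul m⁻¹).contDiffOn
    · rintro _ ⟨u, ⟨hu, huc⟩, rfl⟩
      have hu := hUD hu
      rw [hE₁ u hu]
      constructor
      · simp only [ip_smul_left, ip_sub_left, P.ip_axisTangent_position hC hu,
          P.normal_position u hu]
        ring
      · have h1 := P.ip_axis_axisTangent hu
        rw [← P.ip_axisTangent_self hC hu, hEE u hu huc, ip_comm] at h1
        simp only [ip_smul_left, ip_sub_left, h1, P.axis u hu]
        ring
    · rintro _ ⟨u, ⟨hu, huc⟩, rfl⟩ v hv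
      obtain ⟨h1, h2⟩ := P.ip_of_isTangentTo hUD (hUD hu) hv
      rw [hE₁ u (hUD hu)]
      simp only [ip_smul_left, ip_sub_left, h1, h2]
      ring
    · rintro _ ⟨u, ⟨hu, huc⟩, rfl⟩
      have hu := hUD hu
      have h0 := P.ip_axisTangent_normal (l := l) (w := w) hu
      rw [hE₁ u hu]
      simp only [ip_smul_left, ip_sub_left, ip_smul_right, ip_sub_right, hEE u hu huc, P.unit u hu,
        h0, ip_comm (N u) (axisTangent C w l (X u) (N u))]
      field_simp
      linear_combination -hm2
    · rintro _ ⟨u, ⟨hu, huc⟩, rfl⟩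
      have hu := hUD hu
      rw [hE₂ u huc]
      simp only [ip_smul_left, ip_add_left, P.ip_axisTangent_position hC hu,
          P.normal_position u hu]
      ring
    · rintro _ ⟨u, ⟨hu, huc⟩, rfl⟩ v hv
      rw [ip_comm]
      simp only [η₂, ip_smul_right, ip_sub_right, hv.1, hv.2]
      ring
    · rintro _ ⟨u, ⟨hu, huc⟩, rfl⟩
      have hu := hUD hu
      have h0 := P.ip_axisTangent_normal (l := l) (w := w) hu
      rw [hE₂ u huc]
      simp only [ip_smul_left, ip_add_left, ip_smul_right, ip_add_right, hEE u hu huc, P.unit u hu,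
        h0, ip_comm (N u) (axisTangent C w l (X u) (N u))]
      field_simp
      linear_combination -hm2
  · intro u hu huc
    rw [fieldW, hE₁ u (hUD hu), hE₂ u huc, ha1, ha2]
    have h1 : (ρ⁻¹ : ℝ) = l / m * ((ρ * m)⁻¹ * l) + ρ / m * m⁻¹ := by
      field_simp
      linear_combination hm2
    have h2 : (0 : ℝ) = -(l / m * ((ρ * m)⁻¹ * ρ ^ 2)) + ρ / m * (m⁻¹ * l) := by
      field_simp
      ring
    rw [h1]
    have h3 : (0 : ℝ) • N u = (-(l / m * ((ρ * m)⁻¹ * ρ ^ 2)) + ρ / m * (m⁻¹ * l)) • N u := by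
      rw [← h2]
    rw [zero_smul] at h3
    rw [← add_zero ((l / m * ((ρ * m)⁻¹ * l) + ρ / m * m⁻¹) • axisTangent C w l (X u) (N u)), h3]
    module

end

/-! ### Parametrization near points where the axis is not normal -/

section

variable {k : ℕ} {C : ℝ} {w : Ambient (k + 2)} {l : ℝ}
  {D : Set (EuclideanSpace ℝ (Fin (k + 1)))}
  {X N : EuclideanSpace ℝ (Fin (k + 1)) → Ambient (k + 2)} {u : EuclideanSpace ℝ (Fin (k + 1))}
  {O : Set (Ambient (k + 2))} {r : Ambient (k + 2) → EuclideanSpace ℝ (Fin (k + 1))}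
  {c ρ s : ℝ}

theorem Patch.ip_axisTangent_of_height (hC : C ≠ 0) (P : Patch C w l D X N) (hu : u ∈ D)
    (hρ2 : ρ ^ 2 + C * c ^ 2 = ip C w w - l ^ 2) (hs : ip C w (X u) = leafHeight C c ρ s) :
    ip C (axisTangent C w l (X u) (N u)) (axisTangent C w l (X u) (N u))
      = leafSlope C c ρ s ^ 2 := by
  rw [P.ip_axisTangent_self hC hu, hs, leafSlope_sq hC, hρ2]

theorem Patch.ip_direction_self (hC : C ≠ 0) (P : Patch C w l D X N) (hu : u ∈ D)
    (hρ2 : ρ ^ 2 + C * c ^ 2 = ip C w w - l ^ 2) (hs : ip C w (X u) = leafHeight C c ρ s)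
    (h0 : 0 < leafSlope C c ρ s) :
    ip C ((leafSlope C c ρ s)⁻¹ • axisTangent C w l (X u) (N u))
      ((leafSlope C c ρ s)⁻¹ • axisTangent C w l (X u) (N u)) = 1 := by
  rw [ip_smul_left, ip_smul_right, P.ip_axisTangent_of_height hC hu hρ2 hs]
  field_simp

theorem Patch.ip_direction_position (hC : C ≠ 0) (P : Patch C w l D X N) (hu : u ∈ D) (a : ℝ) :
    ip C (a • axisTangent C w l (X u) (N u)) (X u) = 0 := by
  rw [ip_smul_left, P.ip_axisTangent_position hC hu, mul_zero]

/-- Near a point at which the axis is not normal to it, the hypersurface is parametrized by the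
geodesics normal to a level set of the height. -/
theorem TubularPatch.exists_parametrization (hC : C ≠ 0) (P : TubularPatch C w l D X N O r)
    {u₀ : EuclideanSpace ℝ (Fin (k + 1))} (hu₀ : u₀ ∈ D)
    (hE₀ : axisTangent C w l (X u₀) (N u₀) ≠ 0) :
    ∃ (c : ℝ) (S : Set (Ambient (k + 2))) (η₁ η₂ : Ambient (k + 2) → Ambient (k + 2)) (a : ℝ)
      (I₀ : Set ℝ) (U : Set (EuclideanSpace ℝ (Fin (k + 1))))
      (π : EuclideanSpace ℝ (Fin (k + 1)) → Ambient (k + 2))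
      (ζ : EuclideanSpace ℝ (Fin (k + 1)) → ℝ),
      IsUmbilicalSection C w c ∧ IsFramedHypersurface C w c S η₁ η₂ ∧ I₀.OrdConnected ∧
      I₀ ∈ 𝓝 (0 : ℝ) ∧ IsOpen U ∧ u₀ ∈ U ∧ U ⊆ D ∧ ContDiffOn ℝ ∞ π U ∧ ContDiffOn ℝ ∞ ζ U ∧
      π u₀ = X u₀ ∧ ζ u₀ = 0 ∧ Set.BijOn (fun u => (π u, ζ u)) U (S ×ˢ I₀) ∧
      ∀ u ∈ U, X u = ruledMap C η₁ η₂ a (π u, ζ u) := by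
  set c := ip C w (X u₀)
  have hpos : 0 < ip C w w - l ^ 2 - C * c ^ 2 := by
    rw [← P.ip_axisTangent_self hC hu₀]
    exact lt_of_le_of_ne
      (ip_self_nonneg_of_tangent hC (P.mem u₀ hu₀) (P.ip_axisTangent_position hC hu₀))
      fun h => hE₀ (eq_zero_of_tangent hC (P.mem u₀ hu₀) (P.ip_axisTangent_position hC hu₀) h.symm)
  set ρ := √(ip C w w - l ^ 2 - C * c ^ 2)
  have hρ : 0 < ρ := Real.sqrt_pos.mpr hpos
  have hρ2 : ρ ^ 2 + C * c ^ 2 = ip C w w - l ^ 2 := by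
    rw [Real.sq_sqrt hpos.le]; ring
  obtain ⟨δ, hδ, hO, hleaf⟩ := P.exists_ball hC hu₀
  obtain ⟨t₀, ht₀, hsmall⟩ := exists_dist_geodesic_lt (n := k + 2) hC (‖X u₀‖ + δ)
    (show 0 < δ / 4 by linarith)
  have hHd : HasFDerivAt (leafHeight C c ρ)
      (ContinuousLinearEquiv.unitsEquivAut ℝ (Units.mk0 ρ hρ.ne') : ℝ →L[ℝ] ℝ) 0 := by
    refine HasDerivAt.hasFDerivAt_equiv ?_ hρ.ne'
    simpa using hasDerivAt_leafHeight (c := c) (ρ := ρ) hC 0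
  obtain ⟨e, he0, -, hef, hsymm⟩ := exists_openPartialHomeomorph isOpen_univ
    (contDiff_leafHeight (C := C) (c := c) (ρ := ρ)).contDiffOn (Set.mem_univ 0) hHd
  have hev : ∀ᶠ z in 𝓝 (0 : ℝ), z ∈ e.source ∧ 0 < leafSlope C c ρ z :=
    (Filter.eventually_mem_set.mpr (e.open_source.mem_nhds he0)).and
      (continuousAt_const.eventually_lt
        (contDiff_leafSlope (m := 0)).continuous.continuousAt (by simpa using hρ))
  obtain ⟨ε, hε, hball⟩ := Metric.eventually_nhds_iff_ball.mp hev
  -- `s₀ ≤ ε` makes the height an invertible parameter with positive slope on `I`. The bound `2 * s₀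
  -- ≤ t₀` controls the motion between any two parameters of `I`.
  obtain ⟨s₀, hs₀, hs₀ε, hs₀t⟩ : ∃ s₀ > 0, s₀ ≤ ε ∧ 2 * s₀ ≤ t₀ :=
    ⟨min ε (t₀ / 2), lt_min hε (by linarith), min_le_left _ _, by
      linarith [min_le_right ε (t₀ / 2)]⟩
  set I : Set ℝ := Set.Ioo (-s₀) s₀
  have h0I : (0 : ℝ) ∈ I := ⟨by linarith, hs₀⟩
  have hI : ∀ z ∈ I, z ∈ e.source ∧ 0 < leafSlope C c ρ z := fun z hz => hball z (by
    rw [Metric.mem_ball, Real.dist_eq, sub_zero, abs_lt]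
    exact ⟨by linarith [hz.1], by linarith [hz.2]⟩)
  have hIs : I ⊆ e.source := fun z hz => (hI z hz).1
  set J := e '' I
  have hJ : IsOpen J := e.isOpen_image_of_subset_source isOpen_Ioo hIs
  have hJt : J ⊆ e.target := by
    rintro _ ⟨z, hz, rfl⟩
    exact e.map_source (hIs hz)
  have hHJ : ∀ z ∈ I, leafHeight C c ρ z ∈ J := fun z hz => ⟨z, hz, by rw [hef]⟩
  set ζ : EuclideanSpace ℝ (Fin (k + 1)) → ℝ := fun u => e.symm (ip C w (X u))
  have hζ : ∀ u z, z ∈ I → ip C w (X u) = leafHeight C c ρ z → ζ u = z := by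
    intro u z hz h
    simp only [ζ, h]
    rw [← hef, e.left_inv (hIs hz)]
  have hζJ : ∀ u, ip C w (X u) ∈ J → ζ u ∈ I ∧ ip C w (X u) = leafHeight C c ρ (ζ u) := by
    rintro u ⟨z, hz, hzu⟩
    rw [hef] at hzu
    rw [hζ u z hz hzu.symm]
    exact ⟨hz, hzu.symm⟩
  -- The height determines the leaf parameter `ζ`; following the leaf back for time `ζ` leads to the
  -- level set through `u₀`.
  set π : EuclideanSpace ℝ (Fin (k + 1)) → Ambient (k + 2) := fun u =>
    geodesic C (X u) ((leafSlope C c ρ (ζ u))⁻¹ • axisTangent C w l (X u) (N u)) (-ζ u)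
  set U₀ : Set (EuclideanSpace ℝ (Fin (k + 1))) :=
    (D ∩ X ⁻¹' Metric.ball (X u₀) (δ / 2)) ∩ (fun u => ip C w (X u)) ⁻¹' J
  have hU₀D : U₀ ⊆ D := fun u hu => hu.1.1
  have hU₀ : IsOpen U₀ := (P.contDiffOn_height.continuousOn.mono Set.inter_subset_left).isOpen_inter_preimage
    (P.smooth.continuousOn.isOpen_inter_preimage P.isOpen Metric.isOpen_ball) hJ
  have hζs : ContDiffOn ℝ ∞ ζ U₀ :=
    hsymm.comp (P.contDiffOn_height.mono hU₀D) fun u hu => hJt hu.2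
  have hπs : ContDiffOn ℝ ∞ π U₀ := by
    have h1 : ContDiffOn ℝ ∞ (fun u => leafSlope C c ρ (ζ u)) U₀ :=
      contDiff_leafSlope.comp_contDiffOn hζs
    refine ((contDiff_cs.comp_contDiffOn hζs.neg).smul (P.smooth.mono hU₀D)).add
      ((contDiff_sn.comp_contDiffOn hζs.neg).smul ((h1.inv fun u hu => ?_).smul
        (P.contDiffOn_axisTangent.mono hU₀D)))
    exact (hI _ (hζJ u hu.2).1).2.ne'
  -- Restricting `π`, which is constant along leaves, makes `U` contain the whole leaf over `I`
  -- through each of its points. The radii fit: a base point within `δ / 4` and a drift below `δ /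
  -- 4` give a point within `δ / 2`, and from there geodesics stay within `δ`.
  set U : Set (EuclideanSpace ℝ (Fin (k + 1))) := U₀ ∩ π ⁻¹' Metric.ball (X u₀) (δ / 4)
  have hU : IsOpen U := hπs.continuousOn.isOpen_inter_preimage hU₀ Metric.isOpen_ball
  have hUU₀ : U ⊆ U₀ := Set.inter_subset_left
  have hUD : U ⊆ D := hUU₀.trans hU₀D
  have hπc : ∀ u ∈ D, ip C w (X u) = c → ζ u = 0 ∧ π u = X u := by
    intro u hu huc
    have h1 : ζ u = 0 := hζ u 0 h0I (by simpa using huc)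
    refine ⟨h1, ?_⟩
    simp only [π, h1, neg_zero, geodesic_zero]
  have hclose : ∀ u ∈ U₀, ∀ z, |z| < t₀ → dist (geodesic C (X u)
      ((leafSlope C c ρ (ζ u))⁻¹ • axisTangent C w l (X u) (N u)) z) (X u) < δ / 4 := by
    intro u hu z hz
    obtain ⟨h1, h2⟩ := hζJ u hu.2
    refine hsmall _ (P.mem u hu.1.1) ?_ _ (P.ip_direction_position hC hu.1.1 _)
      (P.ip_direction_self hC hu.1.1 hρ2 h2 (hI _ h1).2) z hz
    have h3 : dist (X u) (X u₀) < δ / 2 := hu.1.2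
    rw [dist_eq_norm] at h3
    linarith [norm_le_norm_add_norm_sub' (X u) (X u₀)]
  have hmove : ∀ u ∈ U₀, ∀ t ∈ I, ∃ u' ∈ D, X u' = geodesic C (X u)
      ((leafSlope C c ρ (ζ u))⁻¹ • axisTangent C w l (X u) (N u)) (t - ζ u) ∧
      ip C w (X u') = leafHeight C c ρ t ∧ axisTangent C w l (X u') (N u') = leafSlope C c ρ t •
        velocity C (X u) ((leafSlope C c ρ (ζ u))⁻¹ • axisTangent C w l (X u) (N u)) (t - ζ u) := by
    intro u hu t ht
    obtain ⟨h1, h2⟩ := hζJ u hu.2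
    have hpos := (hI _ h1).2
    have hsub : Set.uIcc (ζ u) t ⊆ I := Set.OrdConnected.uIcc_subset Set.ordConnected_Ioo h1 ht
    have hb : ∀ z ∈ Set.uIcc (ζ u) t, geodesic C (X u)
        ((leafSlope C c ρ (ζ u))⁻¹ • axisTangent C w l (X u) (N u)) (z - ζ u)
        ∈ Metric.ball (X u₀) δ := by
      intro z hz
      have hz := hsub hz
      have h3 := hclose u hu (z - ζ u) (by
        rw [abs_lt]
        exact ⟨by linarith [hz.1, h1.2], by linarith [hz.2, h1.1]⟩)
      have h4 : dist (X u) (X u₀) < δ / 2 := hu.1.2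
      rw [Metric.mem_ball]
      exact (dist_triangle _ (X u) _).trans_lt (by linarith)
    obtain ⟨u', hu', hX', -, hh', hE'⟩ := hleaf u hu.1.1
      ((leafSlope C c ρ (ζ u))⁻¹ • axisTangent C w l (X u) (N u)) c ρ (ζ u) t h2
      (by rw [smul_inv_smul₀ hpos.ne']) (P.ip_direction_self hC hu.1.1 hρ2 h2 hpos)
      (fun z hz _ => (hI z (hsub hz)).2) hb
    exact ⟨u', hu', hX', hh', hE'⟩
  have hback : ∀ u ∈ U, ∃ u' ∈ U, ip C w (X u') = c ∧ X u' = π u ∧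
      X u = geodesic C (X u') (ρ⁻¹ • axisTangent C w l (X u') (N u')) (ζ u) := by
    intro u hu
    obtain ⟨u', hu', hX', hh', hE'⟩ := hmove u hu.1 0 h0I
    rw [leafHeight_zero] at hh'
    rw [zero_sub] at hX' hE'
    have hXπ : X u' = π u := hX'
    have hball : X u' ∈ Metric.ball (X u₀) (δ / 4) := by rw [hXπ]; exact hu.2
    refine ⟨u', ⟨⟨⟨hu', Metric.ball_subset_ball (by linarith) hball⟩, ?_⟩, ?_⟩, hh', hXπ, ?_⟩
    · have := hHJ 0 h0I
      rw [leafHeight_zero] at this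
      rwa [Set.mem_preimage, hh']
    · rw [Set.mem_preimage, (hπc u' hu' hh').2]
      exact hball
    · rw [hE', leafSlope_zero, inv_smul_smul₀ hρ.ne', hX', geodesic_geodesic hC]
      simp
  have hforth : ∀ u' ∈ U, ip C w (X u') = c → ∀ z ∈ I, ∃ u ∈ U,
      X u = geodesic C (X u') (ρ⁻¹ • axisTangent C w l (X u') (N u')) z ∧ π u = X u' ∧
      ζ u = z := by
    intro u' hu' huc z hz
    obtain ⟨hζ0, hπ0⟩ := hπc u' (hUD hu') huc
    obtain ⟨u, hu, hXu, hhu, hEu⟩ := hmove u' hu'.1 z hz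
    have hcl := hclose u' hu'.1 z (by
      rw [abs_lt]; exact ⟨by linarith [hz.1], by linarith [hz.2]⟩)
    rw [hζ0, leafSlope_zero] at hXu hEu hcl
    rw [sub_zero] at hXu hEu
    have hζu := hζ u z hz hhu
    have hπu : π u = X u' := by
      simp only [π]
      rw [hζu, hEu, inv_smul_smul₀ (hI z hz).2.ne', hXu, geodesic_geodesic hC]
      simp
    have hball : X u' ∈ Metric.ball (X u₀) (δ / 4) := by rw [← hπ0]; exact hu'.2
    refine ⟨u, ⟨⟨⟨hu, ?_⟩, ?_⟩, ?_⟩, hXu, hπu, hζu⟩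
    · rw [Metric.mem_ball] at hball
      rw [Set.mem_preimage, Metric.mem_ball, hXu]
      exact (dist_triangle _ (X u') _).trans_lt (by linarith)
    · rw [Set.mem_preimage, hhu]
      exact hHJ z hz
    · rw [Set.mem_preimage, hπu]
      exact hball
  have hu₀U : u₀ ∈ U := by
    refine ⟨⟨⟨hu₀, Metric.mem_ball_self (by linarith)⟩, ?_⟩, ?_⟩
    · have := hHJ 0 h0I
      rwa [leafHeight_zero] at this
    · rw [Set.mem_preimage, (hπc u₀ hu₀ rfl).2]
      exact Metric.mem_ball_self (by linarith)
  obtain ⟨humb, η₁, η₂, a, hframe, hW⟩ := P.exists_framed_level hC hU hUD hρ hρ2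
  have hformula : ∀ u ∈ U, X u = ruledMap C η₁ η₂ a (π u, ζ u) := by
    intro u hu
    obtain ⟨u', hu', huc, hXπ, hXu⟩ := hback u hu
    rw [ruledMap, ← hXπ, hW u' hu' huc]
    exact hXu
  refine ⟨c, _, η₁, η₂, a, I, U, π, ζ, humb, hframe, Set.ordConnected_Ioo,
    Ioo_mem_nhds (by linarith) hs₀, hU, hu₀U, hUD, hπs.mono hUU₀, hζs.mono hUU₀,
    (hπc u₀ hu₀ rfl).2, (hπc u₀ hu₀ rfl).1, ⟨?_, ?_, ?_⟩, hformula⟩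
  · intro u hu
    obtain ⟨u', hu', huc, hXπ, -⟩ := hback u hu
    exact ⟨⟨u', ⟨hu', huc⟩, hXπ⟩, (hζJ u hu.1.2).1⟩
  · intro u hu v hv h
    refine P.injOn (hUD hu) (hUD hv) ?_
    rw [hformula u hu, hformula v hv]
    exact congrArg _ h
  · rintro ⟨_, z⟩ ⟨⟨u', ⟨hu', huc⟩, rfl⟩, hz⟩
    obtain ⟨u, hu, -, hπu, hζu⟩ := hforth u' hu' huc z hz
    exact ⟨u, hu, Prod.ext hπu hζu⟩

end

/-! ### Ruling near points where the axis is normal -/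

section

variable {k : ℕ} {C : ℝ} {w : Ambient (k + 2)} {l : ℝ}
  {D : Set (EuclideanSpace ℝ (Fin (k + 1)))}
  {X N : EuclideanSpace ℝ (Fin (k + 1)) → Ambient (k + 2)} {u : EuclideanSpace ℝ (Fin (k + 1))}
  {O : Set (Ambient (k + 2))} {r : Ambient (k + 2) → EuclideanSpace ℝ (Fin (k + 1))}

theorem TubularPatch.neg (P : TubularPatch C w l D X N O r) :
    TubularPatch C (-w) (-l) D X N O r :=
  { P with toPatch := P.toPatch.neg }

theorem axisTangent_neg {n : ℕ} (w p ν : Ambient n) (l : ℝ) :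
    axisTangent C (-w) (-l) p ν = - axisTangent C w l p ν := by
  simp only [axisTangent, ip_neg_left]
  module

theorem exists_sn_cs_pos (hC : C ≠ 0) : ∃ ε > 0, ∀ z ∈ Set.Icc (0 : ℝ) ε, 0 < cs C z ∧
    (0 < z → 0 < sn C z) := by
  obtain ⟨ε, hε, h⟩ := Metric.eventually_nhds_iff_ball.mp
    (continuousAt_const.eventually_lt (contDiff_cs (C := C) (m := 0)).continuous.continuousAt
      (show (0 : ℝ) < cs C 0 by simp))
  have hcs : ∀ z ∈ Set.Icc (0 : ℝ) (ε / 2), 0 < cs C z := fun z hz => h z (by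
    rw [Metric.mem_ball, Real.dist_eq, sub_zero, abs_lt]
    exact ⟨by linarith [hz.1], by linarith [hz.2]⟩)
  have hmono : StrictMonoOn (sn C) (Set.Icc 0 (ε / 2)) := by
    refine strictMonoOn_of_deriv_pos (convex_Icc _ _)
      (contDiff_sn (m := 0)).continuous.continuousOn fun z hz => ?_
    rw [(hasDerivAt_sn hC z).deriv]
    exact hcs z (interior_subset hz)
  refine ⟨ε / 2, by linarith, fun z hz => ⟨hcs z hz, fun h0 => ?_⟩⟩
  have := hmono (Set.left_mem_Icc.mpr (by linarith)) hz h0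
  rwa [sn_zero] at this

/-- The point of the leaf through `p` at which the axis is normal to the hypersurface with unit
normal `ν`, where the height is `c`. -/
def foot {n : ℕ} (C : ℝ) (w : Ambient n) (l c : ℝ) (ν : Ambient n) : Ambient n :=
  (C * c)⁻¹ • (w - l • ν)

theorem foot_eq {n : ℕ} (w p ν : Ambient n) (l c : ℝ) :
    foot C w l c ν = (C * c)⁻¹ • (axisTangent C w l p ν + (C * ip C w p) • p) := by
  rw [foot, axisTangent]
  congr 1
  module

/-- Since `w - l ν = E + C h p` does not change along a leaf, it can be read off at the end of the
leaf, where `E = 0` and it equals `C c` times the point. So the end of a leaf is a smooth function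
of the normal alone, even where the direction `E / |E|` is undefined. -/
theorem foot_eq_geodesic {n : ℕ} {w p ν : Ambient n} {l c s : ℝ} (hC : C ≠ 0) (hc : c ≠ 0)
    (hh : ip C w p = leafHeight C c 0 s) (h0 : leafSlope C c 0 s ≠ 0) :
    foot C w l c ν
      = geodesic C p ((leafSlope C c 0 s)⁻¹ • axisTangent C w l p ν) (-s) := by
  have h1 : axisTangent C w l p ν =
      leafSlope C c 0 s • ((leafSlope C c 0 s)⁻¹ • axisTangent C w l p ν) := by
    rw [smul_inv_smul₀ h0]
  rw [foot_eq w p, hh]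
  nth_rw 1 [h1]
  generalize (leafSlope C c 0 s)⁻¹ • axisTangent C w l p ν = e
  rw [geodesic_eq, cs_neg, sn_neg, smul_add, smul_smul, smul_smul, add_comm]
  congr 2
  · simp only [leafHeight]; field_simp; ring
  · simp only [leafSlope]; field_simp; ring

theorem foot_of_axisTangent_eq_zero {n : ℕ} {w p ν : Ambient n} {l c : ℝ} (hC : C ≠ 0)
    (hc : c ≠ 0) (hh : ip C w p = c) (h0 : axisTangent C w l p ν = 0) : foot C w l c ν = p := by
  rw [foot_eq w p, h0, hh, zero_add, inv_smul_smul₀ (mul_ne_zero hC hc)]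

/-- With `C c < 0` the critical height `c` is a local minimum, and leaves leave it with slope `-C c
sn z > 0`. The base level set is taken at the regular height `c₁` of parameter `s₁`, and the leaves
are followed from there down to height `c`. -/
theorem TubularPatch.exists_ruled_of_neg (hC : C ≠ 0) (P : TubularPatch C w l D X N O r)
    {u₀ : EuclideanSpace ℝ (Fin (k + 1))} (hu₀ : u₀ ∈ D)
    (hE₀ : axisTangent C w l (X u₀) (N u₀) = 0)
    (hdense : D ⊆ closure {u | u ∈ D ∧ axisTangent C w l (X u) (N u) ≠ 0})
    (hneg : C * ip C w (X u₀) < 0) :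
    ∃ (c : ℝ) (S : Set (Ambient (k + 2))) (η₁ η₂ : Ambient (k + 2) → Ambient (k + 2)) (a : ℝ)
      (I₀ : Set ℝ) (U : Set (EuclideanSpace ℝ (Fin (k + 1)))),
      IsUmbilicalSection C w c ∧ IsFramedHypersurface C w c S η₁ η₂ ∧ I₀.OrdConnected ∧
      I₀ ∈ 𝓝 (0 : ℝ) ∧ IsOpen U ∧ u₀ ∈ U ∧ U ⊆ D ∧
      X '' U = ruledMap C η₁ η₂ a '' (S ×ˢ I₀) := by
  set c := ip C w (X u₀)
  have hc : c ≠ 0 := fun h => by rw [h, mul_zero] at hneg; exact lt_irrefl _ hneg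
  have hρ2 : (0 : ℝ) ^ 2 + C * c ^ 2 = ip C w w - l ^ 2 := by
    have := P.ip_axisTangent_self hC hu₀
    rw [hE₀, ip_zero_left] at this
    linarith
  obtain ⟨δ, hδ, hO, hleaf⟩ := P.exists_ball hC hu₀
  obtain ⟨t₀, ht₀, hsmall⟩ := exists_dist_geodesic_lt (n := k + 2) hC (‖X u₀‖ + δ)
    (show 0 < δ / 4 by linarith)
  obtain ⟨ε, hε, htrig⟩ := exists_sn_cs_pos hC
  obtain ⟨s₀, hs₀, hs₀ε, hs₀t⟩ : ∃ s₀ > 0, s₀ ≤ ε ∧ 2 * s₀ ≤ t₀ :=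
    ⟨min ε (t₀ / 2), lt_min hε (by linarith), min_le_left _ _, by
      linarith [min_le_right ε (t₀ / 2)]⟩
  have hslope : ∀ z, 0 < z → z ≤ s₀ → 0 < leafSlope C c 0 z := by
    intro z h0 h1
    have := (htrig z ⟨h0.le, by linarith⟩).2 h0
    rw [leafSlope]
    nlinarith
  have hmono : StrictMonoOn (leafHeight C c 0) (Set.Icc 0 s₀) := by
    refine strictMonoOn_of_deriv_pos (convex_Icc _ _)
      (contDiff_leafHeight (m := 0)).continuous.continuousOn fun z hz => ?_
    rw [(hasDerivAt_leafHeight hC z).deriv]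
    rw [interior_Icc] at hz
    exact hslope z hz.1 hz.2.le
  -- The foot plays the role of the base point: it is constant along leaves and continuous across
  -- the zeros of `E`. The condition `0 < c * h` keeps the height on the side of `c`, excluding
  -- values near `-c`.
  set U : Set (EuclideanSpace ℝ (Fin (k + 1))) := D ∩ (fun u => (X u, ip C w (X u), foot C w l c (N u))) ⁻¹'
    (Metric.ball (X u₀) (δ / 2) ×ˢ ({h | 0 < c * h ∧ h < leafHeight C c 0 s₀} ×ˢ
      Metric.ball (X u₀) (δ / 4)))
  have hfoot : ContinuousOn (fun u => foot C w l c (N u)) D := by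
    have := P.smooth_normal.continuousOn
    unfold foot
    fun_prop
  have hU : IsOpen U := by
    refine (P.smooth.continuousOn.prodMk
      (P.contDiffOn_height.continuousOn.prodMk hfoot)).isOpen_inter_preimage P.isOpen ?_
    refine Metric.isOpen_ball.prod (IsOpen.prod ?_ Metric.isOpen_ball)
    exact (isOpen_lt continuous_const (continuous_const.mul continuous_id)).inter
      (isOpen_lt continuous_id continuous_const)
  have hUD : U ⊆ D := Set.inter_subset_left
  have hnorm : ∀ {p}, p ∈ Metric.closedBall (X u₀) δ → ‖p‖ ≤ ‖X u₀‖ + δ := by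
    intro p hp
    rw [Metric.mem_closedBall, dist_eq_norm] at hp
    linarith [norm_le_norm_add_norm_sub' p (X u₀)]
  have hheight : ∀ u ∈ U, ∃ s ∈ Set.Ico 0 s₀, ip C w (X u) = leafHeight C c 0 s := by
    rintro u ⟨hu, -, ⟨h1, h2⟩, -⟩
    have hnn : 0 ≤ C * (c ^ 2 - ip C w (X u) ^ 2) := by
      have h3 := P.ip_axisTangent_self hC hu
      have h4 := ip_self_nonneg_of_tangent hC (P.mem u hu) (P.ip_axisTangent_position (l := l) hC hu)
      rw [h3] at h4
      linarith
    -- `|E|² = C (c² - h²) ≥ 0` and `h` has the sign of `c`. For `C < 0` this means `h ≥ c > 0`; for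
    -- `C > 0` it means `|h| ≤ |c|` with both negative.
    have hle : c ≤ ip C w (X u) := by
      simp only at h1 h2
      generalize ip C w (X u) = h at *
      by_contra! hlt
      rcases lt_or_gt_of_ne hC with h' | h'
      · have : 0 < c := by nlinarith
        have : 0 < h := pos_of_mul_pos_right h1 this.le
        nlinarith [mul_pos this (sub_pos.mpr hlt)]
      · have hcn : c < 0 := by nlinarith
        have : h < 0 := by linarith
        have h5 : 0 < (c - h) * (-(c + h)) := mul_pos (by linarith) (by linarith)
        nlinarith
    obtain ⟨s, hs, hsu⟩ := intermediate_value_Icc hs₀.le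
      (contDiff_leafHeight (C := C) (c := c) (ρ := 0) (m := 0)).continuous.continuousOn
      ⟨by rwa [leafHeight_zero], h2.le⟩
    refine ⟨s, ⟨hs.1, lt_of_le_of_ne hs.2 ?_⟩, hsu.symm⟩
    rintro rfl
    exact h2.ne hsu.symm
  have hzero : ∀ u ∈ D, ip C w (X u) = c → axisTangent C w l (X u) (N u) = 0 := by
    intro u hu huc
    refine eq_zero_of_tangent hC (P.mem u hu) (P.ip_axisTangent_position hC hu) ?_
    rw [P.ip_axisTangent_self hC hu, huc, ← hρ2]
    ring
  have hclose : ∀ u ∈ D, X u ∈ Metric.closedBall (X u₀) δ → ∀ s ∈ Set.Ioo 0 s₀,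
      ip C w (X u) = leafHeight C c 0 s → ∀ z, |z| < t₀ → dist (geodesic C (X u)
      ((leafSlope C c 0 s)⁻¹ • axisTangent C w l (X u) (N u)) z) (X u) < δ / 4 :=
    fun u hu hδu s hs hus z hz => hsmall _ (P.mem u hu) (hnorm hδu) _
      (P.ip_direction_position hC hu _)
      (P.ip_direction_self hC hu hρ2 hus (hslope s hs.1 hs.2.le)) z hz
  have hnear : ∀ u ∈ D, X u ∈ Metric.closedBall (X u₀) δ → ∀ s ∈ Set.Ico 0 s₀,
      ip C w (X u) = leafHeight C c 0 s → dist (X u) (foot C w l c (N u)) < δ / 4 := by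
    intro u hu hδu s hs hus
    rcases hs.1.eq_or_lt with h0 | h0
    · rw [← h0, leafHeight_zero] at hus
      rw [foot_of_axisTangent_eq_zero hC hc hus (hzero u hu hus), dist_self]
      linarith
    · rw [foot_eq_geodesic hC hc hus (hslope s h0 hs.2.le).ne', dist_comm]
      exact hclose u hu hδu s ⟨h0, hs.2⟩ hus _ (by
        rw [abs_neg, abs_of_pos h0]; linarith [hs.2])
  have hmemU : ∀ u ∈ D, X u ∈ Metric.closedBall (X u₀) δ → ∀ s ∈ Set.Ico 0 s₀,
      ip C w (X u) = leafHeight C c 0 s → foot C w l c (N u) ∈ Metric.ball (X u₀) (δ / 4) →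
      u ∈ U := by
    intro u hu hδu s hs hus hf
    refine ⟨hu, ?_, ⟨?_, ?_⟩, hf⟩
    · have := hnear u hu hδu s hs hus
      rw [Metric.mem_ball] at hf ⊢
      exact (dist_triangle _ (foot C w l c (N u)) _).trans_lt (by linarith)
    · have h1 := (htrig s ⟨hs.1, by linarith [hs.2]⟩).1
      have h2 : 0 < c ^ 2 := by positivity
      simp only [hus, leafHeight]
      nlinarith [mul_pos h2 h1]
    · simp only [hus]
      exact hmono ⟨hs.1, hs.2.le⟩ ⟨hs₀.le, le_rfl⟩ hs.2
  have hmove : ∀ u ∈ U, ∀ s ∈ Set.Ioo 0 s₀, ip C w (X u) = leafHeight C c 0 s →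
      ∀ t ∈ Set.Ico 0 s₀, ∃ u' ∈ U, X u' = geodesic C (X u)
        ((leafSlope C c 0 s)⁻¹ • axisTangent C w l (X u) (N u)) (t - s) ∧ N u' = N u ∧
        ip C w (X u') = leafHeight C c 0 t ∧
        axisTangent C w l (X u') (N u') = leafSlope C c 0 t • velocity C (X u)
          ((leafSlope C c 0 s)⁻¹ • axisTangent C w l (X u) (N u)) (t - s) := by
    intro u hu s hs hus t ht
    have hpos := hslope s hs.1 hs.2.le
    have huδ : X u ∈ Metric.ball (X u₀) (δ / 2) := hu.2.1
    have hsub : Set.uIcc s t ⊆ Set.Ico 0 s₀ :=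
      Set.OrdConnected.uIcc_subset Set.ordConnected_Ico ⟨hs.1.le, hs.2⟩ ht
    have hb : ∀ z ∈ Set.uIcc s t, geodesic C (X u)
        ((leafSlope C c 0 s)⁻¹ • axisTangent C w l (X u) (N u)) (z - s)
        ∈ Metric.ball (X u₀) δ := by
      intro z hz
      have hz := hsub hz
      have h3 := hclose u (hUD hu) (Metric.ball_subset_closedBall
        (Metric.ball_subset_ball (by linarith) huδ)) s hs hus (z - s) (by
        rw [abs_lt]
        exact ⟨by linarith [hz.1, hs.2], by linarith [hz.2, hs.1]⟩)
      rw [Metric.mem_ball] at huδ ⊢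
      exact (dist_triangle _ (X u) _).trans_lt (by linarith)
    have hpz : ∀ z ∈ Set.uIcc s t, z ≠ t → 0 < leafSlope C c 0 z := by
      refine fun z hz hzt => hslope z ((hsub hz).1.lt_of_ne fun h0 => ?_) (hsub hz).2.le
      subst h0
      rcases Set.mem_uIcc.mp hz with h | h
      · exact absurd h.1 (not_le.mpr hs.1)
      · exact hzt (le_antisymm ht.1 h.1)
    obtain ⟨u', hu', hX', hN', hh', hE'⟩ := hleaf u (hUD hu)
      ((leafSlope C c 0 s)⁻¹ • axisTangent C w l (X u) (N u)) c 0 s t hus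
      (by rw [smul_inv_smul₀ hpos.ne']) (P.ip_direction_self hC (hUD hu) hρ2 hus hpos) hpz hb
    refine ⟨u', hmemU u' hu' ?_ t ht hh' ?_, hX', hN', hh', hE'⟩
    · rw [hX']
      exact Metric.ball_subset_closedBall (hb t Set.right_mem_uIcc)
    · rw [hN']
      exact hu.2.2.2
  set s₁ := s₀ / 2
  have hs₁ : s₁ ∈ Set.Ioo 0 s₀ := ⟨by simp only [s₁]; linarith, by simp only [s₁]; linarith⟩
  set c₁ := leafHeight C c 0 s₁
  set ρ₁ := leafSlope C c 0 s₁
  have hρ₁ : 0 < ρ₁ := hslope s₁ hs₁.1 hs₁.2.le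
  have hρ₁2 : ρ₁ ^ 2 + C * c₁ ^ 2 = ip C w w - l ^ 2 := by
    rw [leafSlope_sq hC, ← hρ2]; ring
  obtain ⟨humb, η₁, η₂, a, hframe, hW⟩ := P.exists_framed_level hC hU hUD hρ₁ hρ₁2
  have hu₀U : u₀ ∈ U := by
    refine hmemU u₀ hu₀ (Metric.mem_closedBall_self hδ.le) 0 ⟨le_rfl, hs₀⟩ (by simp [c]) ?_
    rw [foot_of_axisTangent_eq_zero hC hc rfl hE₀]
    exact Metric.mem_ball_self (by linarith)
  -- Time is shifted by `s₁`, so that the base level has parameter `0`. The left end is included: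
  -- `-s₁` corresponds to height `c`, where `E = 0`.
  refine ⟨c₁, _, η₁, η₂, a, Set.Ico (-s₁) (s₀ - s₁), U, humb, hframe, Set.ordConnected_Ico,
    Ico_mem_nhds (by linarith [hs₁.1]) (by linarith [hs₁.2]), hU, hu₀U, hUD,
    Set.Subset.antisymm ?_ ?_⟩
  · rintro _ ⟨u, hu, rfl⟩
    obtain ⟨s, hs, hus⟩ := hheight u hu
    rcases hs.1.eq_or_lt with h0 | h0
    · have huc : ip C w (X u) = c := by rw [hus, ← h0, leafHeight_zero]
      have hfu := foot_of_axisTangent_eq_zero hC hc huc (hzero u (hUD hu) huc)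
      -- At a zero of `E` there is no direction to follow. Instead, regular points `x n → u` are
      -- moved along their leaves to height `c₁`, keeping their normals. By compactness a limit `r
      -- p` exists, with height `c₁` and normal `N u`, so its foot is `X u`.
      have hcl : u ∈ closure (U ∩ {u | u ∈ D ∧ axisTangent C w l (X u) (N u) ≠ 0}) :=
        hU.inter_closure ⟨hu, hdense (hUD hu)⟩
      obtain ⟨x, hx, hxu⟩ := mem_closure_iff_seq_limit.mp hcl
      have hv : ∀ n, ∃ v ∈ U, ip C w (X v) = c₁ ∧ N v = N (x n) := by
        intro n
        obtain ⟨s', hs', hus'⟩ := hheight (x n) (hx n).1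
        have h0' : 0 < s' := hs'.1.lt_of_ne fun h => (hx n).2.2
          (hzero _ (hx n).2.1 (by rw [hus', ← h, leafHeight_zero]))
        obtain ⟨v, hv, -, hN, hhv, -⟩ :=
          hmove (x n) (hx n).1 s' ⟨h0', hs'.2⟩ hus' s₁ ⟨hs₁.1.le, hs₁.2⟩
        exact ⟨v, hv, hhv, hN⟩
      choose y hyU hyc hyN using hv
      obtain ⟨p, hp, φ, hφ, hlim⟩ := (isCompact_closedBall (X u₀) (δ / 2)).tendsto_subseq
        (x := fun n => X (y n)) fun n => Metric.ball_subset_closedBall (hyU n).2.1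
      have hpO : p ∈ O := hO (Metric.closedBall_subset_ball (by linarith) hp)
      have hv : r p ∈ D := P.mapsTo_retraction hpO
      have hyv : Filter.Tendsto (fun n => y (φ n)) Filter.atTop (𝓝 (r p)) := by
        have h1 := ((P.smooth_retraction.continuousOn.continuousAt
          (P.isOpen_tube.mem_nhds hpO)).tendsto.comp hlim)
        refine h1.congr fun n => ?_
        exact P.retraction _ (hUD (hyU (φ n)))
      have hXv : X (r p) = p := tendsto_nhds_unique
        ((P.smooth.continuousOn.continuousAt (P.isOpen.mem_nhds hv)).tendsto.comp hyv) hlim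
      have hNv : N (r p) = N u := by
        refine tendsto_nhds_unique
          ((P.smooth_normal.continuousOn.continuousAt (P.isOpen.mem_nhds hv)).tendsto.comp hyv) ?_
        refine ((P.smooth_normal.continuousOn.continuousAt
          (P.isOpen.mem_nhds (hUD hu))).tendsto.comp (hxu.comp hφ.tendsto_atTop)).congr fun n => ?_
        exact (hyN (φ n)).symm
      have hcv : ip C w (X (r p)) = c₁ := by
        refine tendsto_nhds_unique ((P.contDiffOn_height.continuousOn.continuousAt
          (P.isOpen.mem_nhds hv)).tendsto.comp hyv) (tendsto_const_nhds.congr fun n => ?_)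
        exact (hyc (φ n)).symm
      have hvU : r p ∈ U := by
        refine hmemU (r p) hv ?_ s₁ ⟨hs₁.1.le, hs₁.2⟩ hcv ?_
        · rw [hXv]
          exact Metric.closedBall_subset_closedBall (by linarith) hp
        · rw [hNv]
          exact hu.2.2.2
      refine ⟨(X (r p), -s₁), ⟨⟨r p, ⟨hvU, hcv⟩, rfl⟩, le_rfl, by linarith⟩, ?_⟩
      rw [ruledMap, hW _ hvU hcv, ← foot_eq_geodesic hC hc hcv hρ₁.ne', hNv, hfu]
    · obtain ⟨v, hv, hXv, -, hcv, hEv⟩ := hmove u hu s ⟨h0, hs.2⟩ hus s₁ ⟨hs₁.1.le, hs₁.2⟩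
      refine ⟨(X v, s - s₁), ⟨⟨v, ⟨hv, hcv⟩, rfl⟩, by linarith, by linarith [hs.2]⟩, ?_⟩
      rw [ruledMap, hW v hv hcv, hEv, inv_smul_smul₀ hρ₁.ne', hXv]
      simp only
      rw [geodesic_geodesic hC]
      simp
  · rintro _ ⟨⟨_, z⟩, ⟨⟨v, ⟨hv, hcv⟩, rfl⟩, hz⟩, rfl⟩
    simp only at hz
    obtain ⟨u, hu, hXu, -⟩ := hmove v hv s₁ hs₁ hcv (s₁ + z)
      ⟨by linarith [hz.1], by linarith [hz.2]⟩
    refine ⟨u, hu, ?_⟩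
    rw [hXu, ruledMap, hW v hv hcv, add_sub_cancel_left]

/-- Near a point at which the axis is normal to it, the hypersurface is swept out by geodesics
normal to a level set of the height. -/
theorem TubularPatch.exists_ruled (hC : C ≠ 0) (P : TubularPatch C w l D X N O r)
    {u₀ : EuclideanSpace ℝ (Fin (k + 1))} (hu₀ : u₀ ∈ D)
    (hE₀ : axisTangent C w l (X u₀) (N u₀) = 0)
    (hdense : D ⊆ closure {u | u ∈ D ∧ axisTangent C w l (X u) (N u) ≠ 0}) :
    ∃ (w : Ambient (k + 2)) (c : ℝ) (S : Set (Ambient (k + 2)))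
      (η₁ η₂ : Ambient (k + 2) → Ambient (k + 2)) (a : ℝ)
      (I₀ : Set ℝ) (U : Set (EuclideanSpace ℝ (Fin (k + 1)))),
      IsUmbilicalSection C w c ∧ IsFramedHypersurface C w c S η₁ η₂ ∧ I₀.OrdConnected ∧
      I₀ ∈ 𝓝 (0 : ℝ) ∧ IsOpen U ∧ u₀ ∈ U ∧ U ⊆ D ∧
      X '' U = ruledMap C η₁ η₂ a '' (S ×ˢ I₀) := by
  -- A zero of `E` at height zero would have a neighbourhood of zeros, against density.
  have hh : ip C w (X u₀) ≠ 0 := by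
    intro h
    have h1 := P.eventually_axisTangent_eq_zero_of_height hC hu₀ hE₀ h
    obtain ⟨v, hv, hv'⟩ := (mem_closure_iff_frequently.mp (hdense hu₀) |>.and_eventually h1).exists
    exact hv.2 hv'
  rcases lt_or_gt_of_ne (mul_ne_zero hC hh) with h | h
  · exact ⟨w, P.exists_ruled_of_neg hC hu₀ hE₀ hdense h⟩
  -- Changing the signs of `w` and `l` with `N` fixed only reverses `E` and the height.
  · refine ⟨-w, P.neg.exists_ruled_of_neg hC hu₀ ?_ ?_ ?_⟩
    · rw [axisTangent_neg, hE₀, neg_zero]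
    · simpa only [axisTangent_neg, ne_eq, neg_eq_zero] using hdense
    · rw [ip_neg_left]; linarith

end

/-! ### Passage to the manifold and density -/

section

variable {k : ℕ} {C : ℝ} {M : Type*} [TopologicalSpace M]
  [ChartedSpace (EuclideanSpace ℝ (Fin (k + 1))) M] [IsManifold (𝓡 (k + 1)) ∞ M]
  {x : M → Ambient (k + 2)} {V : Ambient (k + 2) → Ambient (k + 2)} {w : Ambient (k + 2)} {l : ℝ}

/-- The chart identifies tangent spaces bijectively. Injectivity of the differential and
orthogonality to the tangent space can thus be moved between `M` and its charts. -/
theorem fderiv_comp_extChartAt_symm (hx : IsHypersurface C x) (q : M)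
    {u : EuclideanSpace ℝ (Fin (k + 1))} (hu : u ∈ (extChartAt (𝓡 (k + 1)) q).target) :
    ∃ T : EuclideanSpace ℝ (Fin (k + 1)) ≃
        TangentSpace (𝓡 (k + 1)) ((extChartAt (𝓡 (k + 1)) q).symm u),
      ∀ v, fderiv ℝ (x ∘ (extChartAt (𝓡 (k + 1)) q).symm) u v =
        mfderiv (𝓡 (k + 1)) 𝓘(ℝ, Ambient (k + 2)) x ((extChartAt (𝓡 (k + 1)) q).symm u) (T v) := by
  have hinv := isInvertible_mfderivWithin_extChartAt_symm (I := 𝓡 (k + 1)) hu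
  rw [ModelWithCorners.Boundaryless.range_eq_univ, mfderivWithin_univ] at hinv
  obtain ⟨T, hT⟩ := hinv
  refine ⟨T.toEquiv, fun v => ?_⟩
  have hd : MDifferentiableAt 𝓘(ℝ, EuclideanSpace ℝ (Fin (k + 1))) (𝓡 (k + 1))
      (extChartAt (𝓡 (k + 1)) q).symm u :=
    ((contMDiffOn_extChartAt_symm (n := ∞) q).contMDiffAt
      ((isOpen_extChartAt_target q).mem_nhds hu)).mdifferentiableAt (by simp)
  have hxd := (hx.smooth ((extChartAt (𝓡 (k + 1)) q).symm u)).mdifferentiableAt (by simp)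
  rw [← mfderiv_eq_fderiv, mfderiv_comp u hxd hd, ← hT]
  rfl

/-- A concircular hypersurface is, in a chart, a patch. -/
theorem exists_patch (hC : C ≠ 0) (hx : IsHypersurface C x)
    (hVw : ∀ p ∈ spaceForm (k + 2) C, V p = tanProj C p w) (q : M)
    (hN : ∃ (U : Set M) (N : M → Ambient (k + 2)), IsOpen U ∧ q ∈ U ∧
      ContMDiffOn (𝓡 (k + 1)) 𝓘(ℝ, Ambient (k + 2)) ∞ N U ∧
      ∀ u ∈ U, IsUnitNormalAt C x u (N u) ∧ ip C (N u) (V (x u)) = l) :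
    ∃ (D : Set (EuclideanSpace ℝ (Fin (k + 1))))
      (N : EuclideanSpace ℝ (Fin (k + 1)) → Ambient (k + 2)),
      extChartAt (𝓡 (k + 1)) q q ∈ D ∧ D ⊆ (extChartAt (𝓡 (k + 1)) q).target ∧
      Patch C w l D (x ∘ (extChartAt (𝓡 (k + 1)) q).symm) N ∧
      ∀ u ∈ D, (IsNormalAt C x ((extChartAt (𝓡 (k + 1)) q).symm u)
        (V (x ((extChartAt (𝓡 (k + 1)) q).symm u))) ↔
        axisTangent C w l ((x ∘ (extChartAt (𝓡 (k + 1)) q).symm) u) (N u) = 0) := by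
  obtain ⟨U, N, hU, hqU, hNs, hNU⟩ := hN
  set φ := extChartAt (𝓡 (k + 1)) q
  have hφ : ContMDiffOn 𝓘(ℝ, EuclideanSpace ℝ (Fin (k + 1))) (𝓡 (k + 1)) ∞ φ.symm φ.target :=
    contMDiffOn_extChartAt_symm q
  have hDo : IsOpen (φ.target ∩ φ.symm ⁻¹' U) :=
    hφ.continuousOn.isOpen_inter_preimage (isOpen_extChartAt_target q) hU
  -- `V` and `w` differ by a multiple of the position vector, to which tangent vectors and the
  -- normal are orthogonal; in the conditions on `V` it may be replaced by `w`.
  have hVip : ∀ u ∈ φ.target ∩ φ.symm ⁻¹' U, ∀ v : Ambient (k + 2),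
      ip C (V (x (φ.symm u))) v = ip C w v - C * ip C w (x (φ.symm u)) * ip C (x (φ.symm u)) v := by
    intro u hu v
    rw [hVw _ (hx.mem _), tanProj, ip_sub_left, ip_smul_left]
  have hP : Patch C w l (φ.target ∩ φ.symm ⁻¹' U) (x ∘ φ.symm) (N ∘ φ.symm) :=
    { isOpen := hDo
      smooth := contMDiffOn_iff_contDiffOn.mp
        (hx.smooth.comp_contMDiffOn (hφ.mono Set.inter_subset_left))
      smooth_normal := contMDiffOn_iff_contDiffOn.mp
        (hNs.comp (hφ.mono Set.inter_subset_left) fun u hu => hu.2)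
      immersion := fun u hu => by
        obtain ⟨T, hT⟩ := fderiv_comp_extChartAt_symm hx q hu.1
        intro v v' h
        rw [hT, hT] at h
        exact T.injective (hx.immersion _ h)
      mem := fun u _ => hx.mem _
      normal_position := fun u hu => (hNU _ hu.2).1.1
      normal := fun u hu v => by
        obtain ⟨T, hT⟩ := fderiv_comp_extChartAt_symm hx q hu.1
        rw [hT]
        exact (hNU _ hu.2).1.2.1 _
      unit := fun u hu => (hNU _ hu.2).1.2.2
      axis := fun u hu => by
        obtain ⟨⟨h1, -, -⟩, h2⟩ := hNU _ hu.2
        rw [ip_comm, hVip u hu, ip_comm (x _), h1, mul_zero, sub_zero, ip_comm] at h2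
        exact h2 }
  have hqD : φ q ∈ φ.target ∩ φ.symm ⁻¹' U := by
    refine ⟨mem_extChartAt_target q, ?_⟩
    rw [Set.mem_preimage, extChartAt_to_inv]
    exact hqU
  refine ⟨_, _, hqD, Set.inter_subset_left, hP, fun u hu => ?_⟩
  rw [hP.axisTangent_eq_zero_iff hC hu]
  obtain ⟨T, hT⟩ := fderiv_comp_extChartAt_symm hx q hu.1
  have key : ∀ v, ip C (V (x (φ.symm u))) (fderiv ℝ (x ∘ φ.symm) u v) =
      ip C w (fderiv ℝ (x ∘ φ.symm) u v) := by
    intro v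
    have h := hP.ip_fderiv_position hu v
    rw [ip_comm, Function.comp_apply] at h
    rw [hVip u hu, h]
    ring
  constructor
  · intro h v
    rw [← key, hT]
    exact h _
  · intro h Y
    obtain ⟨v, rfl⟩ := T.surjective Y
    rw [← hT, key]
    exact h v

/-- `E = 0` everywhere makes `C h²` constant, so by connectedness `h` is a constant `c`, and `⟨w, w⟩
- C c² = l²`. It remains to see that `l ≠ 0`, for the hyperplane to be nowhere tangent. -/
theorem isTrivial_of_isNormalAt [ConnectedSpace M] (hC : C ≠ 0) (hx : IsHypersurface C x)
    (hVw : ∀ p ∈ spaceForm (k + 2) C, V p = tanProj C p w) (hw : w ≠ 0)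
    (hN : ∀ q : M, ∃ (U : Set M) (N : M → Ambient (k + 2)), IsOpen U ∧ q ∈ U ∧
      ContMDiffOn (𝓡 (k + 1)) 𝓘(ℝ, Ambient (k + 2)) ∞ N U ∧
      ∀ u ∈ U, IsUnitNormalAt C x u (N u) ∧ ip C (N u) (V (x u)) = l)
    (hnormal : ∀ q, IsNormalAt C x q (V (x q))) : IsTrivial C x := by
  have hE : ∀ q : M, ∃ ν : Ambient (k + 2), axisTangent C w l (x q) ν = 0 ∧
      C * ip C w (x q) ^ 2 = ip C w w - l ^ 2 := by
    intro q
    obtain ⟨D, N, hq, -, hP, hiff⟩ := exists_patch hC hx hVw q (hN q)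
    have h0 := (hiff _ hq).mp (hnormal _)
    have h1 := hP.ip_axisTangent_self hC hq
    rw [h0, ip_zero_left] at h1
    rw [Function.comp_apply, extChartAt_to_inv] at h0 h1
    exact ⟨_, h0, by linarith⟩
  obtain ⟨q₀⟩ := (inferInstance : Nonempty M)
  set c := ip C w (x q₀)
  have hcont : Continuous fun q => ip C w (x q) :=
    continuousOn_univ.mp (continuousOn_const.ip hx.smooth.continuous.continuousOn)
  have hsq : ∀ q, ip C w (x q) ^ 2 = c ^ 2 := by
    intro q
    obtain ⟨_, -, h1⟩ := hE q
    obtain ⟨_, -, h2⟩ := hE q₀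
    exact mul_left_cancel₀ hC (h1.trans h2.symm)
  have hconst : ∀ q, ip C w (x q) = c := by
    intro q
    by_cases hc : c = 0
    · have := hsq q
      rw [hc] at this ⊢
      simpa using this
    · exact isPreconnected_univ.eq_of_sq_eq (g := fun _ => c) hcont.continuousOn
        continuousOn_const (fun q _ => hsq q) (fun _ => hc) (Set.mem_univ q₀) rfl (Set.mem_univ q)
  -- If `l = 0`, then `w = C c x` everywhere, so `x` is constant, which is impossible for an
  -- immersion in positive dimension.
  have hl : l ≠ 0 := by
    rintro rfl
    have hxc : ∀ q, w = (C * c) • x q := by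
      intro q
      obtain ⟨ν, hν, -⟩ := hE q
      rw [axisTangent, hconst q, zero_smul, sub_zero, sub_eq_zero] at hν
      exact hν
    have hc : C * c ≠ 0 := by
      intro h
      rw [hxc q₀, h, zero_smul] at hw
      exact hw rfl
    have hx' : x = fun _ => (C * c)⁻¹ • w := by
      funext q
      rw [hxc q, inv_smul_smul₀ hc]
    have hinj := hx.immersion q₀
    rw [hx', mfderiv_const] at hinj
    have : (EuclideanSpace.single 0 1 : EuclideanSpace ℝ (Fin (k + 1))) = 0 := hinj rfl
    simpa using congrArg (fun v : EuclideanSpace ℝ (Fin (k + 1)) => v 0) this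
  refine ⟨w, c, isUmbilicalSection_of_pos ?_ hC, ?_⟩
  · obtain ⟨_, -, h⟩ := hE q₀
    change C * c ^ 2 = _ at h
    have : 0 < l ^ 2 := by positivity
    linarith
  · rintro _ ⟨q, rfl⟩
    exact ⟨hx.mem q, hconst q⟩

/-- The interior of the set where `V` is normal is closed by `Patch.eventually_axisTangent_eq_zero`.
If it is not empty, it is all of `M`, and the hypersurface is trivial. -/
theorem dense_not_isNormalAt [ConnectedSpace M] (hC : C ≠ 0) (hx : IsHypersurface C x)
    (hVw : ∀ p ∈ spaceForm (k + 2) C, V p = tanProj C p w) (hw : w ≠ 0)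
    (hN : ∀ q : M, ∃ (U : Set M) (N : M → Ambient (k + 2)), IsOpen U ∧ q ∈ U ∧
      ContMDiffOn (𝓡 (k + 1)) 𝓘(ℝ, Ambient (k + 2)) ∞ N U ∧
      ∀ u ∈ U, IsUnitNormalAt C x u (N u) ∧ ip C (N u) (V (x u)) = l)
    (hnt : ¬ IsTrivial C x) : Dense {q : M | ¬ IsNormalAt C x q (V (x q))} := by
  set Z : Set M := {q | IsNormalAt C x q (V (x q))}
  have hZ : {q : M | ¬ IsNormalAt C x q (V (x q))} = Zᶜ := rfl
  rw [hZ, ← interior_eq_empty_iff_dense_compl]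
  by_contra hne
  have hclosed : IsClosed (interior Z) := by
    refine isClosed_of_closure_subset fun q hq => ?_
    obtain ⟨D, N, hqD, hDt, hP, hiff⟩ := exists_patch hC hx hVw q (hN q)
    set φ := extChartAt (𝓡 (k + 1)) q
    have hφ : ContinuousAt φ q := continuousAt_extChartAt q
    have hsrc : ∀ᶠ q' in 𝓝 q, q' ∈ φ.source :=
      (isOpen_extChartAt_source q).mem_nhds (mem_extChartAt_source q)
    have hD : ∀ᶠ q' in 𝓝 q, φ q' ∈ D := hφ.eventually (hP.isOpen.mem_nhds hqD)
    have hcl : φ q ∈ closure {v | ∀ᶠ v' in 𝓝 v,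
        axisTangent C w l ((x ∘ φ.symm) v') (N v') = 0} := by
      refine mem_closure_iff_frequently.mpr (hφ.tendsto.frequently ?_)
      refine ((mem_closure_iff_frequently.mp hq).and_eventually (hsrc.and hD)).mono ?_
      rintro q' ⟨hq', hs, hD'⟩
      have hsymm : ContinuousAt φ.symm (φ q') := continuousAt_extChartAt_symm'' (φ.map_source hs)
      have h1 : ∀ᶠ v' in 𝓝 (φ q'), φ.symm v' ∈ interior Z := by
        refine hsymm.eventually ?_
        rw [φ.left_inv hs]
        exact isOpen_interior.mem_nhds hq'
      filter_upwards [h1, hP.isOpen.mem_nhds hD'] with v' hv' hvD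
      exact (hiff v' hvD).mp (interior_subset hv')
    have hev := hP.eventually_axisTangent_eq_zero hC hqD hcl
    refine mem_interior_iff_mem_nhds.mpr ?_
    filter_upwards [hφ.eventually hev, hsrc, hD] with q' h1 h2 h3
    have := (hiff _ h3).mpr h1
    rwa [φ.left_inv h2] at this
  have huniv : interior Z = Set.univ :=
    IsClopen.eq_univ ⟨hclosed, isOpen_interior⟩ (Set.nonempty_iff_ne_empty.mpr hne)
  refine hnt (isTrivial_of_isNormalAt hC hx hVw hw hN fun q => ?_)
  have : q ∈ interior Z := huniv ▸ Set.mem_univ q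
  exact interior_subset this

end

end SpaceForm

end

/-! ### The theorem: from charts back to the hypersurface -/

theorem theorem3p4 {k : ℕ} {C : ℝ} (hC : C ≠ 0)
    {M : Type*} [TopologicalSpace M] [T2Space M] [ConnectedSpace M]
    [ChartedSpace (EuclideanSpace ℝ (Fin (k + 1))) M] [IsManifold (𝓡 (k + 1)) ∞ M]
    (x : M → SpaceForm.Ambient (k + 2)) (hx : SpaceForm.IsHypersurface C x)
    (V : SpaceForm.Ambient (k + 2) → SpaceForm.Ambient (k + 2))
    (hV : SpaceForm.IsConcircularHypersurface C x V)
    (hnt : ¬ SpaceForm.IsTrivial C x) :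
    Dense {q : M | ¬ SpaceForm.IsNormalAt C x q (V (x q))} ∧
    ∀ q : M, ∃ (w : SpaceForm.Ambient (k + 2)) (c : ℝ) (P : Set (SpaceForm.Ambient (k + 2)))
      (η₁ η₂ : SpaceForm.Ambient (k + 2) → SpaceForm.Ambient (k + 2)) (a : ℝ)
      (I₀ : Set ℝ) (U : Set M),
      SpaceForm.IsUmbilicalSection C w c ∧
      SpaceForm.IsFramedHypersurface C w c P η₁ η₂ ∧
      I₀.OrdConnected ∧ I₀ ∈ 𝓝 (0 : ℝ) ∧
      IsOpen U ∧ q ∈ U ∧ Set.InjOn x U ∧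
      x '' U = SpaceForm.ruledMap C η₁ η₂ a '' (P ×ˢ I₀) ∧
      (¬ SpaceForm.IsNormalAt C x q (V (x q)) →
        ∃ (π : M → SpaceForm.Ambient (k + 2)) (ζ : M → ℝ),
          ContMDiffOn (𝓡 (k + 1)) 𝓘(ℝ, SpaceForm.Ambient (k + 2)) ∞ π U ∧
          ContMDiffOn (𝓡 (k + 1)) 𝓘(ℝ, ℝ) ∞ ζ U ∧
          π q = x q ∧ ζ q = 0 ∧
          Set.BijOn (fun u => (π u, ζ u)) U (P ×ˢ I₀) ∧
          ∀ u ∈ U, x u = SpaceForm.ruledMap C η₁ η₂ a (π u, ζ u)) := by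
  obtain ⟨hVc, ⟨p₀, hp₀, hVp₀⟩, l, hN⟩ := hV
  obtain ⟨w, hVw⟩ := hVc.exists_axis hC
  have hw : w ≠ 0 := by
    rintro rfl
    refine hVp₀ ?_
    rw [hVw p₀ hp₀, SpaceForm.tanProj, SpaceForm.ip_zero_left]
    simp
  have hdense := SpaceForm.dense_not_isNormalAt hC hx hVw hw hN hnt
  refine ⟨hdense, fun q => ?_⟩
  obtain ⟨D, N, hqD, hDt, hP, hiff⟩ := SpaceForm.exists_patch hC hx hVw q (hN q)
  set φ := extChartAt (𝓡 (k + 1)) q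
  obtain ⟨D', hD', hqD', O, r, P⟩ := hP.exists_tubularPatch hC hqD
  have hDt' : D' ⊆ φ.target := hD'.trans hDt
  have hopen : ∀ U : Set (EuclideanSpace ℝ (Fin (k + 1))), IsOpen U →
      IsOpen (φ.source ∩ φ ⁻¹' U) := fun U hU =>
    (continuousOn_extChartAt q).isOpen_inter_preimage (isOpen_extChartAt_source q) hU
  have hval : ∀ u ∈ φ.source, (x ∘ φ.symm) (φ u) = x u := fun u hu => by
    rw [Function.comp_apply, φ.left_inv hu]
  have himage : ∀ U ⊆ D', x '' (φ.source ∩ φ ⁻¹' U) = (x ∘ φ.symm) '' U := by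
    intro U hU
    ext y
    constructor
    · rintro ⟨u, ⟨hu, huU⟩, rfl⟩
      exact ⟨φ u, huU, hval u hu⟩
    · rintro ⟨v, hv, rfl⟩
      have hvt := hDt' (hU hv)
      exact ⟨φ.symm v, ⟨φ.map_target hvt, by rwa [Set.mem_preimage, φ.right_inv hvt]⟩, rfl⟩
  have hinj : ∀ U ⊆ D', Set.InjOn x (φ.source ∩ φ ⁻¹' U) := by
    rintro U hU a ⟨ha, haU⟩ b ⟨hb, hbU⟩ h
    refine φ.injOn ha hb (P.injOn (hU haU) (hU hbU) ?_)
    rw [hval a ha, hval b hb, h]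
  have hq : φ.symm (φ q) = q := extChartAt_to_inv q
  have hnormal := hiff _ hqD
  rw [hq] at hnormal
  by_cases hE : SpaceForm.axisTangent C w l ((x ∘ φ.symm) (φ q)) (N (φ q)) = 0
  -- Global density on `M`, transported to the chart, supplies the regular points that
  -- `exists_ruled` uses to reach the zeros of `E`.
  · have hloc : D' ⊆ closure {u | u ∈ D' ∧
        SpaceForm.axisTangent C w l ((x ∘ φ.symm) u) (N u) ≠ 0} := by
      intro u hu
      have hut := hDt' hu
      have hφu : ContinuousAt φ (φ.symm u) := continuousAt_extChartAt' (by
        simpa [φ] using φ.map_target hut)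
      have hr : φ (φ.symm u) = u := φ.right_inv hut
      have h1 : Filter.Tendsto φ (𝓝 (φ.symm u)) (𝓝 u) := by
        have := hφu.tendsto
        rwa [hr] at this
      refine mem_closure_iff_frequently.mpr (h1.frequently ?_)
      refine ((mem_closure_iff_frequently.mp (hdense (φ.symm u))).and_eventually
        ((h1.eventually (P.isOpen.mem_nhds hu)).and
          ((isOpen_extChartAt_source q).mem_nhds (φ.map_target hut)))).mono ?_
      rintro q' ⟨hq', hqD, hqs⟩
      refine ⟨hqD, fun h => hq' ?_⟩
      have := (hiff _ (hD' hqD)).mpr h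
      rwa [φ.left_inv hqs] at this
    obtain ⟨w', c, S, η₁, η₂, a, I₀, U, humb, hfr, hI, hI0, hU, hqU, hUD, hX⟩ :=
      P.exists_ruled hC hqD' hE hloc
    refine ⟨w', c, S, η₁, η₂, a, I₀, φ.source ∩ φ ⁻¹' U, humb, hfr, hI, hI0, hopen U hU,
      ⟨mem_extChartAt_source q, hqU⟩, hinj U hUD, (himage U hUD).trans hX, fun h => ?_⟩
    exact absurd (hnormal.mpr hE) h
  · obtain ⟨c, S, η₁, η₂, a, I₀, U, π, ζ, humb, hfr, hI, hI0, hU, hqU, hUD, hπ, hζ, hπ0, hζ0,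
      hbij, hform⟩ := P.exists_parametrization hC hqD' hE
    have hφs : ContMDiffOn (𝓡 (k + 1)) 𝓘(ℝ, EuclideanSpace ℝ (Fin (k + 1))) ∞ φ
        (φ.source ∩ φ ⁻¹' U) :=
      (contMDiffOn_extChartAt (n := ∞)).mono fun u hu => by
        simpa [φ] using hu.1
    refine ⟨w, c, S, η₁, η₂, a, I₀, φ.source ∩ φ ⁻¹' U, humb, hfr, hI, hI0, hopen U hU,
      ⟨mem_extChartAt_source q, hqU⟩, hinj U hUD, (himage U hUD).trans ?_, fun _ =>
      ⟨π ∘ φ, ζ ∘ φ, (contMDiffOn_iff_contDiffOn.mpr hπ).comp hφs fun u hu => hu.2,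
        (contMDiffOn_iff_contDiffOn.mpr hζ).comp hφs fun u hu => hu.2, ?_, hζ0, ?_, ?_⟩⟩
    · rw [← hbij.image_eq, Set.image_image]
      exact Set.image_congr hform
    · rw [Function.comp_apply, hπ0, hval q (mem_extChartAt_source q)]
    · refine hbij.comp (f := φ) ⟨fun u hu => hu.2, φ.injOn.mono Set.inter_subset_left, ?_⟩
      intro v hv
      have hvt := hDt' (hUD hv)
      exact ⟨φ.symm v, ⟨φ.map_target hvt, by rwa [Set.mem_preimage, φ.right_inv hvt]⟩,
        φ.right_inv hvt⟩
    · intro u hu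
      rw [← hval u hu.1]
      exact hform _ hu.2
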